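/- **Setting.** Let $(x,y,t)$ be coordinates on $\mathbb R^{2,1}$, $\xi=\frac{t+x}{2}$, $\eta=\frac{t-x}{2}$, so $\partial_\xi=\partial_t+\partial_x$, $\partial_\eta=\partial_t-\partial_x$. A *monopole* is a smooth $u(n)$-valued pair of a connection $A$ (with $\nabla=\partial-A$) and a Higgs field $\phi$ on $\mathbb R^{2,1}$ which, with all partial derivatives, tends to $0$ as $\|(x,y)\|\to\infty$ for each $t$, and which solves $D_A\phi=*F_A$, i.e. $[\tau(\nabla_y-\phi)-\nabla_\xi,\ \tau\nabla_\eta-\nabla_y-\phi]=0$ for all $\tau$. For an open conjugation-invariant $\Omega\subset\mathbb C$, a *normalized monopole frame* on $\Omega$ is a map $\psi(x,y,t,\tau)\in GL(n,\mathbb C)$, smooth on $\mathbb R^{2,1}\times\Omega$ and holomorphic in $\tau\in\Omega$, such that for some monopole $(A,\phi)$ $$(\tau\partial_y-\partial_\xi)\psi=(\tau A_y+\tau\phi-A_\xi)\psi,\qquad(\tau\partial_\eta-\partial_y)\psi=(\tau A_\eta+\phi-A_y)\psi,$$ $\psi(\cdot,\bar\tau)^*\psi(\cdot,\tau)=\mathrm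 I$, and $\psi(x,y,t,\tau)\to h(\tau)$ as $\|(x,y)\|\to\infty$, locally uniformly in $\tau\in\Omega$, with $h$ independent of $t$. A map $f(x,y,t,\tau)$ has *pole data* $(\alpha,k)$ if it is rational in $\tau$ with coefficients smooth in $(x,y,t)$, has the single pole $\tau=\alpha$, of multiplicity $k$, and satisfies $f(\cdot,\infty)=\mathrm I$ and $f(\cdot,\bar\tau)^*f(\cdot,\tau)=\mathrm I$. (Multiplicity $k$ at $\alpha$ means: the Laurent expansions at $\alpha$ start at $(\tau-\alpha)^{-k}$ or later, and the coefficient of $(\tau-\alpha)^{-k}$ is not identically zero in $(x,y,t)$.) A *$k$-soliton monopole frame with pole data $(\alpha,k)$* is a $g$ with pole data $(\alpha,k)$ for which $(\tau\partial_y g-\partial_\xi g)g^{-1}$ and $(\tau\partial_\eta g-\partial_y g)g^{-1}$ are independent of $\tau$ and decay (with all derivatives) at spatial infinity. **Theorem (subtracting a soliton with pole data $(\alpha,k)$).** Let $\alpha\in\mathbb C\setminus\mathbb R$, $k\ge1$, let $U\ni\alpha$ be open and conjugation-invariant, and let $\psi$ be a normalized monopole frame on $U\setminus\{\alpha,\bar\alpha\}$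 with a pole of multiplicity $k$ at $\tau=\alpha$ and no pole at $\tau=\bar\alpha$. Then there are unique $g,\tilde\psi,\tilde g,\psi_1$ such that $$\psi=\tilde\psi\,g=\tilde g\,\psi_1\quad\text{on }U\setminus\{\alpha,\bar\alpha\},$$ where $g$ is a $k$-soliton monopole frame with pole data $(\alpha,k)$, $\tilde g$ has pole data $(\alpha,k)$, $\psi_1$ is a normalized monopole frame on $U$, and $\tilde\psi$ and $\psi_1$ are holomorphic and nondegenerate at $\tau=\alpha,\bar\alpha$. Moreover $g$ is itself a normalized monopole frame on $\mathbb C\setminus\{\alpha,\bar\alpha\}$ and $\tilde\psi$ is smooth on $\mathbb R^{2,1}\times U$. **Consequence.** Let $\alpha_1,\dots,\alpha_m\in\mathbb C\setminus\mathbb R$ be distinct with $\alpha_i\ne\bar\alpha_j$ for all $i,j$, let $k_j\ge1$, and let $\psi$ be a normalized monopole frame on $\mathbb C\setminus(\mathbb R\cup\{\alpha_j,\bar\alpha_j\}_j)$ with a pole of multiplicity $k_j$ at each $\alpha_j$ and no pole at any $\bar\alpha_j$. Put $E(x,y,t,\mu)=\psi\bigl(x,y,t,\tfrac{i(\mu-1)}{\mu+1}\bigr)$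 and suppose that $\psi$ has continuous scattering data: the limits $E_\pm(x,y,t,e^{i\theta})=\lim_{|\mu|^{\pm1}>1,\ \mu\to e^{i\theta}}E(x,y,t,\mu)$ exist and are smooth, and for all $\theta,t$ the function $r\mapsto \mathrm I-(E_-^{-1}E_+)(r\cos\theta,r\sin\theta,t,e^{i\theta})$ and its derivatives tend to $0$ as $|r|\to\infty$. Then there are a smooth $s:\mathbb R\times S^1\to GL(n,\mathbb C)$ with $s^*=s\ge0$ and $\mathrm I-s(\cdot,e^{i\theta})$ decaying (with all derivatives) for each $\theta$, and soliton monopole frames $\varphi_j$ with pole data $(\alpha_j,k_j)$ that are normalized monopole frames on $\mathbb C\setminus\{\alpha_j,\bar\alpha_j\}$, such that $(E_-^{-1}E_+)(x,y,t,e^{i\theta})=s(x\cos\theta+y\sin\theta-t,e^{i\theta})$ and $\psi\varphi_j^{-1}$ is holomorphic and nondegenerate at $\tau=\alpha_j$ for every $j$. That is, $\psi$ is the dressing of the continuous scattering data $s$ by the solitons $\varphi_j$. -/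

import Mathlib

open Filter Topology Set
open scoped ContDiff Matrix ComplexConjugate ComplexOrder Matrix.Norms.Operator

/-- Complex `n × n` matrices; `star` is the conjugate transpose. The norm is only used to speak
about derivatives and limits. -/
abbrev Mat (n : ℕ) := Matrix (Fin n) (Fin n) ℂ

/-- Points `(x, y, t)` of `ℝ^{2,1}`. -/
abbrev Spacetime := ℝ × ℝ × ℝ

section Derivatives

variable {n : ℕ}

/-- `∂_x`. -/
noncomputable def dX (f : Spacetime → Mat n) (p : Spacetime) : Mat n := fderiv ℝ f p (1, 0, 0)

/-- `∂_y`. -/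
noncomputable def dY (f : Spacetime → Mat n) (p : Spacetime) : Mat n := fderiv ℝ f p (0, 1, 0)

/-- `∂_t`. -/
noncomputable def dT (f : Spacetime → Mat n) (p : Spacetime) : Mat n := fderiv ℝ f p (0, 0, 1)

/-- `∂_ξ = ∂_t + ∂_x`, where `ξ = (t + x) / 2` and `η = (t - x) / 2`. -/
noncomputable def dXi (f : Spacetime → Mat n) (p : Spacetime) : Mat n := dT f p + dX f p

/-- `∂_η = ∂_t - ∂_x`. -/
noncomputable def dEta (f : Spacetime → Mat n) (p : Spacetime) : Mat n := dT f p - dX f p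

/-- Decay at spatial infinity: at every time `t`, the function and all its partial derivatives
tend to `0` as `‖(x, y)‖ → ∞`. -/
def DecaysSpatially (f : Spacetime → Mat n) : Prop :=
  ∀ (m : ℕ) (t : ℝ),
    Tendsto (fun q : ℝ × ℝ => iteratedFDeriv ℝ m f (q.1, q.2, t)) (cocompact (ℝ × ℝ)) (𝓝 0)

/-- Decay of a function of one real variable, together with all its derivatives. -/
def DecaysOnLine (f : ℝ → Mat n) : Prop :=
  ∀ m : ℕ, Tendsto (iteratedDeriv m f) (cocompact ℝ) (𝓝 0)

end Derivatives

/-- A connection `A = A_x dx + A_y dy + A_t dt` (with `∇ = ∂ - A`) and a Higgs field `φ`. -/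
structure GaugePair (n : ℕ) where
  Ax : Spacetime → Mat n
  Ay : Spacetime → Mat n
  At : Spacetime → Mat n
  phi : Spacetime → Mat n

namespace GaugePair

variable {n : ℕ} (M : GaugePair n)

/-- `A_ξ = A_t + A_x`. -/
def Axi (p : Spacetime) : Mat n := M.At p + M.Ax p

/-- `A_η = A_t - A_x`. -/
def Aeta (p : Spacetime) : Mat n := M.At p - M.Ax p

/-- `F_{tx} = [∇_t, ∇_x]`. -/
noncomputable def Ftx (p : Spacetime) : Mat n :=
  -dT M.Ax p + dX M.At p + (M.At p * M.Ax p - M.Ax p * M.At p)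

/-- `F_{yt} = [∇_y, ∇_t]`. -/
noncomputable def Fyt (p : Spacetime) : Mat n :=
  -dY M.At p + dT M.Ay p + (M.Ay p * M.At p - M.At p * M.Ay p)

/-- `F_{yx} = [∇_y, ∇_x]`. -/
noncomputable def Fyx (p : Spacetime) : Mat n :=
  -dY M.Ax p + dX M.Ay p + (M.Ay p * M.Ax p - M.Ax p * M.Ay p)

/-- A smooth `u(n)`-valued solution, decaying at spatial infinity, of the space-time monopole
equation `D_A φ = * F_A` for the metric `dx² + dy² - dt²`. In components this is
`D_x φ = F_{yt}`, `D_y φ = F_{tx}`, `D_t φ = F_{yx}`, equivalently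
`[τ (∇_y - φ) - ∇_ξ, τ ∇_η - ∇_y - φ] = 0` for all `τ`. -/
structure IsMonopole : Prop where
  smooth : ContDiff ℝ ∞ M.Ax ∧ ContDiff ℝ ∞ M.Ay ∧ ContDiff ℝ ∞ M.At ∧ ContDiff ℝ ∞ M.phi
  skew : ∀ p, star (M.Ax p) = -M.Ax p ∧ star (M.Ay p) = -M.Ay p ∧ star (M.At p) = -M.At p ∧
    star (M.phi p) = -M.phi p
  decay : DecaysSpatially M.Ax ∧ DecaysSpatially M.Ay ∧ DecaysSpatially M.At ∧
    DecaysSpatially M.phi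
  eq_x : ∀ p, dX M.phi p - (M.Ax p * M.phi p - M.phi p * M.Ax p) = M.Fyt p
  eq_y : ∀ p, dY M.phi p - (M.Ay p * M.phi p - M.phi p * M.Ay p) = M.Ftx p
  eq_t : ∀ p, dT M.phi p - (M.At p * M.phi p - M.phi p * M.At p) = M.Fyx p

end GaugePair

section Frames

variable {n : ℕ}

/-- `ψ(x, y, t, τ)` is a normalized monopole frame with spectral parameter `τ` in the (open,
conjugation invariant) set `Ω`: it is smooth, holomorphic in `τ`, solves the linear system of some
monopole `(A, φ)`, satisfies the reality condition, and converges at spatial infinity, locally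
uniformly in `τ`, to some `h(τ)` which does not depend on `t`. -/
structure IsNormalizedFrame (Ω : Set ℂ) (ψ : Spacetime → ℂ → Mat n) : Prop where
  smooth : ContDiffOn ℝ ∞ (fun q : Spacetime × ℂ => ψ q.1 q.2) (univ ×ˢ Ω)
  holomorphic : ∀ p, DifferentiableOn ℂ (ψ p) Ω
  linear_system : ∃ M : GaugePair n, M.IsMonopole ∧ ∀ p, ∀ τ ∈ Ω,
    τ • dY (fun q => ψ q τ) p - dXi (fun q => ψ q τ) p
        = (τ • M.Ay p + τ • M.phi p - M.Axi p) * ψ p τ ∧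
      τ • dEta (fun q => ψ q τ) p - dY (fun q => ψ q τ) p
        = (τ • M.Aeta p + M.phi p - M.Ay p) * ψ p τ
  reality : ∀ p, ∀ τ ∈ Ω, star (ψ p (conj τ)) * ψ p τ = 1
  limit : ∃ h : ℂ → Mat n, ∀ t : ℝ,
    TendstoLocallyUniformlyOn (fun (q : ℝ × ℝ) (τ : ℂ) => ψ (q.1, q.2, t) τ) h
      (cocompact (ℝ × ℝ)) Ω

/-- For `ψ` holomorphic in `τ` on a punctured neighbourhood of `α`: `ψ` has a pole of multiplicity
`k` at `τ = α`. The Laurent expansions at `α` start at `(τ - α)^{-k}` or later, and the coefficient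
of `(τ - α)^{-k}`, a function of `(x, y, t)`, does not vanish identically. -/
def HasPole (α : ℂ) (k : ℕ) (ψ : Spacetime → ℂ → Mat n) : Prop :=
  (∀ p, ∃ L, Tendsto (fun τ => (τ - α) ^ k • ψ p τ) (𝓝[≠] α) (𝓝 L)) ∧
    ∃ p, ∃ L, L ≠ 0 ∧ Tendsto (fun τ => (τ - α) ^ k • ψ p τ) (𝓝[≠] α) (𝓝 L)

/-- For `ψ` holomorphic in `τ` on a punctured neighbourhood of `β`: the singularity at `β` is
removable. -/
def HasNoPole (β : ℂ) (ψ : Spacetime → ℂ → Mat n) : Prop :=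
  ∀ p, ∃ L, Tendsto (ψ p) (𝓝[≠] β) (𝓝 L)

/-- `f` is holomorphic and nondegenerate at `τ = β`. -/
def IsRegularAt (β : ℂ) (f : Spacetime → ℂ → Mat n) : Prop :=
  ∀ p, AnalyticAt ℂ (f p) β ∧ IsUnit (f p β)

/-- `f` has pole data `(α, k)`: it is rational in `τ` with coefficients smooth in `(x, y, t)`, its
only pole is `α`, with multiplicity `k`, its value at `τ = ∞` is the identity, and it satisfies the
reality condition. (The value of `f` at `τ = α` is irrelevant.) -/
structure HasPoleData (α : ℂ) (k : ℕ) (f : Spacetime → ℂ → Mat n) : Prop where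
  rational : ∃ c : ℕ → Spacetime → Mat n, (∀ j, ContDiff ℝ ∞ (c j)) ∧ (∃ p, c k p ≠ 0) ∧
    ∀ p τ, τ ≠ α → f p τ = 1 + ∑ j ∈ Finset.Icc 1 k, ((τ - α) ^ j)⁻¹ • c j p
  reality : ∀ p τ, τ ≠ α → τ ≠ conj α → star (f p (conj τ)) * f p τ = 1

/-- A `k`-soliton (Ward) monopole frame with pole data `(α, k)`: in addition
`(τ ∂_y g - ∂_ξ g) g⁻¹ = P` and `(τ ∂_η g - ∂_y g) g⁻¹ = Q` do not depend on `τ` and decay at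
spatial infinity. -/
structure IsSolitonFrame (α : ℂ) (k : ℕ) (g : Spacetime → ℂ → Mat n) : Prop where
  pole_data : HasPoleData α k g
  ward : ∃ P Q : Spacetime → Mat n, DecaysSpatially P ∧ DecaysSpatially Q ∧ ∀ p τ, τ ≠ α →
    τ • dY (fun q => g q τ) p - dXi (fun q => g q τ) p = P p * g p τ ∧
      τ • dEta (fun q => g q τ) p - dY (fun q => g q τ) p = Q p * g p τ

/-- `ψ = ψt g = gt ψ₁`, where `g` is a `k`-soliton frame with pole data `(α, k)`, `gt` is rational
with pole data `(α, k)`, `ψ₁` is a normalized monopole frame on all of `U`, and `ψt`, `ψ₁` are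
holomorphic and nondegenerate at `α` and `conj α`. -/
structure IsSolitonSubtraction (U : Set ℂ) (α : ℂ) (k : ℕ)
    (ψ g ψt gt ψ₁ : Spacetime → ℂ → Mat n) : Prop where
  soliton : IsSolitonFrame α k g
  pole_data : HasPoleData α k gt
  normalized : IsNormalizedFrame U ψ₁
  regular_right : IsRegularAt α ψ₁ ∧ IsRegularAt (conj α) ψ₁
  regular_left : IsRegularAt α ψt ∧ IsRegularAt (conj α) ψt
  eq_left : ∀ p, ∀ τ ∈ U \ {α, conj α}, ψ p τ = ψt p τ * g p τ
  eq_right : ∀ p, ∀ τ ∈ U \ {α, conj α}, ψ p τ = gt p τ * ψ₁ p τ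

end Frames

section ContinuousData

variable {n : ℕ}

/-- The frame in the spectral parameter `μ`, where `τ = i (μ - 1) / (μ + 1)`. The real `τ`-line
corresponds to the unit circle, the upper half plane to `|μ| > 1`. -/
noncomputable def toMu (ψ : Spacetime → ℂ → Mat n) (p : Spacetime) (μ : ℂ) : Mat n :=
  ψ p (Complex.I * (μ - 1) / (μ + 1))

/-- Smoothness of a function on `ℝ^{2,1} × S¹`. -/
def SmoothOnCircle (F : Spacetime → Circle → Mat n) : Prop :=
  ContDiff ℝ ∞ (fun q : Spacetime × ℝ => F q.1 (Circle.exp q.2))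

/-- The nonreal `τ` different from the points `α_j` and their conjugates. -/
def regularDomain {m : ℕ} (α : Fin m → ℂ) : Set ℂ :=
  {τ | τ.im ≠ 0 ∧ ∀ j, τ ≠ α j ∧ τ ≠ conj (α j)}

/-- `ψ` is a normalized monopole frame, holomorphic for nonreal `τ` except for poles at
the distinct points `α_j`, of multiplicity `k_j`, and the limits `Ep`, `Em` of the frame on the unit
circle of the `μ`-plane, from `|μ| > 1` and from `|μ| < 1`, exist and are smooth. -/
structure HasPolesAndJump {m : ℕ} (α : Fin m → ℂ) (k : Fin m → ℕ) (ψ : Spacetime → ℂ → Mat n)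
    (Ep Em : Spacetime → Circle → Mat n) : Prop where
  distinct : Function.Injective α
  nonreal : ∀ j, (α j).im ≠ 0
  not_conj : ∀ i j, α i ≠ conj (α j)
  mult_pos : ∀ j, 1 ≤ k j
  normalized : IsNormalizedFrame (regularDomain α) ψ
  pole : ∀ j, HasPole (α j) (k j) ψ
  no_pole : ∀ j, HasNoPole (conj (α j)) ψ
  smooth_plus : SmoothOnCircle Ep
  smooth_minus : SmoothOnCircle Em
  limit_plus : ∀ p (z : Circle), Tendsto (toMu ψ p) (𝓝[{μ : ℂ | 1 < ‖μ‖}] (z : ℂ)) (𝓝 (Ep p z))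
  limit_minus : ∀ p (z : Circle), Tendsto (toMu ψ p) (𝓝[{μ : ℂ | ‖μ‖ < 1}] (z : ℂ)) (𝓝 (Em p z))

/-- The scattering matrix `E_-⁻¹ E_+` on the unit circle. -/
noncomputable def scatteringMatrix (Ep Em : Spacetime → Circle → Mat n) (p : Spacetime)
    (z : Circle) : Mat n :=
  (Em p z)⁻¹ * Ep p z

/-- Admissible continuous scattering data: a smooth map `s : ℝ × S¹ → GL(n, ℂ)` with
`s* = s ≥ 0` such that `1 - s(·, e^{iθ})` decays for each `θ`. -/
structure IsScatteringDatum (s : ℝ → Circle → Mat n) : Prop where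
  smooth : ContDiff ℝ ∞ (fun q : ℝ × ℝ => s q.1 (Circle.exp q.2))
  invertible : ∀ r z, IsUnit (s r z)
  nonneg : ∀ r z, (s r z).PosSemidef
  decay : ∀ z, DecaysOnLine (fun r => 1 - s r z)

/-- `ψ` is a normalized monopole frame with continuous scattering data `s` and with the discrete
data given by the soliton frames `φ_j` with pole data `(α_j, k_j)`: its scattering matrix is
`s(x cos θ + y sin θ - t, e^{iθ})`, and `ψ φ_j⁻¹` is holomorphic and nondegenerate at `α_j`. -/
def HasScatteringData {m : ℕ} (α : Fin m → ℂ) (k : Fin m → ℕ) (s : ℝ → Circle → Mat n)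
    (φ : Fin m → Spacetime → ℂ → Mat n) (ψ : Spacetime → ℂ → Mat n) : Prop :=
  ∃ Ep Em : Spacetime → Circle → Mat n, HasPolesAndJump α k ψ Ep Em ∧
    (∀ (x y t : ℝ) (z : Circle),
      scatteringMatrix Ep Em (x, y, t) z = s (x * (z : ℂ).re + y * (z : ℂ).im - t) z) ∧
    ∀ j, ∃ F : Spacetime → ℂ → Mat n, IsRegularAt (α j) F ∧
      ∀ p, ∀ᶠ τ in 𝓝[≠] (α j), F p τ = ψ p τ * (φ j p τ)⁻¹

end ContinuousData

/-! Fix a point of spacetime. By reality the inverse of ψ(τ) is ψ(τ̄)*, so the leading coefficient L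
of ψ at α and its value M at ᾱ satisfy L M* = 0. Hence right multiplication by π + (τ-α)/(τ-ᾱ)
(1-π), with π the orthogonal projection onto ker L, lowers the order of the pole at α by one and
creates no pole at ᾱ. After k such steps ψ has been made regular by a real factor 1 + P whose only
pole is ᾱ (`RealPoleAt.exists_factor`); g is its inverse, with its pole at α, and ψt is the regular
product.

The projections may jump with the point, so this construction says nothing about smoothness.
Smoothness comes from uniqueness. Regularity of ψ(1 + P) means that finitely many contour integrals
around α and ᾱ vanish, which is a linear system for the coefficients d of P. A solution of the
homogeneous system makes P(τ̄)*P(τ) entire and zero at infinity, hence zero, and on the real line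
this gives P = 0 (`RealPoleAt.eq_zero_of_hasLimitAt`, `coeffSystem_injective`). The matrix of the
system consists of contour integrals of ψ, so d is smooth; the system of the limit h is injective
too, so d is asymptotically constant as soon as those integrals are, derivatives included
(`IsContourFamily.exists_factor`).

A frame is only assumed to converge at spatial infinity, and the decay of derivatives has to be
extracted from the equations. For nonreal τ, eliminating ∂_t from the two equations leaves a
first-order elliptic operator on the time slices; local L² estimates and Sobolev embedding then give
decay of all derivatives (`VanishesSobolev.of_system`, `isAsympConst_of_linear_system`). The contour
integrals around β solve such a system at τ = β, with an inhomogeneity built from the integral whose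
weight has one more factor τ - β. For a large power the integral is zero, and a descending recursion
reaches the others (`isAsympConst_contour`, `isAsympConst_contour_of_le`).

Liouville's theorem does the rest. The logarithmic derivative of g is regular at α and ᾱ and bounded
at infinity, so it is independent of τ (`soliton_system`); the same argument produces the linear
system of ψ₁ (`left_factor_system`), and the monopole equations are the coefficients in τ of the
compatibility condition (`HasDecayingSystem.exists_isMonopole`). The left factorization is the right
factorization of the transpose. Uniqueness is Liouville for quotients of two candidates.

For the consequence, the first part is applied at each α_j. On the unit circle E_-⁻¹E_+ = E_+*E_+.
The linear system passes to the boundary by the maximum principle (`tendsto_fderiv_boundary`), and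
there, up to a common scalar, it has real coefficients and skew-Hermitian matrices. Two independent
real directions therefore annihilate E_+*E_+, which leaves a function of x cos θ + y sin θ - t. -/

set_option linter.unusedSectionVars false

/-- The topology of the operator norm; it agrees with the product topology, but only up to
unfolding of the norm. -/
noncomputable instance Mat.instTopologicalSpaceOfNorm (n : ℕ) : TopologicalSpace (Mat n) :=
  (inferInstance : NormedAddCommGroup (Mat n)).toPseudoMetricSpace.toUniformSpace.toTopologicalSpace

instance Mat.instContinuousStarOfNorm (n : ℕ) : ContinuousStar (Mat n) where
  continuous_star :=
    (instContinuousStarMatrix (m := Fin n) (R := ℂ)).continuous_star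

/-! ### Removable singularities, Liouville's theorem and contour criteria. -/

section RemovableSingularities

variable {E : Type*} [NormedAddCommGroup E] [NormedSpace ℂ E]

/-- `f` has a limit at `β` along the punctured neighbourhoods. -/
def HasLimitAt (β : ℂ) (f : ℂ → E) : Prop := ∃ L, Tendsto f (𝓝[≠] β) (𝓝 L)

theorem HasLimitAt.congr' {β : ℂ} {f g : ℂ → E} (hf : HasLimitAt β f)
    (h : f =ᶠ[𝓝[≠] β] g) : HasLimitAt β g := by
  obtain ⟨L, hL⟩ := hf
  exact ⟨L, hL.congr' h⟩

theorem ContinuousAt.hasLimitAt {β : ℂ} {f : ℂ → E} (hf : ContinuousAt f β) : HasLimitAt β f :=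
  ⟨f β, hf.tendsto.mono_left nhdsWithin_le_nhds⟩

theorem HasLimitAt.add {β : ℂ} {f g : ℂ → E} (hf : HasLimitAt β f) (hg : HasLimitAt β g) :
    HasLimitAt β (fun z => f z + g z) := by
  obtain ⟨L, hL⟩ := hf
  obtain ⟨M, hM⟩ := hg
  exact ⟨L + M, hL.add hM⟩

theorem HasLimitAt.smul {β : ℂ} {f : ℂ → E} {c : ℂ → ℂ} (hc : HasLimitAt β c)
    (hf : HasLimitAt β f) : HasLimitAt β (fun z => c z • f z) := by
  obtain ⟨L, hL⟩ := hf
  obtain ⟨M, hM⟩ := hc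
  exact ⟨M • L, hM.smul hL⟩

theorem HasLimitAt.mul {A : Type*} [NormedRing A] [NormedAlgebra ℂ A] {β : ℂ} {f g : ℂ → A}
    (hf : HasLimitAt β f) (hg : HasLimitAt β g) : HasLimitAt β (fun z => f z * g z) := by
  obtain ⟨L, hL⟩ := hf
  obtain ⟨M, hM⟩ := hg
  exact ⟨L * M, hL.mul hM⟩

theorem tendsto_conj_punctured (β : ℂ) :
    Tendsto (fun z : ℂ => conj z) (𝓝[≠] β) (𝓝[≠] (conj β)) := by
  apply tendsto_nhdsWithin_of_tendsto_nhds_of_eventually_within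
  · exact (Complex.continuous_conj.tendsto β).mono_left nhdsWithin_le_nhds
  · filter_upwards [self_mem_nhdsWithin] with z hz
    exact fun h => hz ((starRingEnd ℂ).injective h)

variable [CompleteSpace E]

theorem differentiableAt_update_of_tendsto {β : ℂ} {f : ℂ → E} {L : E}
    (hd : ∀ᶠ z in 𝓝[≠] β, DifferentiableAt ℂ f z) (hL : Tendsto f (𝓝[≠] β) (𝓝 L)) :
    DifferentiableAt ℂ (Function.update f β L) β := by
  apply AnalyticAt.differentiableAt
  apply Complex.analyticAt_of_differentiable_on_punctured_nhds_of_continuousAt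
  · filter_upwards [hd, self_mem_nhdsWithin] with z hz hne
    refine hz.congr_of_eventuallyEq ?_
    filter_upwards [isOpen_ne.mem_nhds hne] with w hw
    exact Function.update_of_ne hw _ _
  · rw [continuousAt_update_same]
    exact hL

theorem differentiableAt_update_of_ne {β z : ℂ} {f : ℂ → E} {L : E} (hne : z ≠ β)
    (hz : DifferentiableAt ℂ f z) : DifferentiableAt ℂ (Function.update f β L) z := by
  refine hz.congr_of_eventuallyEq ?_
  filter_upwards [isOpen_ne.mem_nhds hne] with w hw
  exact Function.update_of_ne hw _ _

/-- Liouville's theorem for functions with two removable singularities. -/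
theorem eq_of_tendsto_cocompact_of_hasLimitAt {α β : ℂ} {f : ℂ → E} {c : E}
    (hd : ∀ z, z ≠ α → z ≠ β → DifferentiableAt ℂ f z) (hα : HasLimitAt α f)
    (hβ : HasLimitAt β f) (hc : Tendsto f (cocompact ℂ) (𝓝 c)) {z : ℂ} (h1 : z ≠ α)
    (h2 : z ≠ β) : f z = c := by
  obtain ⟨L, hL⟩ := hα
  obtain ⟨M, hM⟩ := hβ
  have ne_ev : ∀ a b : ℂ, ∀ᶠ w in 𝓝[≠] a, w ≠ b := by
    intro a b
    by_cases h : a = b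
    · subst h; exact self_mem_nhdsWithin
    · exact nhdsWithin_le_nhds (isOpen_ne.mem_nhds h)
  set F := Function.update (Function.update f α L) β M with hF
  have e1 : ∀ w, w ≠ α → w ≠ β → F w = f w := by
    intro w h1 h2
    rw [hF, Function.update_of_ne h2, Function.update_of_ne h1]
  have hdiff : Differentiable ℂ F := by
    intro w
    by_cases hwβ : w = β
    · subst hwβ
      apply differentiableAt_update_of_tendsto
      · filter_upwards [self_mem_nhdsWithin, ne_ev w α] with u hu1 hu2
        exact differentiableAt_update_of_ne hu2 (hd u hu2 hu1)
      · refine hM.congr' ?_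
        filter_upwards [ne_ev w α] with u hu
        exact (Function.update_of_ne hu _ _).symm
    · apply differentiableAt_update_of_ne hwβ
      by_cases hwα : w = α
      · subst hwα
        apply differentiableAt_update_of_tendsto _ hL
        filter_upwards [self_mem_nhdsWithin, ne_ev w β] with u hu1 hu2
        exact hd u hu1 hu2
      · exact differentiableAt_update_of_ne hwα (hd w hwα hwβ)
  have hlim : Tendsto F (cocompact ℂ) (𝓝 c) := by
    refine hc.congr' ?_
    have : ({α, β} : Set ℂ)ᶜ ∈ cocompact ℂ := (Set.toFinite {α, β}).isCompact.compl_mem_cocompact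
    filter_upwards [this] with w hw
    simp only [mem_compl_iff, mem_insert_iff, mem_singleton_iff, not_or] at hw
    exact (e1 w hw.1 hw.2).symm
  rw [← e1 z h1 h2]
  exact hdiff.apply_eq_of_tendsto_cocompact _ hlim

theorem circleIntegral_eq_zero_of_hasLimitAt {β : ℂ} {r : ℝ} (hr : 0 < r) {f : ℂ → E}
    (hd : ∀ z ∈ Metric.closedBall β r, z ≠ β → DifferentiableAt ℂ f z) (hf : HasLimitAt β f) :
    ∮ z in C(β, r), f z = 0 := by
  obtain ⟨L, hL⟩ := hf
  have hev : ∀ᶠ z in 𝓝[≠] β, DifferentiableAt ℂ f z := by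
    filter_upwards [nhdsWithin_le_nhds (Metric.closedBall_mem_nhds β hr), self_mem_nhdsWithin]
      with z h1 h2 using hd z h1 h2
  have hD : DifferentiableOn ℂ (Function.update f β L) (Metric.closedBall β r) := by
    intro z hz
    apply DifferentiableAt.differentiableWithinAt
    by_cases h : z = β
    · subst h; exact differentiableAt_update_of_tendsto hev hL
    · exact differentiableAt_update_of_ne h (hd z hz h)
  have h0 : ∮ z in C(β, r), Function.update f β L z = 0 :=
    Complex.circleIntegral_eq_zero_of_differentiable_on_off_countable hr.le countable_empty
      hD.continuousOn (fun z hz =>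
        hD.differentiableAt (Metric.closedBall_mem_nhds_of_mem hz.1))
  rw [← h0]
  apply circleIntegral.integral_congr hr.le
  intro z hz
  have : z ≠ β := by
    rintro rfl
    simp at hz
    exact hr.ne hz
  exact (Function.update_of_ne this _ _).symm

/-- If `(z - β) ^ (k + 1) f` is regular at `β` and the Laurent coefficient of order `-(k + 1)` of `f`
vanishes, then `(z - β) ^ k f` is regular. -/
theorem HasLimitAt.of_circleIntegral_eq_zero {β : ℂ} {r : ℝ} (hr : 0 < r) {f : ℂ → E} {k : ℕ}
    (hd : ∀ z ∈ Metric.closedBall β r, z ≠ β → DifferentiableAt ℂ f z)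
    (hf : HasLimitAt β (fun z => (z - β) ^ (k + 1) • f z))
    (h0 : ∮ z in C(β, r), (z - β) ^ k • f z = 0) : HasLimitAt β (fun z => (z - β) ^ k • f z) := by
  obtain ⟨L, hL⟩ := hf
  have hdF : ∀ z ∈ Metric.closedBall β r, z ≠ β →
      DifferentiableAt ℂ (fun z => (z - β) ^ (k + 1) • f z) z := by
    intro z hz hne
    exact ((differentiableAt_id.sub_const β).pow _).smul (hd z hz hne)
  have hint := Complex.circleIntegral_sub_center_inv_smul_of_differentiable_on_off_countable_of_tendsto
    hr countable_empty (f := fun z => (z - β) ^ (k + 1) • f z) (c := β) (y := L)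
    (fun z hz => (hdF z hz.1 hz.2).continuousAt.continuousWithinAt)
    (fun z hz => hdF z (Metric.ball_subset_closedBall hz.1.1) hz.1.2) hL
  -- Cauchy's formula at the centre evaluates the vanishing contour integral as 2πi L.
  have hL0 : L = 0 := by
    have : ∮ z in C(β, r), (z - β)⁻¹ • (z - β) ^ (k + 1) • f z = 0 := by
      rw [← h0]
      apply circleIntegral.integral_congr hr.le
      intro z hz
      have : z - β ≠ 0 := by
        rw [sub_ne_zero]
        rintro rfl
        simp at hz
        exact hr.ne hz
      simp only [smul_smul]
      congr 1
      field_simp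
      ring
    rw [this] at hint
    have h2 : (2 * (Real.pi : ℂ) * Complex.I) ≠ 0 := Complex.two_pi_I_ne_zero
    exact (smul_eq_zero.mp hint.symm).resolve_left h2
  subst hL0
  have hev : ∀ᶠ z in 𝓝[≠] β, DifferentiableAt ℂ (fun z => (z - β) ^ (k + 1) • f z) z := by
    filter_upwards [nhdsWithin_le_nhds (Metric.closedBall_mem_nhds β hr), self_mem_nhdsWithin]
      with z h1 h2 using hdF z h1 h2
  -- The extension by 0 is differentiable at β, and its slope there is (z - β)^k f.
  have hdiff := (differentiableAt_update_of_tendsto hev hL).hasDerivAt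
  rw [hasDerivAt_iff_tendsto_slope] at hdiff
  refine ⟨_, hdiff.congr' ?_⟩
  filter_upwards [self_mem_nhdsWithin] with z hz
  have hz' : z - β ≠ 0 := sub_ne_zero.mpr hz
  rw [slope_def_module, Function.update_self, Function.update_of_ne hz, sub_zero, smul_smul]
  congr 1
  field_simp
  ring

/-- The integrals are the Laurent coefficients of negative order, removed one at a time from the
top. This turns regularity into finitely many linear conditions on `f`. -/
theorem hasLimitAt_of_circleIntegrals_eq_zero {β : ℂ} {r : ℝ} (hr : 0 < r) {f : ℂ → E} {k : ℕ}
    (hd : ∀ z ∈ Metric.closedBall β r, z ≠ β → DifferentiableAt ℂ f z)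
    (hf : HasLimitAt β (fun z => (z - β) ^ k • f z))
    (h0 : ∀ j < k, ∮ z in C(β, r), (z - β) ^ j • f z = 0) : HasLimitAt β f := by
  induction k with
  | zero => simpa using hf
  | succ k ih =>
    exact ih (hf.of_circleIntegral_eq_zero hr hd (h0 k (Nat.lt_succ_self k)))
      (fun j hj => h0 j (hj.trans (Nat.lt_succ_self k)))

theorem circleIntegral_pow_smul_eq_zero {β : ℂ} {r : ℝ} (hr : 0 < r) {f : ℂ → E}
    (hd : ∀ z ∈ Metric.closedBall β r, z ≠ β → DifferentiableAt ℂ f z) (hf : HasLimitAt β f)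
    {w : ℂ → ℂ} (hw : ∀ z ∈ Metric.closedBall β r, DifferentiableAt ℂ w z) :
    ∮ z in C(β, r), w z • f z = 0 := by
  apply circleIntegral_eq_zero_of_hasLimitAt hr
  · intro z hz hne
    exact (hw z hz).smul (hd z hz hne)
  · exact (hw β (Metric.mem_closedBall_self hr.le)).continuousAt.hasLimitAt.smul hf

end RemovableSingularities

/-! ### Polar parts at a single point. -/

section PolarSums

variable {n k : ℕ}

/-- The polar part `∑ (z - β)^{-(i + 1)} d i`. -/
noncomputable def polarSum (β : ℂ) (d : Fin k → Mat n) (z : ℂ) : Mat n :=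
  ∑ i : Fin k, ((z - β) ^ (i.val + 1))⁻¹ • d i

theorem star_polarSum (β : ℂ) (d : Fin k → Mat n) (z : ℂ) :
    star (polarSum β d (conj z)) = polarSum (conj β) (fun i => star (d i)) z := by
  simp [polarSum, star_sum, star_smul]

theorem differentiableAt_polarSum {β : ℂ} (d : Fin k → Mat n) {z : ℂ} (hz : z ≠ β) :
    DifferentiableAt ℂ (polarSum β d) z := by
  unfold polarSum
  have h : z - β ≠ 0 := sub_ne_zero.mpr hz
  fun_prop (disch := exact pow_ne_zero _ h)

theorem tendsto_sub_const_inv_cocompact (β : ℂ) :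
    Tendsto (fun z : ℂ => (z - β)⁻¹) (cocompact ℂ) (𝓝 0) := by
  rw [← Metric.cobounded_eq_cocompact]
  exact tendsto_inv₀_cobounded.comp (tendsto_sub_const_cobounded β)

theorem tendsto_polarSum_cocompact (β : ℂ) (d : Fin k → Mat n) :
    Tendsto (polarSum β d) (cocompact ℂ) (𝓝 0) := by
  unfold polarSum
  have h : ∀ i : Fin k, Tendsto (fun z : ℂ => ((z - β) ^ (i.val + 1))⁻¹ • d i) (cocompact ℂ)
      (𝓝 0) := by
    intro i
    have := ((tendsto_sub_const_inv_cocompact β).pow (i.val + 1)).smul_const (d i)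
    simpa [inv_pow] using this
  simpa using tendsto_finsetSum Finset.univ (fun i _ => h i)

theorem polarSum_succ {β : ℂ} (d : Fin (k + 1) → Mat n) (z : ℂ) :
    polarSum β d z = (z - β)⁻¹ • (d 0 + polarSum β (fun i => d i.succ) z) := by
  simp only [polarSum, Fin.sum_univ_succ, smul_add, Finset.smul_sum, smul_smul]
  simp [pow_succ, mul_comm]

theorem tendsto_ofReal_cocompact :
    Tendsto (fun x : ℝ => (x : ℂ)) atTop (cocompact ℂ) := by
  rw [← Metric.cobounded_eq_cocompact, ← tendsto_norm_atTop_iff_cobounded]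
  exact tendsto_atTop_mono (fun x => by simpa using le_abs_self x) tendsto_id

/-- Multiplying by x - β and letting x tend to infinity isolates the coefficient of the simple pole;
what remains is a shorter polar part. -/
theorem eq_zero_of_polarSum_real {β : ℂ} (hβ : β.im ≠ 0) (d : Fin k → Mat n)
    (h : ∀ x : ℝ, polarSum β d x = 0) : d = 0 := by
  induction k with
  | zero => exact Subsingleton.elim _ _
  | succ k ih =>
    have hx : ∀ x : ℝ, (x : ℂ) - β ≠ 0 := by
      intro x hx
      apply hβ
      have := congrArg Complex.im hx
      simpa using this
    have h1 : ∀ x : ℝ, d 0 + polarSum β (fun i => d i.succ) x = 0 := by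
      intro x
      have := h x
      rw [polarSum_succ] at this
      exact (smul_eq_zero.mp this).resolve_left (inv_ne_zero (hx x))
    have h0 : d 0 = 0 := by
      have t1 := ((tendsto_polarSum_cocompact β (fun i : Fin k => d i.succ)).comp
        tendsto_ofReal_cocompact).const_add (d 0)
      simp only [Function.comp_def, h1, add_zero] at t1
      exact tendsto_nhds_unique t1 tendsto_const_nhds |>.symm ▸ rfl
    have h2 := ih (fun i => d i.succ) (fun x => by simpa [h0] using h1 x)
    funext i
    refine Fin.cases h0 (fun j => congrFun h2 j) i

/-- Both factors have their pole at the same β, so the product is again 1 plus a polar part, with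
one more coefficient. The `Fin.snoc` term keeps the old coefficients in place; multiplication by (z
- β)⁻¹ e shifts them by one order, hence `Fin.cons`, whose leading 1 comes from the constant term.
-/
theorem one_add_smul_mul_one_add_polarSum (β : ℂ) (e : Mat n) (d : Fin k → Mat n) (z : ℂ) :
    (1 + (z - β)⁻¹ • e) * (1 + polarSum β d z) =
      1 + polarSum β
        (fun j => (Fin.snoc d 0 : Fin (k + 1) → Mat n) j +
          e * (Fin.cons 1 d : Fin (k + 1) → Mat n) j) z := by
  have h1 : polarSum β (fun j => (Fin.snoc d 0 : Fin (k + 1) → Mat n) j +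
        e * (Fin.cons 1 d : Fin (k + 1) → Mat n) j) z
      = polarSum β (Fin.snoc d 0 : Fin (k + 1) → Mat n) z +
        polarSum β (fun j => e * (Fin.cons 1 d : Fin (k + 1) → Mat n) j) z := by
    simp [polarSum, smul_add, Finset.sum_add_distrib]
  have h2 : polarSum β (Fin.snoc d 0 : Fin (k + 1) → Mat n) z = polarSum β d z := by
    simp [polarSum, Fin.sum_univ_castSucc]
  have h3 : polarSum β (fun j => e * (Fin.cons 1 d : Fin (k + 1) → Mat n) j) z
      = (z - β)⁻¹ • e + ((z - β)⁻¹ • e) * polarSum β d z := by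
    rw [polarSum_succ]
    simp [polarSum, Finset.mul_sum, smul_add, Finset.smul_sum, smul_comm (z - β)⁻¹]
  rw [h1, h2, h3]
  noncomm_ring

theorem polarSum_eq_sum_Icc (β : ℂ) (c : ℕ → Mat n) (z : ℂ) :
    polarSum β (fun i : Fin k => c (i.val + 1)) z =
      ∑ j ∈ Finset.Icc 1 k, ((z - β) ^ j)⁻¹ • c j := by
  rw [polarSum, Finset.sum_fin_eq_sum_range, Finset.range_eq_Ico,
    show Finset.Icc 1 k = Finset.Ico (0 + 1) (k + 1) by rw [zero_add]; rfl,
    ← Finset.sum_Ico_add']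
  apply Finset.sum_congr rfl
  intro i hi
  simp only [Finset.mem_Ico] at hi
  simp [hi.2]

end PolarSums

/-! ### Pointwise clearing of the pole by a real rational factor. -/

section Factorization

variable {n k : ℕ}

/-- Orthogonal projection, obtained by viewing matrices as operators on Euclidean space. The last
clause applies to matrices all of whose columns lie in the kernel. -/
theorem exists_projection_onto_ker (L : Mat n) :
    ∃ π : Mat n, star π = π ∧ π * π = π ∧ L * π = 0 ∧ ∀ X, L * X = 0 → π * X = X := by
  let φ : Mat n ≃⋆ₐ[ℂ] (EuclideanSpace ℂ (Fin n) →L[ℂ] EuclideanSpace ℂ (Fin n)) :=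
    Matrix.toEuclideanCLM
  let K : Submodule ℂ (EuclideanSpace ℂ (Fin n)) := LinearMap.ker (φ L).toLinearMap
  obtain ⟨π, hπ⟩ : ∃ π, φ π = K.starProjection := φ.surjective _
  have hinj : ∀ A B, φ A = φ B → A = B := fun A B h => φ.injective h
  have hstar : ∀ A, φ (star A) = star (φ A) := fun A => φ.map_star' A
  have hmul : ∀ A B, φ (A * B) = φ A * φ B := fun A B => φ.map_mul' A B
  have hzero : φ 0 = 0 := by
    have h : φ (0 + 0) = φ 0 + φ 0 := φ.map_add' 0 0
    rwa [add_zero, left_eq_add] at h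
  refine ⟨π, hinj _ _ ?_, hinj _ _ ?_, hinj _ _ ?_, fun X hX => hinj _ _ ?_⟩
  · rw [hstar, hπ]
    exact isSelfAdjoint_starProjection K
  · rw [hmul, hπ]
    exact K.isIdempotentElem_starProjection
  · rw [hmul, hπ, hzero]
    ext1 v
    exact (K.starProjection_apply_mem v : K.starProjection v ∈ K)
  · rw [hmul, hπ]
    ext1 v
    apply Submodule.starProjection_eq_self_iff.mpr
    have : φ L * φ X = 0 := by rw [← hmul, hX, hzero]
    exact congrArg (fun T => T v) this

/-- `f` is holomorphic on punctured neighbourhoods of `α` and `conj α`, has a pole of order at most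
`k` at `α`, is regular at `conj α`, and satisfies the reality condition. -/
structure RealPoleAt (α : ℂ) (k : ℕ) (f : ℂ → Mat n) : Prop where
  diff : ∀ᶠ z in 𝓝[≠] α, DifferentiableAt ℂ f z
  diff_conj : ∀ᶠ z in 𝓝[≠] (conj α), DifferentiableAt ℂ f z
  pole : HasLimitAt α (fun z => (z - α) ^ k • f z)
  no_pole : HasLimitAt (conj α) f
  real : ∀ᶠ z in 𝓝[≠] α, star (f (conj z)) * f z = 1

theorem ne_conj_of_im_ne_zero {α : ℂ} (h : α.im ≠ 0) : α ≠ conj α := fun h' =>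
  h (Complex.conj_eq_iff_im.mp h'.symm)

theorem RealPoleAt.real_conj {α : ℂ} {f : ℂ → Mat n} (h : RealPoleAt α k f) :
    ∀ᶠ z in 𝓝[≠] (conj α), star (f (conj z)) * f z = 1 := by
  have := tendsto_conj_punctured (conj α)
  rw [Complex.conj_conj] at this
  filter_upwards [this.eventually h.real] with z hz
  rw [Complex.conj_conj] at hz
  simpa using congrArg star hz

theorem HasLimitAt.star_conj {β : ℂ} {f : ℂ → Mat n} (hf : HasLimitAt (conj β) f) :
    HasLimitAt β (fun z => star (f (conj z))) := by
  obtain ⟨L, hL⟩ := hf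
  exact ⟨star L, (hL.comp (tendsto_conj_punctured β)).star⟩

theorem hasLimitAt_inv_smul {E : Type*} [NormedAddCommGroup E] [NormedSpace ℂ E]
    [CompleteSpace E] {β : ℂ} {f : ℂ → E} (hd : ∀ᶠ z in 𝓝[≠] β, DifferentiableAt ℂ f z)
    (h0 : Tendsto f (𝓝[≠] β) (𝓝 0)) : HasLimitAt β (fun z => (z - β)⁻¹ • f z) := by
  have hdiff := (differentiableAt_update_of_tendsto hd h0).hasDerivAt
  rw [hasDerivAt_iff_tendsto_slope] at hdiff
  refine ⟨_, hdiff.congr' ?_⟩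
  filter_upwards [self_mem_nhdsWithin] with z hz
  rw [slope_def_module, Function.update_self, Function.update_of_ne hz, sub_zero]

/-- Induction on the order of the pole. With L the leading coefficient at α, M the value at ᾱ and π
the projection onto ker L, multiply by s = π + (z-α)/(z-ᾱ) (1-π). At α the first summand gains a
zero because L π = 0 and the second carries the factor z - α. At ᾱ the pole of s is cancelled
because M (1 - π) = 0. Since s is real, the product satisfies the hypotheses with k in place of k +
1. -/
theorem RealPoleAt.exists_factor {α : ℂ} (hα : α.im ≠ 0) {f : ℂ → Mat n}
    (h : RealPoleAt α k f) : ∃ d : Fin k → Mat n,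
      HasLimitAt α (fun z => f z * (1 + polarSum (conj α) d z)) ∧
      HasLimitAt (conj α) (fun z => f z * (1 + polarSum (conj α) d z)) ∧
      ∀ z, z ≠ α → z ≠ conj α →
        star (1 + polarSum (conj α) d (conj z)) * (1 + polarSum (conj α) d z) = 1 := by
  induction k generalizing f with
  | zero =>
    refine ⟨0, ?_, ?_, ?_⟩
    · simpa [polarSum] using h.pole
    · simpa [polarSum] using h.no_pole
    · intro z _ _
      simp [polarSum]
  | succ k ih =>
    obtain ⟨L, hL⟩ := h.pole
    obtain ⟨M, hM⟩ := h.no_pole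
    obtain ⟨π, hπ1, hπ2, hπ3, hπ4⟩ := exists_projection_onto_ker L
    have hne := ne_conj_of_im_ne_zero hα
    -- Multiply f(z) f(z̄)* = 1 by (z - α)^(k+1) and let z tend to α.
    have hLM : L * star M = 0 := by
      have t1 : Tendsto (fun z => ((z - α) ^ (k + 1) • f z) * star (f (conj z))) (𝓝[≠] α)
          (𝓝 (L * star M)) := hL.mul ((hM.comp (tendsto_conj_punctured α)).star)
      have t2 : Tendsto (fun z : ℂ => (z - α) ^ (k + 1) • (1 : Mat n)) (𝓝[≠] α) (𝓝 0) := by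
        have : ContinuousAt (fun z : ℂ => (z - α) ^ (k + 1) • (1 : Mat n)) α := by fun_prop
        have := this.tendsto.mono_left (nhdsWithin_le_nhds (s := {α}ᶜ))
        simpa using this
      refine tendsto_nhds_unique (t1.congr' ?_) t2
      filter_upwards [h.real] with z hz
      rw [smul_mul_assoc, mul_eq_one_comm.mp hz]
    have hMπ : M * (1 - π) = 0 := by
      have := congrArg star (hπ4 _ hLM)
      rw [star_mul, star_star, hπ1] at this
      rw [mul_sub, mul_one, this, sub_self]
    -- Chosen because (z-α)/(z-ᾱ) = 1 + (ᾱ-α)/(z-ᾱ), so that 1 + (z-ᾱ)⁻¹ e is the factor s.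
    set e : Mat n := (conj α - α) • (1 - π) with he
    set s : ℂ → Mat n := fun z => 1 + (z - conj α)⁻¹ • e with hs
    have hse : ∀ z, z ≠ conj α → s z = π + ((z - α) * (z - conj α)⁻¹) • (1 - π) := by
      intro z hz
      have hz' : z - conj α ≠ 0 := sub_ne_zero.mpr hz
      have : (z - α) * (z - conj α)⁻¹ = 1 + (z - conj α)⁻¹ * (conj α - α) := by
        field_simp; ring
      rw [hs, he]
      simp only
      rw [this, add_smul, smul_smul, one_smul]
      abel
    have hsdiff : ∀ z, z ≠ conj α → DifferentiableAt ℂ s z := by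
      intro z hz
      have hz' : z - conj α ≠ 0 := sub_ne_zero.mpr hz
      rw [hs]
      fun_prop (disch := exact hz')
    have hsreal : ∀ z, z ≠ α → z ≠ conj α → star (s (conj z)) * s z = 1 := by
      intro z h1 h2
      have h3 : conj z ≠ conj α := fun hh => h1 ((starRingEnd ℂ).injective hh)
      have h1' : z - α ≠ 0 := sub_ne_zero.mpr h1
      have h2' : z - conj α ≠ 0 := sub_ne_zero.mpr h2
      rw [hse z h2, hse _ h3]
      have hp : π * (1 - π) = 0 := by rw [mul_sub, mul_one, hπ2, sub_self]
      have hp' : (1 - π) * π = 0 := by rw [sub_mul, one_mul, hπ2, sub_self]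
      have hpp : (1 - π) * (1 - π) = 1 - π := by rw [sub_mul, one_mul, hp, sub_zero]
      rw [star_add, hπ1, star_smul, star_sub, star_one, hπ1]
      simp only [add_mul, mul_add, smul_mul_assoc, mul_smul_comm, hπ2, hp, hp', hpp, smul_zero,
        zero_add, add_zero, smul_smul]
      have : (z - α) * (z - conj α)⁻¹ * star ((conj z - α) * (conj z - conj α)⁻¹) = 1 := by
        simp
        field_simp
      rw [mul_comm] at this
      first
        | rw [this, one_smul, add_sub_cancel]
        | (rw [mul_comm, this, one_smul, add_sub_cancel])
    have near : ∀ a b : ℂ, a ≠ b → ∀ᶠ w in 𝓝[≠] a, w ≠ b := fun a b hab =>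
      nhdsWithin_le_nhds (isOpen_ne.mem_nhds hab)
    have h1 : RealPoleAt α k (fun z => f z * s z) := by
      refine ⟨?_, ?_, ?_, ?_, ?_⟩
      · filter_upwards [h.diff, near α _ hne] with z hz hz'
        exact hz.mul (hsdiff z hz')
      · filter_upwards [h.diff_conj, self_mem_nhdsWithin] with z hz hz'
        exact hz.mul (hsdiff z hz')
      · have t1 : HasLimitAt α (fun z => (z - α)⁻¹ • ((z - α) ^ (k + 1) • f z * π)) := by
          apply hasLimitAt_inv_smul
          · filter_upwards [h.diff] with z hz
            exact ((((differentiableAt_id.sub_const α).pow _).smul hz)).mul_const π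
          · simpa [hπ3] using hL.mul_const π
        have t2 : HasLimitAt α (fun z => (z - conj α)⁻¹ • ((z - α) ^ (k + 1) • f z * (1 - π))) := by
          apply HasLimitAt.smul
          · apply ContinuousAt.hasLimitAt
            have : α - conj α ≠ 0 := sub_ne_zero.mpr hne
            fun_prop (disch := exact this)
          · exact ⟨_, hL.mul_const _⟩
        refine (t1.add t2).congr' ?_
        filter_upwards [self_mem_nhdsWithin, near α _ hne] with z hz hz'
        have hz0 : z - α ≠ 0 := sub_ne_zero.mpr hz
        rw [hse z hz', mul_add, smul_add]
        congr 1
        · rw [smul_mul_assoc, smul_smul]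
          congr 1
          field_simp
          ring
        · rw [smul_mul_assoc, smul_smul, mul_smul_comm, smul_smul]
          congr 1
          ring
      · have t1 : HasLimitAt (conj α) (fun z => f z * π) := ⟨_, hM.mul_const π⟩
        have t2 : HasLimitAt (conj α) (fun z => (z - conj α)⁻¹ • (f z * (1 - π))) := by
          apply hasLimitAt_inv_smul
          · filter_upwards [h.diff_conj] with z hz
            exact hz.mul_const _
          · simpa [hMπ] using hM.mul_const (1 - π)
        have t3 : HasLimitAt (conj α) (fun z : ℂ => z - α) := by
          apply ContinuousAt.hasLimitAt
          fun_prop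
        refine (t1.add (t3.smul t2)).congr' ?_
        filter_upwards [self_mem_nhdsWithin] with z hz
        rw [hse z hz, mul_add, smul_smul, mul_smul_comm]
      · filter_upwards [h.real, self_mem_nhdsWithin, near α _ hne] with z hz hz1 hz2
        rw [star_mul]
        calc star (s (conj z)) * star (f (conj z)) * (f z * s z)
            = star (s (conj z)) * (star (f (conj z)) * f z) * s z := by noncomm_ring
          _ = 1 := by rw [hz, mul_one, hsreal z hz1 hz2]
    obtain ⟨d, hd1, hd2, hd3⟩ := ih h1
    refine ⟨fun j => (Fin.snoc d 0 : Fin (k + 1) → Mat n) j +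
          e * (Fin.cons 1 d : Fin (k + 1) → Mat n) j, ?_, ?_, ?_⟩
    · simp only [← one_add_smul_mul_one_add_polarSum, ← mul_assoc]
      exact hd1
    · simp only [← one_add_smul_mul_one_add_polarSum, ← mul_assoc]
      exact hd2
    · intro z hz1 hz2
      simp only [← one_add_smul_mul_one_add_polarSum]
      rw [star_mul]
      have h5 := hsreal z hz1 hz2
      rw [hs] at h5
      simp only at h5
      rw [mul_assoc, ← mul_assoc (star (1 + (conj z - conj α)⁻¹ • e)), h5, one_mul]
      exact hd3 z hz1 hz2

/-- By reality f cancels from (fP)(z̄)* (fP)(z), leaving P(z̄)* P(z). The former is regular at α and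
ᾱ, the latter vanishes at infinity, so Liouville makes it zero. On the real line it is the Gram
matrix of P(x), which therefore vanishes. -/
theorem RealPoleAt.eq_zero_of_hasLimitAt {l : ℕ} {α : ℂ} (hα : α.im ≠ 0) {f : ℂ → Mat n}
    (h : RealPoleAt α l f) {d : Fin k → Mat n}
    (h1 : HasLimitAt α (fun z => f z * polarSum (conj α) d z))
    (h2 : HasLimitAt (conj α) (fun z => f z * polarSum (conj α) d z)) : d = 0 := by
  have hreal : ∀ z : ℂ, star (f (conj z)) * f z = 1 →
      star (f (conj z) * polarSum (conj α) d (conj z)) * (f z * polarSum (conj α) d z) =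
      star (polarSum (conj α) d (conj z)) * polarSum (conj α) d z := by
    intro z hz
    rw [star_mul, mul_assoc, ← mul_assoc (star (f (conj z))), hz, one_mul]
  have key : ∀ z, z ≠ α → z ≠ conj α →
      star (polarSum (conj α) d (conj z)) * polarSum (conj α) d z = 0 := by
    intro z hz1 hz2
    refine eq_of_tendsto_cocompact_of_hasLimitAt (α := α) (β := conj α)
      (f := fun z => star (polarSum (conj α) d (conj z)) * polarSum (conj α) d z)
      ?_ ?_ ?_ ?_ hz1 hz2
    · intro w hw1 hw2
      simp only [star_polarSum, Complex.conj_conj]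
      exact (differentiableAt_polarSum _ hw1).mul (differentiableAt_polarSum _ hw2)
    · refine (h2.star_conj.mul h1).congr' ?_
      filter_upwards [h.real] with w hw using hreal w hw
    · have h1' : HasLimitAt (conj (conj α)) (fun z => f z * polarSum (conj α) d z) := by
        rwa [Complex.conj_conj]
      refine (h1'.star_conj.mul h2).congr' ?_
      filter_upwards [h.real_conj] with w hw using hreal w hw
    · simp only [star_polarSum, Complex.conj_conj]
      simpa using (tendsto_polarSum_cocompact α (fun i => star (d i))).mul
        (tendsto_polarSum_cocompact (conj α) d)
  apply eq_zero_of_polarSum_real (β := conj α) (by simpa using hα)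
  intro x
  have hx : ∀ b : ℂ, b.im ≠ 0 → (x : ℂ) ≠ b := by
    rintro b hb rfl
    simp at hb
  have := key x (hx _ hα) (hx _ (by simpa using hα))
  rw [Complex.conj_ofReal] at this
  exact Matrix.conjTranspose_mul_self_eq_zero.mp this

end Factorization

/-! ### Smooth dependence of contour integrals on parameters. -/

section ParametricIntegrals

variable {E : Type} [NormedAddCommGroup E] [NormedSpace ℝ E] [FiniteDimensional ℝ E]

theorem hasFDerivAt_intervalIntegral_of_contDiffOn {F : Type} [NormedAddCommGroup F]
    [NormedSpace ℝ F] {O : Set E} (hO : IsOpen O) {G : E → ℝ → F}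
    (hG : ContDiffOn ℝ ∞ (fun q : E × ℝ => G q.1 q.2) (O ×ˢ univ)) (a b : ℝ) {p : E}
    (hp : p ∈ O) :
    HasFDerivAt (fun p => ∫ θ in a..b, G p θ) (∫ θ in a..b, fderiv ℝ (fun p => G p θ) p) p := by
  have hopen : IsOpen (O ×ˢ (univ : Set ℝ)) := hO.prod isOpen_univ
  have hdiff : ∀ q ∈ O, ∀ θ, HasFDerivAt (fun p => G p θ)
      ((fderiv ℝ (fun q : E × ℝ => G q.1 q.2) (q, θ)).comp (.inl ℝ E ℝ)) q := by
    intro q hq θ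
    have h1 : DifferentiableAt ℝ (fun q : E × ℝ => G q.1 q.2) (q, θ) :=
      (hG.differentiableOn (by simp)).differentiableAt (hopen.mem_nhds ⟨hq, mem_univ _⟩)
    have h2 : HasFDerivAt (fun p : E => (p, θ)) (.inl ℝ E ℝ) q := hasFDerivAt_prodMk_left q θ
    exact h1.hasFDerivAt.comp q h2
  have hcont : ContinuousOn (fun q : E × ℝ => fderiv ℝ (fun p => G p q.2) q.1) (O ×ˢ univ) := by
    have : ContinuousOn (fun q : E × ℝ =>
        (fderiv ℝ (fun q : E × ℝ => G q.1 q.2) q).comp (.inl ℝ E ℝ)) (O ×ˢ univ) :=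
      (hG.continuousOn_fderiv_of_isOpen hopen (by simp)).clm_comp continuousOn_const
    refine this.congr ?_
    rintro ⟨q, θ⟩ hq
    exact (hdiff q hq.1 θ).fderiv
  obtain ⟨ε, hε, hball⟩ := Metric.nhds_basis_closedBall.mem_iff.mp (hO.mem_nhds hp)
  have hK : IsCompact (Metric.closedBall p ε ×ˢ uIcc a b) :=
    (isCompact_closedBall p ε).prod isCompact_uIcc
  obtain ⟨C, hC⟩ := hK.exists_bound_of_continuousOn
    (hcont.mono (prod_mono hball (subset_univ _)))
  have hslice : ∀ q ∈ O, Continuous (fun θ => G q θ) := fun q hq =>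
    continuousOn_univ.mp (hG.continuousOn.comp (f := fun θ : ℝ => (q, θ)) (by fun_prop)
      (fun θ _ => ⟨hq, mem_univ _⟩))
  refine intervalIntegral.hasFDerivAt_integral_of_dominated_of_fderiv_le (𝕜 := ℝ)
    (μ := MeasureTheory.volume) (F := G) (F' := fun p θ => fderiv ℝ (fun p => G p θ) p)
    (s := Metric.closedBall p ε) (bound := fun _ => C) (Metric.closedBall_mem_nhds p hε) ?_ ?_ ?_ ?_
    (intervalIntegrable_const (μ := MeasureTheory.volume)) ?_
  · filter_upwards [hO.mem_nhds hp] with q hq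
    exact (hslice q hq).aestronglyMeasurable
  · exact (hslice p hp).intervalIntegrable _ _
  · have : Continuous (fun θ => fderiv ℝ (fun p => G p θ) p) :=
      continuousOn_univ.mp (hcont.comp (f := fun θ : ℝ => (p, θ)) (by fun_prop)
        (fun θ _ => ⟨hp, mem_univ _⟩))
    exact this.aestronglyMeasurable
  · refine Eventually.of_forall fun θ hθ q hq => hC (q, θ) ⟨hq, uIoc_subset_uIcc hθ⟩
  · exact Eventually.of_forall fun θ _ q hq => (hdiff q (hball hq) θ).differentiableAt.hasFDerivAt

/-- Induction on the order of differentiability. The derivative of the integral is again an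
integral, but with values in a space of linear maps, so the target has to vary. -/
theorem contDiffOn_intervalIntegral {F : Type} [NormedAddCommGroup F]
    [NormedSpace ℝ F] {O : Set E} (hO : IsOpen O) {G : E → ℝ → F}
    (hG : ContDiffOn ℝ ∞ (fun q : E × ℝ => G q.1 q.2) (O ×ˢ univ)) (a b : ℝ) :
    ContDiffOn ℝ ∞ (fun p => ∫ θ in a..b, G p θ) O := by
  have hopen : IsOpen (O ×ˢ (univ : Set ℝ)) := hO.prod isOpen_univ
  rw [contDiffOn_infty]
  intro m
  induction m generalizing F with
  | zero =>
    rw [Nat.cast_zero, contDiffOn_zero]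
    exact fun p hp =>
      (hasFDerivAt_intervalIntegral_of_contDiffOn hO hG a b hp).continuousAt.continuousWithinAt
  | succ m ih =>
    rw [Nat.cast_succ, contDiffOn_succ_iff_fderiv_of_isOpen hO]
    refine ⟨fun p hp => (hasFDerivAt_intervalIntegral_of_contDiffOn hO hG a b
      hp).differentiableAt.differentiableWithinAt, by simp, ?_⟩
    have hG' : ContDiffOn ℝ ∞ (fun q : E × ℝ => fderiv ℝ (fun p => G p q.2) q.1) (O ×ˢ univ) := by
      have : ContDiffOn ℝ ∞ (fun q : E × ℝ =>
          (fderiv ℝ (fun q : E × ℝ => G q.1 q.2) q).comp (.inl ℝ E ℝ)) (O ×ˢ univ) :=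
        (hG.fderiv_of_isOpen hopen (by simp)).clm_comp contDiffOn_const
      refine this.congr ?_
      rintro ⟨q, θ⟩ hq
      have h1 : DifferentiableAt ℝ (fun q : E × ℝ => G q.1 q.2) (q, θ) :=
        (hG.differentiableOn (by simp)).differentiableAt (hopen.mem_nhds hq)
      have h2 : HasFDerivAt (fun p : E => (p, θ)) (.inl ℝ E ℝ) q := hasFDerivAt_prodMk_left q θ
      exact (h1.hasFDerivAt.comp q h2).fderiv
    refine (ih (G := fun p θ => fderiv ℝ (fun p => G p θ) p) hG').congr ?_
    intro p hp
    exact (hasFDerivAt_intervalIntegral_of_contDiffOn hO hG a b hp).fderiv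

variable {F : Type} [NormedAddCommGroup F] [NormedSpace ℂ F]

theorem contDiffOn_circleIntegral {O : Set E} (hO : IsOpen O) {f : E → ℂ → F} {c : ℂ} {R : ℝ}
    (hf : ContDiffOn ℝ ∞ (fun q : E × ℝ => f q.1 (circleMap c R q.2)) (O ×ˢ univ)) :
    ContDiffOn ℝ ∞ (fun p => ∮ z in C(c, R), f p z) O := by
  apply contDiffOn_intervalIntegral hO
  refine ContDiffOn.smul ?_ hf
  simp only [deriv_circleMap]
  have := contDiff_circleMap (n := ∞) 0 R
  fun_prop

theorem fderiv_circleIntegral [CompleteSpace F] {O : Set E} (hO : IsOpen O) {f : E → ℂ → F}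
    {c : ℂ} {R : ℝ}
    (hf : ContDiffOn ℝ ∞ (fun q : E × ℝ => f q.1 (circleMap c R q.2)) (O ×ˢ univ)) {p : E}
    (hp : p ∈ O) (v : E) :
    fderiv ℝ (fun p => ∮ z in C(c, R), f p z) p v
      = ∮ z in C(c, R), fderiv ℝ (fun p => f p z) p v := by
  have hsm : ContDiffOn ℝ ∞
      (fun q : E × ℝ => deriv (circleMap c R) q.2 • f q.1 (circleMap c R q.2)) (O ×ˢ univ) := by
    refine ContDiffOn.smul ?_ hf
    simp only [deriv_circleMap]
    have := contDiff_circleMap (n := ∞) 0 R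
    fun_prop
  have h := hasFDerivAt_intervalIntegral_of_contDiffOn hO
    (G := fun p θ => deriv (circleMap c R) θ • f p (circleMap c R θ)) hsm 0 (2 * Real.pi) hp
  have hopen : IsOpen (O ×ˢ (univ : Set ℝ)) := hO.prod isOpen_univ
  have hdf : ∀ q ∈ O, ∀ θ, DifferentiableAt ℝ (fun p => f p (circleMap c R θ)) q := by
    intro q hq θ
    have h1 : DifferentiableAt ℝ (fun q : E × ℝ => f q.1 (circleMap c R q.2)) (q, θ) :=
      (hf.differentiableOn (by simp)).differentiableAt (hopen.mem_nhds ⟨hq, mem_univ _⟩)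
    have h2 : HasFDerivAt (fun p : E => (p, θ)) (.inl ℝ E ℝ) q := hasFDerivAt_prodMk_left q θ
    exact (h1.hasFDerivAt.comp q h2).differentiableAt
  have hG' : ContinuousOn (fun q : E × ℝ => fderiv ℝ
      (fun p => deriv (circleMap c R) q.2 • f p (circleMap c R q.2)) q.1) (O ×ˢ univ) := by
    have : ContinuousOn (fun q : E × ℝ =>
        (fderiv ℝ (fun q : E × ℝ => deriv (circleMap c R) q.2 • f q.1 (circleMap c R q.2)) q).comp
          (.inl ℝ E ℝ)) (O ×ˢ univ) :=
      (hsm.continuousOn_fderiv_of_isOpen hopen (by simp)).clm_comp continuousOn_const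
    refine this.congr ?_
    rintro ⟨q, θ⟩ hq
    have h1 : DifferentiableAt ℝ
        (fun q : E × ℝ => deriv (circleMap c R) q.2 • f q.1 (circleMap c R q.2)) (q, θ) :=
      (hsm.differentiableOn (by simp)).differentiableAt (hopen.mem_nhds hq)
    have h2 : HasFDerivAt (fun p : E => (p, θ)) (.inl ℝ E ℝ) q := hasFDerivAt_prodMk_left q θ
    exact (h1.hasFDerivAt.comp q h2).fderiv
  have hG'' : Continuous (fun θ : ℝ => fderiv ℝ
      (fun p => deriv (circleMap c R) θ • f p (circleMap c R θ)) p) :=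
    continuousOn_univ.mp (hG'.comp (f := fun θ : ℝ => (p, θ)) (by fun_prop)
        (fun θ _ => ⟨hp, mem_univ _⟩))
  unfold circleIntegral
  rw [h.fderiv, ContinuousLinearMap.intervalIntegral_apply (hG''.intervalIntegrable _ _)]
  congr 1
  funext θ
  rw [fderiv_fun_const_smul (hdf p hp θ)]
  rfl

end ParametricIntegrals

/-! ### Extension over a removable singularity, with parameters and limits. -/

section Regularization

variable {F : Type} [NormedAddCommGroup F] [NormedSpace ℂ F] [CompleteSpace F]

/-- The function `f` with its value at `β` replaced by its limit there. -/
noncomputable def regularize (β : ℂ) (f : ℂ → F) : ℂ → F :=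
  Function.update f β (limUnder (𝓝[≠] β) f)

theorem regularize_of_ne {β z : ℂ} (f : ℂ → F) (h : z ≠ β) : regularize β f z = f z :=
  Function.update_of_ne h _ _

theorem HasLimitAt.tendsto_regularize {β : ℂ} {f : ℂ → F} (h : HasLimitAt β f) :
    Tendsto f (𝓝[≠] β) (𝓝 (regularize β f β)) := by
  rw [regularize, Function.update_self]
  exact tendsto_nhds_limUnder h

theorem regularize_eventuallyEq (β : ℂ) (f : ℂ → F) : regularize β f =ᶠ[𝓝[≠] β] f := by
  filter_upwards [self_mem_nhdsWithin] with z hz using regularize_of_ne f hz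

theorem differentiableOn_regularize {β : ℂ} {V : Set ℂ} (hV : IsOpen V) {f : ℂ → F}
    (hd : DifferentiableOn ℂ f (V \ {β})) (hf : HasLimitAt β f) :
    DifferentiableOn ℂ (regularize β f) V := by
  have hd' : ∀ z ∈ V, z ≠ β → DifferentiableAt ℂ f z := fun z hz hne =>
    hd.differentiableAt ((hV.sdiff isClosed_singleton).mem_nhds ⟨hz, hne⟩)
  intro z hz
  apply DifferentiableAt.differentiableWithinAt
  by_cases h : z = β
  · subst h
    apply differentiableAt_update_of_tendsto _ (tendsto_nhds_limUnder hf)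
    filter_upwards [nhdsWithin_le_nhds (hV.mem_nhds hz), self_mem_nhdsWithin] with w h1 h2
      using hd' w h1 h2
  · exact differentiableAt_update_of_ne h (hd' z hz h)

/-- Near β the extension is Cauchy's integral over a circle that avoids β, where `f` is jointly
smooth; smoothness follows by differentiating under the integral. -/
theorem contDiffOn_regularize {E : Type} [NormedAddCommGroup E] [NormedSpace ℝ E]
    [FiniteDimensional ℝ E] {β : ℂ} {V : Set ℂ} (hV : IsOpen V) (hβ : β ∈ V) {f : E → ℂ → F}
    (hs : ContDiffOn ℝ ∞ (fun q : E × ℂ => f q.1 q.2) (univ ×ˢ (V \ {β})))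
    (hd : ∀ p, DifferentiableOn ℂ (f p) (V \ {β})) (hf : ∀ p, HasLimitAt β (f p)) :
    ContDiffOn ℝ ∞ (fun q : E × ℂ => regularize β (f q.1) q.2) (univ ×ˢ V) := by
  have hopen : IsOpen ((univ : Set E) ×ˢ (V \ {β})) :=
    isOpen_univ.prod (hV.sdiff isClosed_singleton)
  obtain ⟨r, hr, hball⟩ := Metric.nhds_basis_closedBall.mem_iff.mp (hV.mem_nhds hβ)
  have hcirc : ∀ θ, circleMap β r θ ∈ V \ {β} := fun θ =>
    ⟨hball (Metric.sphere_subset_closedBall (circleMap_mem_sphere β hr.le θ)),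
      circleMap_ne_center hr.ne'⟩
  have hBall : ContDiffOn ℝ ∞ (fun q : E × ℂ => regularize β (f q.1) q.2)
      (univ ×ˢ Metric.ball β r) := by
    have h1 : ContDiffOn ℝ ∞ (fun q : E × ℂ => ((2 * Real.pi * Complex.I : ℂ))⁻¹ •
        ∮ z in C(β, r), (z - q.2)⁻¹ • f q.1 z) (univ ×ˢ Metric.ball β r) := by
      apply contDiffOn_const.smul
      apply contDiffOn_circleIntegral (isOpen_univ.prod Metric.isOpen_ball)
      have hne : ∀ x ∈ (((univ : Set E) ×ˢ Metric.ball β r) ×ˢ (univ : Set ℝ)),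
          circleMap β r x.2 - x.1.2 ≠ 0 := by
        rintro ⟨⟨p, w⟩, θ⟩ hx h0
        have hw : w ∈ Metric.ball β r := hx.1.2
        rw [sub_eq_zero] at h0
        simp only at h0
        rw [← h0] at hw
        have := circleMap_mem_sphere β hr.le θ
        rw [Metric.mem_sphere] at this
        rw [Metric.mem_ball, this] at hw
        exact lt_irrefl _ hw
      have hcm := contDiff_circleMap (n := ∞) β r
      apply ContDiffOn.smul
      · exact ContDiffOn.inv (by fun_prop) hne
      · refine hs.comp (t := univ ×ˢ (V \ {β})) (f := fun x : (E × ℂ) × ℝ =>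
          (x.1.1, circleMap β r x.2)) (by fun_prop) ?_
        rintro ⟨⟨p, w⟩, θ⟩ _
        exact ⟨mem_univ _, hcirc θ⟩
    refine h1.congr ?_
    rintro ⟨p, w⟩ ⟨_, hw⟩
    have hD : DifferentiableOn ℂ (regularize β (f p)) (Metric.closedBall β r) :=
      (differentiableOn_regularize hV (hd p) (hf p)).mono hball
    have := hD.circleIntegral_sub_inv_smul hw
    simp only
    rw [eq_inv_smul_iff₀ Complex.two_pi_I_ne_zero, ← this]
    apply circleIntegral.integral_congr hr.le
    intro z hz
    have hz' : z ≠ β := by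
      rintro rfl
      simp at hz
      exact hr.ne hz
    simp only [regularize_of_ne _ hz']
  rintro ⟨p, z⟩ ⟨_, hz⟩
  apply ContDiffAt.contDiffWithinAt
  by_cases h : z = β
  · subst h
    exact hBall.contDiffAt ((isOpen_univ.prod Metric.isOpen_ball).mem_nhds
      ⟨mem_univ _, Metric.mem_ball_self hr⟩)
  · have h1 := hs.contDiffAt (hopen.mem_nhds (x := (p, z)) ⟨mem_univ _, hz, h⟩)
    refine h1.congr_of_eventuallyEq ?_
    filter_upwards [hopen.mem_nhds (x := (p, z)) ⟨mem_univ _, hz, h⟩] with q hq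
    exact regularize_of_ne _ hq.2.2

/-- Locally uniform convergence of holomorphic functions extends over a point, by the maximum
principle. -/
theorem tendstoLocallyUniformlyOn_regularize {ι : Type*} {l : Filter ι} [l.NeBot] {β : ℂ}
    {V : Set ℂ} (hV : IsOpen V) (hβ : β ∈ V) {f : ι → ℂ → F} {h : ℂ → F}
    (hd : ∀ q, DifferentiableOn ℂ (f q) V)
    (hf : TendstoLocallyUniformlyOn f h l (V \ {β})) :
    HasLimitAt β h ∧ TendstoLocallyUniformlyOn f (regularize β h) l V := by
  have hV' : IsOpen (V \ {β}) := hV.sdiff isClosed_singleton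
  have hdh : DifferentiableOn ℂ h (V \ {β}) :=
    hf.differentiableOn (Eventually.of_forall fun q => (hd q).mono sdiff_subset) hV'
  obtain ⟨r, hr, hball⟩ := Metric.nhds_basis_closedBall.mem_iff.mp (hV.mem_nhds hβ)
  have hsph : Metric.sphere β r ⊆ V \ {β} := fun z hz =>
    ⟨hball (Metric.sphere_subset_closedBall hz), by rintro rfl; simp at hz; exact hr.ne hz⟩
  have hK := (tendstoLocallyUniformlyOn_iff_forall_isCompact hV').mp hf
  have hS := hK _ hsph (isCompact_sphere β r)
  rw [Metric.tendstoUniformlyOn_iff] at hS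
  -- The maximum principle bounds f q - f q' on the ball by its values on the circle, where both are
  -- close to h; then pass to the limit in q'. The point β is excluded because h is not yet known to
  -- extend.
  have step : ∀ ε > 0, ∀ᶠ q in l, ∀ z ∈ Metric.closedBall β r, z ≠ β → ‖f q z - h z‖ ≤ ε := by
    intro ε hε
    filter_upwards [hS (ε / 2) (half_pos hε)] with q hq z hz hne
    have hlim : Tendsto (fun q' => ‖f q z - f q' z‖) l (𝓝 ‖f q z - h z‖) :=
      (tendsto_const_nhds.sub (hf.tendsto_at ⟨hball hz, hne⟩)).norm
    refine le_of_tendsto hlim ?_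
    filter_upwards [hS (ε / 2) (half_pos hε)] with q' hq'
    have hD : DiffContOnCl ℂ (fun z => f q z - f q' z) (Metric.ball β r) :=
      ((((hd q).sub (hd q')).mono hball).mono Metric.closure_ball_subset_closedBall).diffContOnCl
    refine Complex.norm_le_of_forall_mem_frontier_norm_le Metric.isBounded_ball hD ?_
      (by rwa [closure_ball β hr.ne'])
    intro w hw
    rw [frontier_ball β hr.ne'] at hw
    have h1 := hq w hw
    have h2 := hq' w hw
    rw [dist_eq_norm] at h1 h2
    calc ‖f q w - f q' w‖ = ‖(h w - f q' w) - (h w - f q w)‖ := by congr 1; abel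
      _ ≤ ‖h w - f q' w‖ + ‖h w - f q w‖ := norm_sub_le _ _
      _ ≤ ε := by linarith
  have hlim : HasLimitAt β h := by
    obtain ⟨q, hq⟩ := (step 1 one_pos).exists
    have hbd : IsBoundedUnder (· ≤ ·) (𝓝[≠] β) fun z => ‖h z - h β‖ := by
      obtain ⟨C, hC⟩ := (isCompact_closedBall β r).exists_bound_of_continuousOn
        ((hd q).continuousOn.mono hball)
      refine ⟨1 + C + ‖h β‖, ?_⟩
      rw [eventually_map]
      filter_upwards [nhdsWithin_le_nhds (Metric.closedBall_mem_nhds β hr), self_mem_nhdsWithin]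
        with z h1 h2
      have h3 := hq z h1 h2
      have h4 := hC z h1
      calc ‖h z - h β‖ = ‖f q z - (f q z - h z) - h β‖ := by congr 1; abel
        _ ≤ ‖f q z‖ + ‖f q z - h z‖ + ‖h β‖ :=
          (norm_sub_le _ _).trans (by gcongr; exact norm_sub_le _ _)
        _ ≤ 1 + C + ‖h β‖ := by linarith
    refine ⟨_, Complex.tendsto_limUnder_of_differentiable_on_punctured_nhds_of_bounded_under
      ?_ hbd⟩
    filter_upwards [nhdsWithin_le_nhds (hV.mem_nhds hβ), self_mem_nhdsWithin] with z h1 h2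
    exact hdh.differentiableAt (hV'.mem_nhds ⟨h1, h2⟩)
  refine ⟨hlim, ?_⟩
  rw [tendstoLocallyUniformlyOn_iff_forall_isCompact hV]
  intro K hKV hKc
  rw [Metric.tendstoUniformlyOn_iff]
  intro ε hε
  have hK' := hK (K \ Metric.ball β r)
    (fun z hz => ⟨hKV hz.1, by rintro rfl; exact hz.2 (Metric.mem_ball_self hr)⟩)
    (hKc.diff Metric.isOpen_ball)
  rw [Metric.tendstoUniformlyOn_iff] at hK'
  filter_upwards [hK' ε hε, step (ε / 2) (half_pos hε)] with q h1 h2 z hz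
  have h3 : ∀ z ∈ Metric.closedBall β r, z ≠ β → dist (regularize β h z) (f q z) ≤ ε / 2 := by
    intro z hz hne
    rw [regularize_of_ne h hne, dist_comm, dist_eq_norm]
    exact h2 z hz hne
  by_cases hzb : z ∈ Metric.ball β r
  · refine lt_of_le_of_lt ?_ (half_lt_self hε)
    by_cases hne : z = β
    · subst hne
      have hc : Tendsto (fun w => dist (regularize z h w) (f q w)) (𝓝[≠] z)
          (𝓝 (dist (regularize z h z) (f q z))) := by
        refine Tendsto.dist (hlim.tendsto_regularize.congr' (regularize_eventuallyEq z h).symm) ?_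
        exact (((hd q).continuousOn.continuousAt (hV.mem_nhds hβ)).tendsto).mono_left
          nhdsWithin_le_nhds
      refine le_of_tendsto hc ?_
      filter_upwards [nhdsWithin_le_nhds (Metric.closedBall_mem_nhds z hr), self_mem_nhdsWithin]
        with w h1 h2 using h3 w h1 h2
    · exact h3 z (Metric.ball_subset_closedBall hzb) hne
  · have hne : z ≠ β := by rintro rfl; exact hzb (Metric.mem_ball_self hr)
    rw [regularize_of_ne h hne]
    exact h1 z ⟨hz, hzb⟩

end Regularization

/-! ### Functions asymptotically constant at spatial infinity. -/

section AsymptoticallyConstant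

variable {E F G : Type} [NormedAddCommGroup E] [NormedSpace ℝ E] [NormedAddCommGroup F]
  [NormedSpace ℝ F] [NormedAddCommGroup G] [NormedSpace ℝ G]

/-- `f` is smooth and at every time tends to `L` at spatial infinity, while its partial
derivatives of positive order tend to `0`. -/
structure IsAsympConst (f : Spacetime → E) (L : E) : Prop where
  smooth : ContDiff ℝ ∞ f
  tendsto : ∀ t : ℝ, Tendsto (fun q : ℝ × ℝ => f (q.1, q.2, t)) (cocompact (ℝ × ℝ)) (𝓝 L)
  decay : ∀ (m : ℕ) (t : ℝ), 1 ≤ m →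
    Tendsto (fun q : ℝ × ℝ => ‖iteratedFDeriv ℝ m f (q.1, q.2, t)‖) (cocompact (ℝ × ℝ)) (𝓝 0)

theorem isAsympConst_const (L : E) : IsAsympConst (fun _ => L) L where
  smooth := contDiff_const
  tendsto _ := tendsto_const_nhds
  decay m t hm := by
    rw [iteratedFDeriv_const_of_ne (by omega)]
    simp

/-- Asymptotically constant functions are preserved by maps smooth near the limit. -/
theorem IsAsympConst.comp_of_eq {f : Spacetime → E} {L : E} (hf : IsAsympConst f L) {Φ : E → F}
    {O : Set E} (hO : IsOpen O) (hΦ : ContDiffOn ℝ ∞ Φ O) (hL : L ∈ O) {h : Spacetime → F}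
    (hh : ContDiff ℝ ∞ h) (heq : ∀ p, f p ∈ O → h p = Φ (f p)) : IsAsympConst h (Φ L) := by
  have hev : ∀ t : ℝ, ∀ᶠ q : ℝ × ℝ in cocompact (ℝ × ℝ), f (q.1, q.2, t) ∈ O := fun t =>
    (hf.tendsto t).eventually (hO.mem_nhds hL)
  refine ⟨hh, fun t => ?_, fun m t hm => ?_⟩
  · have h1 : Tendsto (fun q : ℝ × ℝ => Φ (f (q.1, q.2, t))) (cocompact (ℝ × ℝ)) (𝓝 (Φ L)) :=
      ((hΦ.continuousOn.continuousAt (hO.mem_nhds hL)).tendsto).comp (hf.tendsto t)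
    refine h1.congr' ?_
    filter_upwards [hev t] with q hq using (heq _ hq).symm
  · have hbd : ∃ C : ℝ, 0 < C ∧ ∀ᶠ x in 𝓝 L, ∀ i ≤ m, ‖iteratedFDerivWithin ℝ i Φ O x‖ ≤ C := by
      have h1 : ∀ i : ℕ, ∀ᶠ x in 𝓝 L, ‖iteratedFDerivWithin ℝ i Φ O x‖ ≤
          ‖iteratedFDerivWithin ℝ i Φ O L‖ + 1 := by
        intro i
        have hc := ((hΦ.continuousOn_iteratedFDerivWithin (m := i)
          (by exact_mod_cast le_top) hO.uniqueDiffOn).continuousAt (hO.mem_nhds hL)).norm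
        filter_upwards [hc.eventually (gt_mem_nhds (lt_add_one _))] with x hx using hx.le
      refine ⟨∑ i ∈ Finset.range (m + 1), (‖iteratedFDerivWithin ℝ i Φ O L‖ + 1), ?_, ?_⟩
      · exact Finset.sum_pos (fun i _ => by positivity) (by simp)
      · have : ∀ᶠ x in 𝓝 L, ∀ i ∈ Finset.range (m + 1), ‖iteratedFDerivWithin ℝ i Φ O x‖ ≤
            ‖iteratedFDerivWithin ℝ i Φ O L‖ + 1 :=
          (Filter.eventually_all_finset _).mpr fun i _ => h1 i
        filter_upwards [this] with x hx i hi
        refine (hx i (by simp; omega)).trans ?_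
        exact Finset.single_le_sum
          (f := fun i => ‖iteratedFDerivWithin ℝ i Φ O L‖ + 1) (fun i _ => by positivity)
          (by simp; omega)
    obtain ⟨C, hC0, hC⟩ := hbd
    rw [Metric.tendsto_nhds]
    intro ε hε
    set K : ℝ := (m.factorial : ℝ) * C with hK
    have hKpos : 0 < K := by positivity
    -- If the derivatives of Φ up to order m are at most C and the i-th derivative of f is at most
    -- D^i, the chain rule bounds the m-th derivative of the composition by m! C D^m. As D ≤ 1 and m
    -- ≥ 1, this is at most K D.
    obtain ⟨D, hD0, hD1, hD⟩ : ∃ D : ℝ, 0 < D ∧ D ≤ 1 ∧ K * D < ε := by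
      refine ⟨min 1 (ε / (2 * K)), by positivity, min_le_left _ _, ?_⟩
      calc K * min 1 (ε / (2 * K)) ≤ K * (ε / (2 * K)) := by gcongr; exact min_le_right _ _
        _ = ε / 2 := by field_simp
        _ < ε := half_lt_self hε
    have hDer : ∀ᶠ q : ℝ × ℝ in cocompact (ℝ × ℝ), ∀ i ∈ Finset.Icc 1 m,
        ‖iteratedFDeriv ℝ i f (q.1, q.2, t)‖ < D ^ i :=
      (Filter.eventually_all_finset _).mpr fun i hi =>
        (hf.decay i t (Finset.mem_Icc.mp hi).1).eventually (gt_mem_nhds (by positivity))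
    filter_upwards [hev t, (hf.tendsto t).eventually hC, hDer] with q h1 h2 h3
    set s : Set Spacetime := f ⁻¹' O
    have hs : IsOpen s := hO.preimage hf.smooth.continuous
    have h4 := norm_iteratedFDerivWithin_comp_le hΦ hf.smooth.contDiffOn (n := m) (s := s)
      (by exact_mod_cast le_top) hO.uniqueDiffOn hs.uniqueDiffOn (fun _ hx => hx) h1 h2
      (D := D) (fun i hi1 hi2 => by
        rw [iteratedFDerivWithin_of_isOpen i hs h1]
        exact (h3 i (Finset.mem_Icc.mpr ⟨hi1, hi2⟩)).le)
    have h5 : iteratedFDerivWithin ℝ m (Φ ∘ f) s (q.1, q.2, t)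
        = iteratedFDeriv ℝ m h (q.1, q.2, t) := by
      rw [← iteratedFDerivWithin_of_isOpen m hs h1]
      exact iteratedFDerivWithin_congr (fun p hp => (heq p hp).symm) h1 m
    rw [h5] at h4
    rw [dist_zero_right, norm_norm]
    refine h4.trans_lt (lt_of_le_of_lt ?_ hD)
    rw [← hK]
    gcongr
    exact pow_le_of_le_one hD0.le hD1 (by omega)

theorem IsAsympConst.comp {f : Spacetime → E} {L : E} (hf : IsAsympConst f L) {Φ : E → F}
    (hΦ : ContDiff ℝ ∞ Φ) : IsAsympConst (fun p => Φ (f p)) (Φ L) :=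
  hf.comp_of_eq isOpen_univ hΦ.contDiffOn (mem_univ _) (hΦ.comp hf.smooth) fun _ _ => rfl

theorem IsAsympConst.clm {f : Spacetime → E} {L : E} (hf : IsAsympConst f L) (Φ : E →L[ℝ] F) :
    IsAsympConst (fun p => Φ (f p)) (Φ L) := hf.comp Φ.contDiff

theorem IsAsympConst.prodMk {f : Spacetime → E} {g : Spacetime → F} {L : E} {M : F}
    (hf : IsAsympConst f L) (hg : IsAsympConst g M) :
    IsAsympConst (fun p => (f p, g p)) (L, M) := by
  refine ⟨hf.smooth.prodMk hg.smooth, fun t => (hf.tendsto t).prodMk_nhds (hg.tendsto t),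
    fun m t hm => ?_⟩
  have h1 : ∀ p, ‖iteratedFDeriv ℝ m (fun p => (f p, g p)) p‖ =
      max ‖iteratedFDeriv ℝ m f p‖ ‖iteratedFDeriv ℝ m g p‖ := by
    intro p
    rw [iteratedFDeriv_prodMk (hf.smooth.contDiffAt.of_le (by exact_mod_cast le_top))
      (hg.smooth.contDiffAt.of_le (by exact_mod_cast le_top)) le_rfl]
    exact ContinuousMultilinearMap.opNorm_prod _ _
  simp only [h1]
  simpa using (hf.decay m t hm).max (hg.decay m t hm)

theorem norm_iteratedFDeriv_sum_clm_le {ι : Type} [Fintype ι] (A : ι → E →L[ℝ] F)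
    {f : ι → Spacetime → E} (hf : ∀ i, ContDiff ℝ ∞ (f i)) (m : ℕ) (p : Spacetime) :
    ‖iteratedFDeriv ℝ m (fun p => ∑ i, A i (f i p)) p‖ ≤
      ∑ i, ‖A i‖ * ‖iteratedFDeriv ℝ m (f i) p‖ := by
  have hm : (m : ℕ∞ω) ≤ ∞ := by exact_mod_cast le_top
  have hs : ∀ i ∈ Finset.univ, ContDiffAt ℝ m (fun p => A i (f i p)) p := fun i _ =>
    (((A i).contDiff.comp (hf i)).of_le hm).contDiffAt
  rw [iteratedFDeriv_fun_sum_apply hs]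
  refine (norm_sum_le _ _).trans (Finset.sum_le_sum fun i _ => ?_)
  exact (A i).norm_iteratedFDeriv_comp_left (hf i).contDiffAt hm

theorem isAsympConst_pi {ι : Type} [Fintype ι] {f : Spacetime → ι → E} {L : ι → E}
    (hf : ∀ i, IsAsympConst (fun p => f p i) (L i)) : IsAsympConst f L := by
  classical
  refine ⟨contDiff_pi.mpr fun i => (hf i).smooth, fun t => tendsto_pi_nhds.mpr fun i =>
    (hf i).tendsto t, fun m t hm => ?_⟩
  have h1 : f = fun p => ∑ i, ContinuousLinearMap.single ℝ (fun _ : ι => E) i (f p i) := by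
    funext p
    exact (Finset.univ_sum_single (f p)).symm
  have h2 : ∀ p, ‖iteratedFDeriv ℝ m f p‖ ≤
      ∑ i, ‖ContinuousLinearMap.single ℝ (fun _ : ι => E) i‖ *
        ‖iteratedFDeriv ℝ m (fun p => f p i) p‖ := by
    intro p
    conv_lhs => rw [h1]
    exact norm_iteratedFDeriv_sum_clm_le _ (fun i => (hf i).smooth) m p
  refine squeeze_zero (fun _ => norm_nonneg _) (fun q => h2 _) ?_
  have : Tendsto (fun q : ℝ × ℝ => ∑ i, ‖ContinuousLinearMap.single ℝ (fun _ : ι => E) i‖ *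
        ‖iteratedFDeriv ℝ m (fun p => f p i) (q.1, q.2, t)‖) (cocompact (ℝ × ℝ))
      (𝓝 (∑ i : ι, ‖ContinuousLinearMap.single ℝ (fun _ : ι => E) i‖ * 0)) :=
    tendsto_finsetSum _ fun i _ => ((hf i).decay m t hm).const_mul _
  simpa using this

theorem IsAsympConst.congr {f g : Spacetime → E} {L : E} (hf : IsAsympConst f L)
    (h : ∀ p, g p = f p) : IsAsympConst g L := by
  rwa [funext h]

theorem IsAsympConst.add {f g : Spacetime → E} {L M : E} (hf : IsAsympConst f L)
    (hg : IsAsympConst g M) : IsAsympConst (fun p => f p + g p) (L + M) :=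
  (hf.prodMk hg).comp (Φ := fun x : E × E => x.1 + x.2) (contDiff_fst.add contDiff_snd)

theorem IsAsympConst.sub {f g : Spacetime → E} {L M : E} (hf : IsAsympConst f L)
    (hg : IsAsympConst g M) : IsAsympConst (fun p => f p - g p) (L - M) :=
  (hf.prodMk hg).comp (Φ := fun x : E × E => x.1 - x.2) (contDiff_fst.sub contDiff_snd)

theorem IsAsympConst.mul {A : Type} [NormedRing A] [NormedAlgebra ℝ A] {f g : Spacetime → A}
    {L M : A} (hf : IsAsympConst f L) (hg : IsAsympConst g M) :
    IsAsympConst (fun p => f p * g p) (L * M) :=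
  (hf.prodMk hg).comp (Φ := fun x : A × A => x.1 * x.2) (contDiff_fst.mul contDiff_snd)

theorem IsAsympConst.sum {ι : Type} (s : Finset ι) {f : ι → Spacetime → E} {L : ι → E}
    (hf : ∀ i ∈ s, IsAsympConst (f i) (L i)) :
    IsAsympConst (fun p => ∑ i ∈ s, f i p) (∑ i ∈ s, L i) := by
  classical
  induction s using Finset.induction_on with
  | empty => simpa using isAsympConst_const (0 : E)
  | insert a s ha ih =>
    simp only [Finset.sum_insert ha]
    exact (hf a (Finset.mem_insert_self _ _)).add
      (ih fun i hi => hf i (Finset.mem_insert_of_mem hi))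

theorem IsAsympConst.fderiv_apply {f : Spacetime → E} {L : E} (hf : IsAsympConst f L)
    (v : Spacetime) : IsAsympConst (fun p => fderiv ℝ f p v) 0 := by
  have hs : ContDiff ℝ ∞ (fderiv ℝ f) := hf.smooth.fderiv_right (by simp)
  have hbd : ∀ (m : ℕ) p, ‖iteratedFDeriv ℝ m (fun p => fderiv ℝ f p v) p‖ ≤
      ‖ContinuousLinearMap.apply ℝ E v‖ * ‖iteratedFDeriv ℝ (m + 1) f p‖ := by
    intro m p
    rw [← norm_iteratedFDeriv_fderiv]
    exact (ContinuousLinearMap.apply ℝ E v).norm_iteratedFDeriv_comp_left hs.contDiffAt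
      (by exact_mod_cast le_top)
  have hlim : ∀ (m : ℕ) (t : ℝ), Tendsto (fun q : ℝ × ℝ =>
      ‖iteratedFDeriv ℝ m (fun p => fderiv ℝ f p v) (q.1, q.2, t)‖) (cocompact (ℝ × ℝ)) (𝓝 0) := by
    intro m t
    refine squeeze_zero (fun _ => norm_nonneg _) (fun q => hbd m _) ?_
    simpa using (hf.decay (m + 1) t (by omega)).const_mul ‖ContinuousLinearMap.apply ℝ E v‖
  refine ⟨hs.clm_apply contDiff_const, fun t => ?_, fun m t _ => hlim m t⟩
  rw [tendsto_zero_iff_norm_tendsto_zero]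
  simpa using hlim 0 t

theorem IsAsympConst.of_sub {f : Spacetime → E} {L : E}
    (hf : IsAsympConst (fun p => f p - L) 0) : IsAsympConst f L := by
  have := hf.add (isAsympConst_const L)
  simpa using this

/-- A function is asymptotically zero as soon as every function in a family closed under the three
partial derivatives, and containing it, tends to zero. -/
theorem isAsympConst_zero_of_closed {𝒞 : (Spacetime → E) → Prop}
    (hsm : ∀ f, 𝒞 f → ContDiff ℝ ∞ f)
    (hlim : ∀ f, 𝒞 f → ∀ t : ℝ,
      Tendsto (fun q : ℝ × ℝ => f (q.1, q.2, t)) (cocompact (ℝ × ℝ)) (𝓝 0))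
    (hcl : ∀ f, 𝒞 f → ∀ v, 𝒞 (fun p => fderiv ℝ f p v)) {f : Spacetime → E} (hf : 𝒞 f) :
    IsAsympConst f 0 := by
  refine ⟨hsm f hf, hlim f hf, fun m t _ => ?_⟩
  suffices H : ∀ m : ℕ, ∀ f, 𝒞 f → Tendsto (fun q : ℝ × ℝ =>
      ‖iteratedFDeriv ℝ m f (q.1, q.2, t)‖) (cocompact (ℝ × ℝ)) (𝓝 0) from H m f hf
  intro m
  induction m with
  | zero =>
    intro f hf
    simpa [tendsto_zero_iff_norm_tendsto_zero] using hlim f hf t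
  | succ m ih =>
    intro f hf
    let e : Fin 3 → Spacetime := ![(1, 0, 0), (0, 1, 0), (0, 0, 1)]
    let c : Fin 3 → (Spacetime →L[ℝ] ℝ) := ![.fst ℝ ℝ (ℝ × ℝ),
      (ContinuousLinearMap.fst ℝ ℝ ℝ).comp (.snd ℝ ℝ (ℝ × ℝ)),
      (ContinuousLinearMap.snd ℝ ℝ ℝ).comp (.snd ℝ ℝ (ℝ × ℝ))]
    -- The differential is rebuilt from the three partial derivatives, which lie in the family
    -- again, so the induction hypothesis applies to each.
    have h1 : fderiv ℝ f = fun p => ∑ i, ContinuousLinearMap.smulRightL ℝ Spacetime E (c i)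
        (fderiv ℝ f p (e i)) := by
      funext p
      ext
      all_goals simp [Fin.sum_univ_three, e, c]
      rfl
    have hs : ∀ i, ContDiff ℝ ∞ (fun p => fderiv ℝ f p (e i)) := fun i => hsm _ (hcl f hf (e i))
    have h2 : ∀ p, ‖iteratedFDeriv ℝ (m + 1) f p‖ ≤
        ∑ i, ‖ContinuousLinearMap.smulRightL ℝ Spacetime E (c i)‖ *
          ‖iteratedFDeriv ℝ m (fun p => fderiv ℝ f p (e i)) p‖ := by
      intro p
      rw [← norm_iteratedFDeriv_fderiv]
      conv_lhs => rw [h1]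
      exact norm_iteratedFDeriv_sum_clm_le _ hs m p
    refine squeeze_zero (fun _ => norm_nonneg _) (fun q => h2 _) ?_
    have : Tendsto (fun q : ℝ × ℝ =>
        ∑ i, ‖ContinuousLinearMap.smulRightL ℝ Spacetime E (c i)‖ *
          ‖iteratedFDeriv ℝ m (fun p => fderiv ℝ f p (e i)) (q.1, q.2, t)‖) (cocompact (ℝ × ℝ))
        (𝓝 (∑ i, ‖ContinuousLinearMap.smulRightL ℝ Spacetime E (c i)‖ * 0)) :=
      tendsto_finsetSum _ fun i _ => (ih _ (hcl f hf (e i))).const_mul _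
    simpa using this

theorem isAsympConst_zero_iff_decaysSpatially {n : ℕ} {f : Spacetime → Mat n}
    (hf : ContDiff ℝ ∞ f) : IsAsympConst f 0 ↔ DecaysSpatially f := by
  constructor
  · intro h m t
    have : Tendsto (fun q : ℝ × ℝ => ‖iteratedFDeriv ℝ m f (q.1, q.2, t)‖)
        (cocompact (ℝ × ℝ)) (𝓝 0) := by
      rcases Nat.eq_zero_or_pos m with rfl | hm
      · simpa [tendsto_zero_iff_norm_tendsto_zero] using h.tendsto t
      · exact h.decay m t hm
    exact tendsto_zero_iff_norm_tendsto_zero.mpr this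
  · intro h
    have h' : ∀ (m : ℕ) (t : ℝ), Tendsto (fun q : ℝ × ℝ =>
        ‖iteratedFDeriv ℝ m f (q.1, q.2, t)‖) (cocompact (ℝ × ℝ)) (𝓝 0) := fun m t =>
      tendsto_zero_iff_norm_tendsto_zero.mp (h m t)
    refine ⟨hf, fun t => ?_, fun m t _ => h' m t⟩
    rw [tendsto_zero_iff_norm_tendsto_zero]
    simpa using h' 0 t

end AsymptoticallyConstant

/-! ### Regularity of solutions of injective linear systems. -/

section InjectiveLinearSystems

variable {V W : Type} [NormedAddCommGroup V] [NormedSpace ℝ V] [FiniteDimensional ℝ V]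
  [NormedAddCommGroup W] [NormedSpace ℝ W] [FiniteDimensional ℝ W]

/-- The solution of a linear system depends smoothly on the system near a system with injective
matrix. -/
theorem exists_smooth_solution_near (T₀ : V →L[ℝ] W) (h₀ : Function.Injective T₀) :
    ∃ (O : Set ((V →L[ℝ] W) × W)) (Φ : (V →L[ℝ] W) × W → V), IsOpen O ∧ ContDiffOn ℝ ∞ Φ O ∧
      (∀ b, (T₀, b) ∈ O) ∧ ∀ T b d, (T, b) ∈ O → T d = b → d = Φ (T, b) := by
  -- A left inverse S of T₀ makes S ∘ T invertible for T near T₀. Any solution of T d = b is then (S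
  -- T)⁻¹ S b, which is smooth in (T, b); solvability is not needed.
  obtain ⟨S', hS'⟩ := T₀.toLinearMap.exists_leftInverse_of_injective
    (LinearMap.ker_eq_bot.mpr h₀)
  let S : W →L[ℝ] V := LinearMap.toContinuousLinearMap S'
  have hS : S.comp T₀ = 1 := by
    ext v
    exact LinearMap.congr_fun hS' v
  have : CompleteSpace V := FiniteDimensional.complete ℝ V
  have hcd : ContDiff ℝ ∞ (fun x : (V →L[ℝ] W) × W => S.comp x.1) :=
    contDiff_const.clm_comp contDiff_fst
  refine ⟨{x | IsUnit (S.comp x.1)}, fun x => Ring.inverse (S.comp x.1) (S x.2), ?_, ?_, ?_, ?_⟩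
  · exact Units.isOpen.preimage hcd.continuous
  · intro x hx
    apply ContDiffAt.contDiffWithinAt
    have hx' : IsUnit (S.comp x.1) := hx
    obtain ⟨u, hu⟩ := hx'
    have h1 : ContDiffAt ℝ ∞ Ring.inverse (S.comp x.1) := by
      rw [← hu]
      exact contDiffAt_ringInverse ℝ u
    exact (h1.comp x hcd.contDiffAt).clm_apply (S.contDiff.contDiffAt.comp x contDiffAt_snd)
  · intro b
    change IsUnit (S.comp T₀)
    rw [hS]
    exact isUnit_one
  · intro T b d hT hd
    have hT' : IsUnit (S.comp T) := hT
    have := Ring.inverse_mul_cancel _ hT'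
    simp only [← hd]
    exact (congrArg (fun A : V →L[ℝ] V => A d) this).symm

/-- Nothing is assumed of `d` beyond the equation; uniqueness makes it agree locally with the smooth
solution formula. -/
theorem contDiff_of_injective_system {E : Type} [NormedAddCommGroup E] [NormedSpace ℝ E]
    {T : E → V →L[ℝ] W} {b : E → W} {d : E → V} (hT : ContDiff ℝ ∞ T) (hb : ContDiff ℝ ∞ b)
    (hinj : ∀ p, Function.Injective (T p)) (hd : ∀ p, T p (d p) = b p) : ContDiff ℝ ∞ d := by
  rw [contDiff_iff_contDiffAt]
  intro p
  obtain ⟨O, Φ, hO, hΦ, hO', hsol⟩ := exists_smooth_solution_near (T p) (hinj p)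
  have hTb : ContDiff ℝ ∞ (fun p => (T p, b p)) := hT.prodMk hb
  have h1 : ContDiffAt ℝ ∞ (fun p => Φ (T p, b p)) p :=
    (hΦ.contDiffAt (hO.mem_nhds (hO' (b p)))).comp p hTb.contDiffAt
  refine h1.congr_of_eventuallyEq ?_
  filter_upwards [hTb.continuous.continuousAt.preimage_mem_nhds (hO.mem_nhds (hO' (b p)))]
    with q hq
  exact hsol _ _ _ hq (hd q)

theorem isAsympConst_of_injective_system {T : Spacetime → V →L[ℝ] W} {b : Spacetime → W}
    {d : Spacetime → V} {T₀ : V →L[ℝ] W} {b₀ : W} (hT : IsAsympConst T T₀)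
    (hb : IsAsympConst b b₀) (hinj : ∀ p, Function.Injective (T p))
    (h₀ : Function.Injective T₀) (hd : ∀ p, T p (d p) = b p) : ∃ d₀, IsAsympConst d d₀ := by
  obtain ⟨O, Φ, hO, hΦ, hO', hsol⟩ := exists_smooth_solution_near T₀ h₀
  exact ⟨_, (hT.prodMk hb).comp_of_eq hO hΦ (hO' b₀)
    (contDiff_of_injective_system hT.smooth hb.smooth hinj hd) fun p hp => hsol _ _ _ hp (hd p)⟩

end InjectiveLinearSystems

/-! ### Symmetry of second derivatives. -/

section SecondDerivatives

variable {E F : Type} [NormedAddCommGroup E] [NormedSpace ℝ E] [NormedAddCommGroup F]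
  [NormedSpace ℝ F]

theorem ContDiff.fderiv_apply_const {f : E → F} (hf : ContDiff ℝ ∞ f) (v : E) :
    ContDiff ℝ ∞ (fun p => fderiv ℝ f p v) :=
  (hf.fderiv_right (by simp)).clm_apply contDiff_const

theorem fderiv_fderiv_apply_comm {f : E → F} (hf : ContDiff ℝ ∞ f) (p u v : E) :
    fderiv ℝ (fun p => fderiv ℝ f p u) p v = fderiv ℝ (fun p => fderiv ℝ f p v) p u := by
  have hd : DifferentiableAt ℝ (fderiv ℝ f) p :=
    ((hf.fderiv_right (m := ∞) (by simp)).differentiable (by simp)).differentiableAt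
  have h1 : ∀ w : E, HasFDerivAt (fun p => fderiv ℝ f p w)
      ((ContinuousLinearMap.apply ℝ F w).comp (fderiv ℝ (fderiv ℝ f) p)) p := fun w =>
    (ContinuousLinearMap.apply ℝ F w).hasFDerivAt.comp p hd.hasFDerivAt
  rw [(h1 u).fderiv, (h1 v).fderiv]
  have := (hf.contDiffAt (x := p)).isSymmSndFDerivAt (by
    rw [minSmoothness_of_isRCLikeNormedField]
    exact WithTop.coe_le_coe.mpr (le_top : (2 : ℕ∞) ≤ ⊤))
  exact this v u

end SecondDerivatives

/-! ### L² estimates for test functions on the plane. -/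

section PlanarEstimates

open MeasureTheory

/-- Smooth compactly supported functions on the plane. -/
structure IsTest (χ : ℝ × ℝ → ℂ) : Prop where
  smooth : ContDiff ℝ ∞ χ
  compact : HasCompactSupport χ

theorem IsTest.fderiv_apply {χ : ℝ × ℝ → ℂ} (h : IsTest χ) (u : ℝ × ℝ) :
    IsTest (fun z => fderiv ℝ χ z u) :=
  ⟨h.smooth.fderiv_apply_const u, h.compact.fderiv_apply ℝ u⟩

theorem IsTest.mul_right {χ : ℝ × ℝ → ℂ} (h : IsTest χ) {f : ℝ × ℝ → ℂ} (hf : ContDiff ℝ ∞ f) :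
    IsTest (fun z => χ z * f z) :=
  ⟨h.smooth.mul hf, h.compact.mul_right⟩

theorem IsTest.add {χ ψ : ℝ × ℝ → ℂ} (h : IsTest χ) (h' : IsTest ψ) :
    IsTest (fun z => χ z + ψ z) := ⟨h.smooth.add h'.smooth, h.compact.add h'.compact⟩

theorem IsTest.const_mul {χ : ℝ × ℝ → ℂ} (h : IsTest χ) (c : ℂ) :
    IsTest (fun z => c * χ z) := ⟨contDiff_const.mul h.smooth, h.compact.mul_left⟩

theorem IsTest.memLp {χ : ℝ × ℝ → ℂ} (h : IsTest χ) (p : ENNReal) : MemLp χ p :=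
  h.smooth.continuous.memLp_of_hasCompactSupport h.compact

theorem IsTest.integrable {χ : ℝ × ℝ → ℂ} (h : IsTest χ) : Integrable χ :=
  h.smooth.continuous.integrable_of_hasCompactSupport h.compact

theorem IsTest.conj {χ : ℝ × ℝ → ℂ} (h : IsTest χ) : IsTest (fun z => conj (χ z)) :=
  ⟨Complex.conjCLE.contDiff.comp h.smooth, h.compact.comp_left (by simp)⟩

theorem fderiv_conj_apply {v : ℝ × ℝ → ℂ} (hv : ContDiff ℝ ∞ v) (z u : ℝ × ℝ) :
    fderiv ℝ (fun z => conj (v z)) z u = conj (fderiv ℝ v z u) := by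
  have h := (Complex.conjCLE.toContinuousLinearMap.hasFDerivAt (x := v z)).comp z
    ((hv.differentiable (by simp)) z).hasFDerivAt
  exact congrArg (fun A => A u) h.fderiv

/-- The two mixed Dirichlet integrals of a test function agree. -/
theorem IsTest.integral_mixed {v : ℝ × ℝ → ℂ} (hv : IsTest v) (a b : ℝ × ℝ) :
    ∫ z, fderiv ℝ v z a * conj (fderiv ℝ v z b) = ∫ z, fderiv ℝ v z b * conj (fderiv ℝ v z a) := by
  have key : ∀ a b : ℝ × ℝ, ∫ z, conj (fderiv ℝ v z b) * fderiv ℝ v z a =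
      -∫ z, conj (fderiv ℝ (fun z => fderiv ℝ v z b) z a) * v z := by
    intro a b
    have hb := hv.fderiv_apply b
    have h := integral_mul_fderiv_eq_neg_fderiv_mul_of_integrable (μ := volume)
      (f := fun z => conj (fderiv ℝ v z b)) (g := v) (v := a)
      ((hb.conj.fderiv_apply a).mul_right hv.smooth).integrable
      (hb.conj.mul_right (hv.fderiv_apply a).smooth).integrable
      (hb.conj.mul_right hv.smooth).integrable
      (fun x _ => hb.conj.smooth.differentiable (by simp) x)
      (fun x _ => hv.smooth.differentiable (by simp) x)
    rw [h]
    simp only [fderiv_conj_apply hb.smooth]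
  simp only [mul_comm (fderiv ℝ v _ _), key]
  congr 2
  funext z
  rw [fderiv_fderiv_apply_comm hv.smooth]

theorem eLpNorm_two_eq_of_integral {f g : ℝ × ℝ → ℂ} (hf : MemLp f 2) (hg : MemLp g 2)
    (h : ∫ z, f z * conj (f z) = ∫ z, g z * conj (g z)) :
    eLpNorm f 2 volume = eLpNorm g 2 volume := by
  rw [hf.eLpNorm_eq_integral_rpow_norm two_ne_zero ENNReal.ofNat_ne_top,
    hg.eLpNorm_eq_integral_rpow_norm two_ne_zero ENNReal.ofNat_ne_top]
  have e : ∀ f : ℝ × ℝ → ℂ, ((∫ z, ‖f z‖ ^ (2 : ENNReal).toReal : ℝ) : ℂ) =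
      ∫ z, f z * conj (f z) := by
    intro f
    rw [← integral_complex_ofReal]
    congr 1
    funext z
    rw [Complex.mul_conj, Complex.normSq_eq_norm_sq]
    simp
  have : (∫ z, ‖f z‖ ^ (2 : ENNReal).toReal) = ∫ z, ‖g z‖ ^ (2 : ENNReal).toReal := by
    rw [← Complex.ofReal_inj, e, e, h]
  rw [this]

/-- Ellipticity of `p ∂_a + q ∂_b`: passing to the conjugate symbol does not change the `L²` norm. -/
theorem IsTest.eLpNorm_conj_symbol {v : ℝ × ℝ → ℂ} (hv : IsTest v) (p q : ℂ) (a b : ℝ × ℝ) :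
    eLpNorm (fun z => conj p * fderiv ℝ v z a + conj q * fderiv ℝ v z b) 2 volume =
      eLpNorm (fun z => p * fderiv ℝ v z a + q * fderiv ℝ v z b) 2 volume := by
  have ha := hv.fderiv_apply a
  have hb := hv.fderiv_apply b
  have hL : ∀ p q : ℂ, IsTest (fun z => p * fderiv ℝ v z a + q * fderiv ℝ v z b) := fun p q =>
    (ha.const_mul p).add (hb.const_mul q)
  apply eLpNorm_two_eq_of_integral ((hL _ _).memLp 2) ((hL _ _).memLp 2)
  rw [← sub_eq_zero, ← integral_sub ((hL _ _).mul_right (hL _ _).conj.smooth).integrable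
    ((hL _ _).mul_right (hL _ _).conj.smooth).integrable]
  -- The two squared norms differ by a multiple of v_a v̄_b - v_b v̄_a, whose integral vanishes.
  have : ∀ z, (conj p * fderiv ℝ v z a + conj q * fderiv ℝ v z b) *
        conj (conj p * fderiv ℝ v z a + conj q * fderiv ℝ v z b) -
      (p * fderiv ℝ v z a + q * fderiv ℝ v z b) * conj (p * fderiv ℝ v z a + q * fderiv ℝ v z b) =
      (conj p * q - p * conj q) * (fderiv ℝ v z a * conj (fderiv ℝ v z b) -
        fderiv ℝ v z b * conj (fderiv ℝ v z a)) := by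
    intro z
    simp only [map_add, map_mul, Complex.conj_conj]
    ring
  simp only [this]
  rw [integral_const_mul, integral_sub (ha.mul_right hb.conj.smooth).integrable
    (hb.mul_right ha.conj.smooth).integrable, hv.integral_mixed a b, sub_self, mul_zero]

theorem eLpNorm_add_le_two {f g : ℝ × ℝ → ℂ} (hf : IsTest f) (hg : IsTest g) :
    eLpNorm (fun z => f z + g z) 2 volume ≤ eLpNorm f 2 volume + eLpNorm g 2 volume :=
  eLpNorm_add_le hf.smooth.continuous.aestronglyMeasurable
    hg.smooth.continuous.aestronglyMeasurable (by norm_num)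

theorem eLpNorm_const_mul_two (c : ℂ) (f : ℝ × ℝ → ℂ) :
    eLpNorm (fun z => c * f z) 2 volume = ‖c‖ₑ * eLpNorm f 2 volume :=
  eLpNorm_const_smul c f 2 volume

/-- The operator p ∂_a + q ∂_b and the one with conjugate symbol determine ∂_a by Cramer's rule,
with determinant Δ = 2i Im(p q̄) ≠ 0. Both have the same L² norm on test functions, so one of them
alone controls ∂_a. -/
theorem IsTest.eLpNorm_fderiv_le {p q : ℂ} (hpq : (p * conj q).im ≠ 0) (a b : ℝ × ℝ) :
    ∃ C : NNReal, ∀ v : ℝ × ℝ → ℂ, IsTest v →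
      eLpNorm (fun z => fderiv ℝ v z a) 2 volume ≤
        C * eLpNorm (fun z => p * fderiv ℝ v z a + q * fderiv ℝ v z b) 2 volume := by
  set Δ : ℂ := p * conj q - conj p * q with hΔ
  have hΔ0 : Δ ≠ 0 := by
    intro h0
    apply hpq
    have h1 := congrArg Complex.im h0
    simp [hΔ] at h1
    simp
    linarith
  refine ⟨‖Δ⁻¹ * conj q‖₊ + ‖-(Δ⁻¹ * q)‖₊, fun v hv => ?_⟩
  have ha := hv.fderiv_apply a
  have hb := hv.fderiv_apply b
  have hL : ∀ p q : ℂ, IsTest (fun z => p * fderiv ℝ v z a + q * fderiv ℝ v z b) := fun p q =>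
    (ha.const_mul p).add (hb.const_mul q)
  have e : (fun z => fderiv ℝ v z a) = fun z =>
      (Δ⁻¹ * conj q) * (p * fderiv ℝ v z a + q * fderiv ℝ v z b) +
      (-(Δ⁻¹ * q)) * (conj p * fderiv ℝ v z a + conj q * fderiv ℝ v z b) := by
    funext z
    have : Δ⁻¹ * (p * conj q - conj p * q) = 1 := inv_mul_cancel₀ hΔ0
    linear_combination (-fderiv ℝ v z a) * this
  conv_lhs => rw [e]
  refine (eLpNorm_add_le_two ((hL _ _).const_mul _) ((hL _ _).const_mul _)).trans ?_
  rw [eLpNorm_const_mul_two, eLpNorm_const_mul_two, hv.eLpNorm_conj_symbol p q a b, ← add_mul]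
  simp [enorm_eq_nnnorm]

/-- The fundamental theorem of calculus, once in each variable. Together with Cauchy–Schwarz on a
bounded support this gives the sup bound behind the Sobolev embedding. -/
theorem IsTest.enorm_le_lintegral {v : ℝ × ℝ → ℂ} (hv : IsTest v) :
    ‖v 0‖ₑ ≤ ∫⁻ z, ‖fderiv ℝ (fun z => fderiv ℝ v z (1, 0)) z (0, 1)‖ₑ := by
  have hd : ∀ (f : ℝ × ℝ → ℂ), IsTest f → ∀ y, (∀ x, HasDerivAt (fun x => f (x, y))
      (fderiv ℝ f (x, y) (1, 0)) x) := by
    intro f hf y x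
    have h1 : HasDerivAt (fun x : ℝ => (x, y)) ((1 : ℝ), (0 : ℝ)) x :=
      (hasDerivAt_id x).prodMk (hasDerivAt_const x y)
    exact ((hf.smooth.differentiable (by simp)) (x, y)).hasFDerivAt.comp_hasDerivAt x h1
  have hd' : ∀ (f : ℝ × ℝ → ℂ), IsTest f → ∀ x, (∀ y, HasDerivAt (fun y => f (x, y))
      (fderiv ℝ f (x, y) (0, 1)) y) := by
    intro f hf x y
    have h1 : HasDerivAt (fun y : ℝ => (x, y)) ((0 : ℝ), (1 : ℝ)) y :=
      (hasDerivAt_const y x).prodMk (hasDerivAt_id y)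
    exact ((hf.smooth.differentiable (by simp)) (x, y)).hasFDerivAt.comp_hasDerivAt y h1
  have hcs : ∀ (f : ℝ × ℝ → ℂ), IsTest f → ∀ y, HasCompactSupport (fun x => f (x, y)) := by
    intro f hf y
    exact hf.compact.comp_isClosedEmbedding (g := fun x : ℝ => (x, y))
      (Topology.IsClosedEmbedding.of_continuous_injective_isClosedMap (by fun_prop)
        (fun a b h => (Prod.mk.inj h).1)
        (fun s hs => by
          have : (fun x : ℝ => (x, y)) '' s = s ×ˢ {y} := by ext ⟨a, b⟩; simp [eq_comm]
          rw [this]; exact hs.prod isClosed_singleton))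
  have hcs' : ∀ (f : ℝ × ℝ → ℂ), IsTest f → ∀ x, HasCompactSupport (fun y => f (x, y)) := by
    intro f hf x
    exact hf.compact.comp_isClosedEmbedding (g := fun y : ℝ => (x, y))
      (Topology.IsClosedEmbedding.of_continuous_injective_isClosedMap (by fun_prop)
        (fun a b h => (Prod.mk.inj h).2)
        (fun s hs => by
          have : (fun y : ℝ => (x, y)) '' s = {x} ×ˢ s := by ext ⟨a, b⟩; simp [eq_comm, and_comm]
          rw [this]; exact isClosed_singleton.prod hs))
  have hx := hv.fderiv_apply (1, 0)
  have hxy := hx.fderiv_apply (0, 1)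
  have s1 : ‖v 0‖ₑ ≤ ∫⁻ x, ‖fderiv ℝ v (x, 0) (1, 0)‖ₑ := by
    have h := (hcs v hv 0).enorm_le_lintegral_Ici_deriv
      ((hv.smooth.comp (f := fun x : ℝ => (x, (0 : ℝ))) (by fun_prop)).of_le (by simp)) 0
    refine h.trans ((setLIntegral_le_lintegral _ _).trans (le_of_eq ?_))
    congr 1
    funext x
    exact congrArg _ (hd v hv 0 x).deriv
  have s2 : ∀ x, ‖fderiv ℝ v (x, 0) (1, 0)‖ₑ ≤
      ∫⁻ y, ‖fderiv ℝ (fun z => fderiv ℝ v z (1, 0)) (x, y) (0, 1)‖ₑ := by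
    intro x
    have h := (hcs' _ hx x).enorm_le_lintegral_Ici_deriv
      ((hx.smooth.comp (f := fun y : ℝ => (x, y)) (by fun_prop)).of_le (by simp)) 0
    refine h.trans ((setLIntegral_le_lintegral _ _).trans (le_of_eq ?_))
    congr 1
    funext y
    exact congrArg _ (hd' _ hx x y).deriv
  refine s1.trans ((lintegral_mono s2).trans (le_of_eq ?_))
  rw [Measure.volume_eq_prod, lintegral_prod]
  exact (hxy.smooth.continuous.enorm).aemeasurable

theorem IsTest.eLpNorm_one_le {w : ℝ × ℝ → ℂ} (hw : IsTest w) {K : Set (ℝ × ℝ)}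
    (hK : Function.support w ⊆ K) :
    ∫⁻ z, ‖w z‖ₑ ≤ eLpNorm w 2 volume * volume K ^ (1 / 2 : ℝ) := by
  rw [← eLpNorm_one_eq_lintegral_enorm, ← eLpNorm_restrict_eq_of_support_subset hK,
    ← eLpNorm_restrict_eq_of_support_subset (p := 2) hK]
  have := eLpNorm_le_eLpNorm_mul_rpow_measure_univ (μ := volume.restrict K) (p := 1) (q := 2)
    (f := w) (by norm_num) hw.smooth.continuous.aestronglyMeasurable
  refine this.trans (le_of_eq ?_)
  rw [Measure.restrict_apply_univ]
  norm_num

end PlanarEstimates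

/-! ### Local L² and Sobolev decay at spatial infinity. -/

section LocalL2

open MeasureTheory

/-- The time slice of `f` at `t`, translated by `q`. -/
def slice (f : Spacetime → ℂ) (t : ℝ) (q z : ℝ × ℝ) : ℂ := f (z.1 + q.1, z.2 + q.2, t)

theorem contDiff_slice {f : Spacetime → ℂ} (hf : ContDiff ℝ ∞ f) (t : ℝ) (q : ℝ × ℝ) :
    ContDiff ℝ ∞ (slice f t q) := by
  unfold slice
  exact hf.comp (by fun_prop)

theorem fderiv_slice {f : Spacetime → ℂ} (hf : ContDiff ℝ ∞ f) (t : ℝ) (q z u : ℝ × ℝ) :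
    fderiv ℝ (slice f t q) z u = slice (fun p => fderiv ℝ f p (u.1, u.2, 0)) t q z := by
  have h1 : HasFDerivAt (fun z : ℝ × ℝ => ((z.1 + q.1, z.2 + q.2, t) : Spacetime))
      ((ContinuousLinearMap.fst ℝ ℝ ℝ).prod ((ContinuousLinearMap.snd ℝ ℝ ℝ).prod 0)) z :=
    (hasFDerivAt_fst.add_const _).prodMk
      ((hasFDerivAt_snd.add_const _).prodMk (hasFDerivAt_const _ _))
  have h2 := ((hf.differentiable (by simp)) (z.1 + q.1, z.2 + q.2, t)).hasFDerivAt.comp z h1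
  exact congrArg (fun A => A u) h2.fderiv

theorem fderiv_mul_slice {χ : ℝ × ℝ → ℂ} (hχ : IsTest χ) {f : Spacetime → ℂ}
    (hf : ContDiff ℝ ∞ f) (t : ℝ) (q z u : ℝ × ℝ) :
    fderiv ℝ (fun z => χ z * slice f t q z) z u =
      χ z * slice (fun p => fderiv ℝ f p (u.1, u.2, 0)) t q z +
        fderiv ℝ χ z u * slice f t q z := by
  rw [fderiv_fun_mul (hχ.smooth.differentiable (by simp) z)
    ((contDiff_slice hf t q).differentiable (by simp) z)]
  simp [fderiv_slice hf, mul_comm]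

/-- The local `L²` norms of `f` on the time slices tend to `0` at spatial infinity. -/
def VanishesL2 (f : Spacetime → ℂ) : Prop :=
  ∀ (t : ℝ) (χ : ℝ × ℝ → ℂ), IsTest χ → Tendsto
    (fun q : ℝ × ℝ => eLpNorm (fun z => χ z * slice f t q z) 2 volume) (cocompact (ℝ × ℝ)) (𝓝 0)

/-- Translates of a compact set eventually leave every ball, so decay at infinity becomes uniform
smallness on the translated set. -/
theorem eventually_slice_le {a : Spacetime → ℂ} {t : ℝ}
    (ha : Tendsto (fun q : ℝ × ℝ => a (q.1, q.2, t)) (cocompact (ℝ × ℝ)) (𝓝 0))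
    {K : Set (ℝ × ℝ)} (hK : IsCompact K) {ε : ℝ} (hε : 0 < ε) :
    ∀ᶠ q in cocompact (ℝ × ℝ), ∀ z ∈ K, ‖slice a t q z‖ ≤ ε := by
  have h1 : ∀ᶠ q : ℝ × ℝ in cocompact (ℝ × ℝ), ‖a (q.1, q.2, t)‖ < ε := by
    have := ha.norm
    rw [norm_zero] at this
    exact this.eventually (gt_mem_nhds hε)
  rw [← Metric.cobounded_eq_cocompact, ← comap_norm_atTop, eventually_comap,
    eventually_atTop] at h1 ⊢
  obtain ⟨R, hR⟩ := h1
  obtain ⟨B, hB⟩ := hK.exists_bound_of_continuousOn (f := fun z : ℝ × ℝ => z) continuousOn_id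
  refine ⟨R + B, fun b hb q hq z hz => ?_⟩
  refine (hR ‖z + q‖ ?_ (z + q) rfl).le
  have := norm_sub_le (z + q) z
  rw [add_sub_cancel_left] at this
  have := hB z hz
  simp only [ge_iff_le] at *
  linarith

theorem VanishesL2.mul_of_tendsto {a w : Spacetime → ℂ} (hw : VanishesL2 w)
    (ha : ∀ t : ℝ, Tendsto (fun q : ℝ × ℝ => a (q.1, q.2, t)) (cocompact (ℝ × ℝ)) (𝓝 0)) :
    VanishesL2 (fun p => a p * w p) := by
  intro t χ hχ
  refine tendsto_of_tendsto_of_tendsto_of_le_of_le' tendsto_const_nhds (hw t χ hχ)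
    (Eventually.of_forall fun _ => zero_le) ?_
  filter_upwards [eventually_slice_le (ha t) hχ.compact one_pos] with q hq
  apply eLpNorm_mono
  intro z
  by_cases hz : z ∈ tsupport χ
  · have h1 : slice (fun p => a p * w p) t q z = slice a t q z * slice w t q z := rfl
    rw [h1, norm_mul, norm_mul, norm_mul]
    have := hq z hz
    calc ‖χ z‖ * (‖slice a t q z‖ * ‖slice w t q z‖)
        ≤ ‖χ z‖ * (1 * ‖slice w t q z‖) := by gcongr
      _ = _ := by rw [one_mul]
  · rw [image_eq_zero_of_notMem_tsupport hz]
    simp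

theorem vanishesL2_of_tendsto {f : Spacetime → ℂ}
    (hf : ∀ t : ℝ, Tendsto (fun q : ℝ × ℝ => f (q.1, q.2, t)) (cocompact (ℝ × ℝ)) (𝓝 0)) :
    VanishesL2 f := by
  intro t χ hχ
  rw [ENNReal.tendsto_nhds_zero]
  intro ε hε
  have hfin : eLpNorm χ 2 volume ≠ ⊤ := (hχ.memLp 2).eLpNorm_ne_top
  obtain ⟨δ, hδ, hδε⟩ : ∃ δ : ℝ, 0 < δ ∧ ENNReal.ofReal δ * eLpNorm χ 2 volume ≤ ε := by
    by_cases htop : ε = ⊤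
    · exact ⟨1, one_pos, by simp [htop]⟩
    · have hx : 0 < ε.toReal := ENNReal.toReal_pos hε.ne' htop
      set N := (eLpNorm χ 2 volume).toReal with hN
      have hN0 : 0 ≤ N := ENNReal.toReal_nonneg
      refine ⟨ε.toReal / (N + 1), by positivity, ?_⟩
      rw [← ENNReal.ofReal_toReal hfin, ← hN, ← ENNReal.ofReal_mul (by positivity)]
      rw [← ENNReal.ofReal_toReal htop]
      apply ENNReal.ofReal_le_ofReal
      rw [div_mul_eq_mul_div, div_le_iff₀ (by positivity), ENNReal.toReal_ofReal hx.le]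
      nlinarith
  filter_upwards [eventually_slice_le (hf t) hχ.compact hδ] with q hq
  refine le_trans ?_ hδε
  apply eLpNorm_le_mul_eLpNorm_of_ae_le_mul
  refine Eventually.of_forall fun z => ?_
  by_cases hz : z ∈ tsupport χ
  · rw [norm_mul, mul_comm]
    gcongr
    exact hq z hz
  · rw [image_eq_zero_of_notMem_tsupport hz]
    simp

theorem VanishesL2.add {f g : Spacetime → ℂ} (hf : VanishesL2 f) (hg : VanishesL2 g)
    (hfs : ContDiff ℝ ∞ f) (hgs : ContDiff ℝ ∞ g) : VanishesL2 (fun p => f p + g p) := by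
  intro t χ hχ
  have := (hf t χ hχ).add (hg t χ hχ)
  rw [add_zero] at this
  refine tendsto_of_tendsto_of_tendsto_of_le_of_le tendsto_const_nhds this
    (fun _ => zero_le) fun q => ?_
  refine le_trans (le_of_eq ?_) (eLpNorm_add_le_two (hχ.mul_right (contDiff_slice hfs t q))
    (hχ.mul_right (contDiff_slice hgs t q)))
  congr 1
  funext z
  exact mul_add _ _ _

theorem VanishesL2.const_mul {f : Spacetime → ℂ} (hf : VanishesL2 f) (c : ℂ) :
    VanishesL2 (fun p => c * f p) := by
  intro t χ hχ
  have := ENNReal.Tendsto.const_mul (hf t χ hχ) (Or.inr (enorm_ne_top (x := c)))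
  rw [mul_zero] at this
  refine this.congr fun q => ?_
  rw [← eLpNorm_const_mul_two]
  congr 1
  funext z
  exact mul_left_comm _ _ _

/-- The elliptic estimate is applied to the cut-off function χ w. The commutator terms contain only
w times derivatives of χ, which are again test functions, so they vanish by the hypothesis on w. -/
theorem VanishesL2.of_elliptic {p q : ℂ} (hpq : (p * conj q).im ≠ 0) {a b : ℝ × ℝ}
    {w : Spacetime → ℂ} (hs : ContDiff ℝ ∞ w) (hw : VanishesL2 w)
    (hL : VanishesL2 (fun x => p * fderiv ℝ w x (a.1, a.2, 0) + q * fderiv ℝ w x (b.1, b.2, 0))) :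
    VanishesL2 (fun x => fderiv ℝ w x (a.1, a.2, 0)) := by
  intro t χ hχ
  obtain ⟨C, hC⟩ := IsTest.eLpNorm_fderiv_le hpq a b
  have hLs : ContDiff ℝ ∞
      (fun x => p * fderiv ℝ w x (a.1, a.2, 0) + q * fderiv ℝ w x (b.1, b.2, 0)) :=
    (contDiff_const.mul (hs.fderiv_apply_const _)).add
      (contDiff_const.mul (hs.fderiv_apply_const _))
  have hχa := hχ.fderiv_apply a
  have hχL := (hχa.const_mul p).add ((hχ.fderiv_apply b).const_mul q)
  have hlim := (ENNReal.Tendsto.const_mul ((hL t χ hχ).add (hw t _ hχL))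
    (Or.inr (ENNReal.coe_ne_top (r := C)))).add ((hw t _ hχa))
  rw [add_zero, add_zero, mul_zero] at hlim
  refine tendsto_of_tendsto_of_tendsto_of_le_of_le tendsto_const_nhds hlim
    (fun _ => zero_le) fun y => ?_
  have hv : IsTest (fun z => χ z * slice w t y z) := hχ.mul_right (contDiff_slice hs t y)
  have e : (fun z => χ z * slice (fun x => fderiv ℝ w x (a.1, a.2, 0)) t y z) = fun z =>
      fderiv ℝ (fun z => χ z * slice w t y z) z a + (-1) * (fderiv ℝ χ z a * slice w t y z) := by
    funext z
    rw [fderiv_mul_slice hχ hs]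
    ring
  have e2 : (fun z => p * fderiv ℝ (fun z => χ z * slice w t y z) z a +
      q * fderiv ℝ (fun z => χ z * slice w t y z) z b) = fun z =>
      χ z * slice (fun x => p * fderiv ℝ w x (a.1, a.2, 0) + q * fderiv ℝ w x (b.1, b.2, 0)) t y z
      + (p * fderiv ℝ χ z a + q * fderiv ℝ χ z b) * slice w t y z := by
    funext z
    rw [fderiv_mul_slice hχ hs, fderiv_mul_slice hχ hs]
    simp only [slice]
    ring
  have h1 := hC _ hv
  rw [e2] at h1
  simp only
  rw [e]
  refine (eLpNorm_add_le_two (hv.fderiv_apply a)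
    ((hχa.mul_right (contDiff_slice hs t y)).const_mul _)).trans ?_
  rw [eLpNorm_const_mul_two]
  simp only [enorm_neg, enorm_one, one_mul]
  gcongr
  refine h1.trans ?_
  gcongr
  exact eLpNorm_add_le_two (hχ.mul_right (contDiff_slice hLs t y))
    (hχL.mul_right (contDiff_slice hs t y))

/-- All derivatives of order at most `m` vanish at spatial infinity in the local `L²` sense. -/
def VanishesSobolev : ℕ → (Spacetime → ℂ) → Prop
  | 0, f => VanishesL2 f
  | m + 1, f => VanishesSobolev m f ∧ ∀ v, VanishesSobolev m (fun p => fderiv ℝ f p v)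

theorem VanishesSobolev.vanishesL2 {m : ℕ} {f : Spacetime → ℂ} (h : VanishesSobolev m f) :
    VanishesL2 f := by
  induction m with
  | zero => exact h
  | succ m ih => exact ih h.1

theorem VanishesSobolev.add {m : ℕ} {f g : Spacetime → ℂ} (hf : VanishesSobolev m f)
    (hg : VanishesSobolev m g) (hfs : ContDiff ℝ ∞ f) (hgs : ContDiff ℝ ∞ g) :
    VanishesSobolev m (fun p => f p + g p) := by
  induction m generalizing f g with
  | zero => exact VanishesL2.add hf hg hfs hgs
  | succ m ih =>
    refine ⟨ih hf.1 hg.1 hfs hgs, fun v => ?_⟩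
    have e : (fun p => fderiv ℝ (fun p => f p + g p) p v) =
        fun p => fderiv ℝ f p v + fderiv ℝ g p v := by
      funext p
      rw [fderiv_fun_add (hfs.differentiable (by simp) p) (hgs.differentiable (by simp) p)]
      rfl
    rw [e]
    exact ih (hf.2 v) (hg.2 v) (hfs.fderiv_apply_const v) (hgs.fderiv_apply_const v)

theorem VanishesSobolev.const_mul {m : ℕ} {f : Spacetime → ℂ} (hf : VanishesSobolev m f)
    (hfs : ContDiff ℝ ∞ f) (c : ℂ) : VanishesSobolev m (fun p => c * f p) := by
  induction m generalizing f with
  | zero => exact VanishesL2.const_mul hf c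
  | succ m ih =>
    refine ⟨ih hf.1 hfs, fun v => ?_⟩
    have e : (fun p => fderiv ℝ (fun p => c * f p) p v) = fun p => c * fderiv ℝ f p v := by
      funext p
      rw [fderiv_const_mul (hfs.differentiable (by simp) p)]
      rfl
    rw [e]
    exact ih (hf.2 v) (hfs.fderiv_apply_const v)

theorem VanishesSobolev.sum {ι : Type} {m : ℕ} (s : Finset ι) {f : ι → Spacetime → ℂ}
    (hf : ∀ i ∈ s, VanishesSobolev m (f i)) (hfs : ∀ i ∈ s, ContDiff ℝ ∞ (f i))
    (h0 : VanishesSobolev m (fun _ => 0)) : VanishesSobolev m (fun p => ∑ i ∈ s, f i p) := by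
  classical
  induction s using Finset.induction_on with
  | empty => simpa using h0
  | insert a s ha ih =>
    simp only [Finset.sum_insert ha]
    exact (hf a (Finset.mem_insert_self _ _)).add
      (ih (fun i hi => hf i (Finset.mem_insert_of_mem hi))
        (fun i hi => hfs i (Finset.mem_insert_of_mem hi)))
      (hfs a (Finset.mem_insert_self _ _))
      (ContDiff.sum fun i hi => hfs i (Finset.mem_insert_of_mem hi))

theorem VanishesSobolev.mul {m : ℕ} {a w : Spacetime → ℂ} (hw : VanishesSobolev m w)
    (ha : IsAsympConst a 0) (hs : ContDiff ℝ ∞ w) : VanishesSobolev m (fun p => a p * w p) := by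
  induction m generalizing a w with
  | zero => exact VanishesL2.mul_of_tendsto hw ha.tendsto
  | succ m ih =>
    refine ⟨ih hw.1 ha hs, fun v => ?_⟩
    have e : (fun p => fderiv ℝ (fun p => a p * w p) p v) =
        fun p => a p * fderiv ℝ w p v + fderiv ℝ a p v * w p := by
      funext p
      rw [fderiv_fun_mul (ha.smooth.differentiable (by simp) p) (hs.differentiable (by simp) p)]
      simp [mul_comm]
    rw [e]
    exact (ih (hw.2 v) ha (hs.fderiv_apply_const v)).add (ih hw.1 (ha.fderiv_apply v) hs)
      (ha.smooth.mul (hs.fderiv_apply_const v)) ((ha.smooth.fderiv_apply_const v).mul hs)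

theorem IsAsympConst.vanishesSobolev {f : Spacetime → ℂ} (hf : IsAsympConst f 0) (m : ℕ) :
    VanishesSobolev m f := by
  induction m generalizing f with
  | zero => exact vanishesL2_of_tendsto hf.tendsto
  | succ m ih => exact ⟨ih hf, fun v => ih (hf.fderiv_apply v)⟩

/-- Sobolev embedding at spatial infinity. -/
theorem VanishesSobolev.tendsto {w : Spacetime → ℂ} (hw : VanishesSobolev 2 w)
    (hs : ContDiff ℝ ∞ w) (t : ℝ) :
    Tendsto (fun q : ℝ × ℝ => w (q.1, q.2, t)) (cocompact (ℝ × ℝ)) (𝓝 0) := by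
  obtain ⟨χ, hχ, hχ0⟩ : ∃ χ : ℝ × ℝ → ℂ, IsTest χ ∧ χ 0 = 1 := by
    obtain ⟨f, -, hf1, hf2, -, hf3⟩ := exists_contDiff_tsupport_subset (n := ⊤)
      (Metric.ball_mem_nhds (0 : ℝ × ℝ) one_pos)
    exact ⟨fun z => (f z : ℂ), ⟨Complex.ofRealCLM.contDiff.comp hf2,
      hf1.comp_left (g := fun x : ℝ => (x : ℂ)) (by simp)⟩, by simp [hf3]⟩
  set X : ℝ × ℝ := (1, 0)
  set Y : ℝ × ℝ := (0, 1)
  set wx := fun p => fderiv ℝ w p (X.1, X.2, 0) with hwx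
  set wy := fun p => fderiv ℝ w p (Y.1, Y.2, 0) with hwy
  set wxy := fun p => fderiv ℝ wx p (Y.1, Y.2, 0) with hwxy
  have hwxs : ContDiff ℝ ∞ wx := hs.fderiv_apply_const _
  have hwys : ContDiff ℝ ∞ wy := hs.fderiv_apply_const _
  have hwxys : ContDiff ℝ ∞ wxy := hwxs.fderiv_apply_const _
  have hχx := hχ.fderiv_apply X
  have hχy := hχ.fderiv_apply Y
  have hχxy := hχx.fderiv_apply Y
  -- The mixed derivative of χ w has four terms, each a test function times a derivative of w of
  -- order at most two.
  have hlim := (((hw.2 (X.1, X.2, 0)).2 (Y.1, Y.2, 0)).vanishesL2 t χ hχ).add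
    (((hw.1.2 (X.1, X.2, 0)).vanishesL2 t _ hχy).add
    (((hw.1.2 (Y.1, Y.2, 0)).vanishesL2 t _ hχx).add (hw.vanishesL2 t _ hχxy)))
  have hKfin : volume (tsupport χ) ^ (1 / 2 : ℝ) ≠ ⊤ :=
    ENNReal.rpow_ne_top_of_nonneg (by norm_num) hχ.compact.measure_lt_top.ne
  have hlim2 := ENNReal.Tendsto.mul_const hlim (Or.inr hKfin)
  simp only [add_zero, zero_mul] at hlim2
  rw [tendsto_zero_iff_enorm_tendsto_zero]
  refine tendsto_of_tendsto_of_tendsto_of_le_of_le tendsto_const_nhds hlim2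
    (fun _ => zero_le) fun q => ?_
  have hv : IsTest (fun z => χ z * slice w t q z) := hχ.mul_right (contDiff_slice hs t q)
  have h1 := hv.enorm_le_lintegral
  have h2 := ((hv.fderiv_apply X).fderiv_apply Y).eLpNorm_one_le (K := tsupport χ) (by
    refine (subset_tsupport _).trans ?_
    refine (tsupport_fderiv_apply_subset ℝ Y).trans ?_
    refine (tsupport_fderiv_apply_subset ℝ X).trans ?_
    exact tsupport_mul_subset_left)
  have e0 : ‖w (q.1, q.2, t)‖ₑ = ‖χ 0 * slice w t q 0‖ₑ := by simp [hχ0, slice]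
  have e1 : (fun z => fderiv ℝ (fun z => fderiv ℝ (fun z => χ z * slice w t q z) z X) z Y) =
      fun z => χ z * slice wxy t q z + (fderiv ℝ χ z Y * slice wx t q z +
        (fderiv ℝ χ z X * slice wy t q z +
          fderiv ℝ (fun z => fderiv ℝ χ z X) z Y * slice w t q z)) := by
    have e2 : (fun z => fderiv ℝ (fun z => χ z * slice w t q z) z X) = fun z =>
        χ z * slice wx t q z + fderiv ℝ χ z X * slice w t q z := by
      funext z
      rw [fderiv_mul_slice hχ hs]
    funext z
    rw [e2, fderiv_fun_add
      ((hχ.mul_right (contDiff_slice hwxs t q)).smooth.differentiable (by simp) z)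
      ((hχx.mul_right (contDiff_slice hs t q)).smooth.differentiable (by simp) z)]
    rw [add_apply, fderiv_mul_slice hχ hwxs, fderiv_mul_slice hχx hs]
    simp only [hwy, hwxy]
    ring
  rw [e0]
  refine h1.trans (h2.trans ?_)
  · rw [e1]
    gcongr
    have t1 := hχ.mul_right (contDiff_slice hwxys t q)
    have t2 := hχy.mul_right (contDiff_slice hwxs t q)
    have t3 := hχx.mul_right (contDiff_slice hwys t q)
    have t4 := hχxy.mul_right (contDiff_slice hs t q)
    refine (eLpNorm_add_le_two t1 (t2.add (t3.add t4))).trans ?_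
    gcongr
    refine (eLpNorm_add_le_two t2 (t3.add t4)).trans ?_
    gcongr
    exact eLpNorm_add_le_two t3 t4

theorem isAsympConst_of_vanishesSobolev {w : Spacetime → ℂ} (hs : ContDiff ℝ ∞ w)
    (hw : ∀ m, VanishesSobolev m w) : IsAsympConst w 0 :=
  isAsympConst_zero_of_closed (𝒞 := fun w => ContDiff ℝ ∞ w ∧ ∀ m, VanishesSobolev m w)
    (fun _ h => h.1) (fun _ h t => (h.2 2).tendsto h.1 t)
    (fun _ h v => ⟨h.1.fderiv_apply_const v, fun m => (h.2 (m + 1)).2 v⟩) ⟨hs, hw⟩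

theorem VanishesSobolev.congr {m : ℕ} {f g : Spacetime → ℂ} (hf : VanishesSobolev m f)
    (h : ∀ p, g p = f p) : VanishesSobolev m g := by
  rwa [funext h]

theorem fderiv_apply_eq_sum {E : Type} [NormedAddCommGroup E] [NormedSpace ℝ E]
    (w : Spacetime → E) (p v : Spacetime) :
    fderiv ℝ w p v = v.1 • fderiv ℝ w p (1, 0, 0) + (v.2.1 • fderiv ℝ w p (0, 1, 0) +
      v.2.2 • fderiv ℝ w p (0, 0, 1)) := by
  rw [← map_smul, ← map_smul, ← map_smul, ← map_add, ← map_add]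
  congr 1
  ext <;> simp

/-- τ times the first expression plus the second is (τ² - 1) w_y - 2τ w_x, free of w_t. It is
elliptic on time slices exactly for nonreal τ, as Im(-2τ conj(τ² - 1)) = 2 Im τ (|τ|² + 1). This
controls w_x and w_y, and the first expression then gives w_t. The coefficients are constant, so
derivatives of w satisfy the same system and the order can be raised by induction. -/
theorem VanishesSobolev.of_system {τ : ℂ} (hτ : τ.im ≠ 0) {m : ℕ} {w : Spacetime → ℂ}
    (hs : ContDiff ℝ ∞ w) (hw : VanishesL2 w)
    (h1 : VanishesSobolev m (fun p => τ * fderiv ℝ w p (0, 1, 0) -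
      (fderiv ℝ w p (0, 0, 1) + fderiv ℝ w p (1, 0, 0))))
    (h2 : VanishesSobolev m (fun p => τ * (fderiv ℝ w p (0, 0, 1) - fderiv ℝ w p (1, 0, 0)) -
      fderiv ℝ w p (0, 1, 0))) : VanishesSobolev (m + 1) w := by
  have hsd : ∀ v, ContDiff ℝ ∞ (fun p => fderiv ℝ w p v) := hs.fderiv_apply_const
  have hs1 : ContDiff ℝ ∞ (fun p => τ * fderiv ℝ w p (0, 1, 0) -
      (fderiv ℝ w p (0, 0, 1) + fderiv ℝ w p (1, 0, 0))) :=
    (contDiff_const.mul (hsd _)).sub ((hsd _).add (hsd _))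
  have hs2 : ContDiff ℝ ∞ (fun p => τ * (fderiv ℝ w p (0, 0, 1) - fderiv ℝ w p (1, 0, 0)) -
      fderiv ℝ w p (0, 1, 0)) := (contDiff_const.mul ((hsd _).sub (hsd _))).sub (hsd _)
  induction m generalizing w with
  | zero =>
    refine ⟨hw, ?_⟩
    have hsym : (-2 * τ * conj (τ ^ 2 - 1)).im ≠ 0 := by
      have : (-2 * τ * conj (τ ^ 2 - 1)).im = 2 * τ.im * (τ.re ^ 2 + τ.im ^ 2 + 1) := by
        simp [pow_two]
        ring
      rw [this]
      have : 0 < τ.re ^ 2 + τ.im ^ 2 + 1 := by positivity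
      exact mul_ne_zero (mul_ne_zero two_ne_zero hτ) this.ne'
    have hsym' : ((τ ^ 2 - 1) * conj (-2 * τ)).im ≠ 0 := by
      have : (τ ^ 2 - 1) * conj (-2 * τ) = conj (-2 * τ * conj (τ ^ 2 - 1)) := by
        rw [map_mul (starRingEnd ℂ) (-2 * τ), Complex.conj_conj, mul_comm]
      rw [this, Complex.conj_im]
      exact neg_ne_zero.mpr hsym
    have hL := (VanishesSobolev.const_mul h1 hs1 τ).add h2 (contDiff_const.mul hs1) hs2
    have hx : VanishesSobolev 0 (fun p => fderiv ℝ w p (1, 0, 0)) :=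
      VanishesL2.of_elliptic hsym (a := (1, 0)) (b := (0, 1)) hs hw
        (hL.congr fun p => by simp only; ring)
    have hy : VanishesSobolev 0 (fun p => fderiv ℝ w p (0, 1, 0)) :=
      VanishesL2.of_elliptic hsym' (a := (0, 1)) (b := (1, 0)) hs hw
        (hL.congr fun p => by simp only; ring)
    have ht : VanishesSobolev 0 (fun p => fderiv ℝ w p (0, 0, 1)) :=
      ((hy.const_mul (hsd _) τ).add ((hx.const_mul (hsd _) (-1)).add
        (VanishesSobolev.const_mul h1 hs1 (-1)) (contDiff_const.mul (hsd _))
        (contDiff_const.mul hs1))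
        (contDiff_const.mul (hsd _))
        ((contDiff_const.mul (hsd _)).add (contDiff_const.mul hs1))).congr fun p => by ring
    intro v
    refine ((hx.const_mul (hsd _) v.1).add ((hy.const_mul (hsd _) v.2.1).add
      (ht.const_mul (hsd _) v.2.2) (contDiff_const.mul (hsd _)) (contDiff_const.mul (hsd _)))
      (contDiff_const.mul (hsd _))
      ((contDiff_const.mul (hsd _)).add (contDiff_const.mul (hsd _)))).congr fun p => ?_
    rw [fderiv_apply_eq_sum]
    simp only [Complex.real_smul]
  | succ m ih =>
    have hfirst := ih hs hw h1.1 h2.1 hsd hs1 hs2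
    refine ⟨hfirst, fun v => ?_⟩
    have hd : ∀ u p, DifferentiableAt ℝ (fun p => fderiv ℝ w p u) p := fun u p =>
      (hsd u).differentiable (by simp) p
    have hsv : ∀ u, ContDiff ℝ ∞ (fun p => fderiv ℝ (fun p => fderiv ℝ w p v) p u) :=
      (hsd v).fderiv_apply_const
    refine ih (hsd v) (hfirst.2 v).vanishesL2 ((h1.2 v).congr fun p => ?_)
      ((h2.2 v).congr fun p => ?_) hsv ?_ ?_
    · rw [fderiv_fun_sub ((hd _ p).const_mul τ) ((hd _ p).fun_add (hd _ p)),
        fderiv_fun_add (hd _ p) (hd _ p), fderiv_const_mul (hd _ p)]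
      simp [fderiv_fderiv_apply_comm hs p v]
    · rw [fderiv_fun_sub (((hd _ p).fun_sub (hd _ p)).const_mul τ) (hd _ p),
        fderiv_const_mul ((hd _ p).fun_sub (hd _ p)), fderiv_fun_sub (hd _ p) (hd _ p)]
      simp [fderiv_fderiv_apply_comm hs p v]
    · exact (contDiff_const.mul (hsv _)).sub ((hsv _).add (hsv _))
    · exact (contDiff_const.mul ((hsv _).sub (hsv _))).sub (hsv _)

end LocalL2

/-! ### Decay of solutions of the matrix linear system. -/

section LinearSystem

variable {n : ℕ}

/-- The evaluation of a matrix entry, as a real-linear map. -/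
noncomputable def entryCLM (i j : Fin n) : Mat n →L[ℝ] ℂ :=
  LinearMap.toContinuousLinearMap
    { toFun := fun A => A i j, map_add' := fun _ _ => rfl, map_smul' := fun _ _ => rfl }

/-- The inclusion of a matrix entry, as a real-linear map. -/
noncomputable def singleCLM (i j : Fin n) : ℂ →L[ℝ] Mat n :=
  LinearMap.toContinuousLinearMap
    { toFun := fun z => Matrix.single i j z
      map_add' := fun _ _ => Matrix.single_add _ _ _ _
      map_smul' := fun c z => (Matrix.smul_single c i j z).symm }

theorem isAsympConst_of_entries {f : Spacetime → Mat n} {L : Mat n}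
    (h : ∀ i j, IsAsympConst (fun p => f p i j) (L i j)) : IsAsympConst f L := by
  have h1 : ∀ A : Mat n, A = ∑ i, ∑ j, singleCLM i j (A i j) := fun A =>
    Matrix.matrix_eq_sum_single A
  have h2 : IsAsympConst (fun p => ∑ i, ∑ j, singleCLM i j (f p i j))
      (∑ i, ∑ j, singleCLM i j (L i j)) :=
    IsAsympConst.sum _ fun i _ => IsAsympConst.sum _ fun j _ => (h i j).clm (singleCLM i j)
  rw [← h1] at h2
  exact h2.congr fun p => h1 (f p)

theorem fderiv_entry {f : Spacetime → Mat n} (hf : ContDiff ℝ ∞ f) (i j : Fin n)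
    (p v : Spacetime) : fderiv ℝ (fun p => f p i j) p v = fderiv ℝ f p v i j := by
  have h := ((entryCLM i j).hasFDerivAt (x := f p)).comp p
    ((hf.differentiable (by simp)) p).hasFDerivAt
  exact congrArg (fun A => A v) h.fderiv

/-- A solution of an elliptic inhomogeneous linear system with decaying coefficients, which tends
to zero at spatial infinity, decays with all its derivatives. -/
theorem isAsympConst_of_linear_system {τ : ℂ} (hτ : τ.im ≠ 0) {W a₁ a₂ e₁ e₂ : Spacetime → Mat n}
    (hs : ContDiff ℝ ∞ W)
    (hW : ∀ t : ℝ, Tendsto (fun q : ℝ × ℝ => W (q.1, q.2, t)) (cocompact (ℝ × ℝ)) (𝓝 0))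
    (ha₁ : IsAsympConst a₁ 0) (ha₂ : IsAsympConst a₂ 0) (he₁ : IsAsympConst e₁ 0)
    (he₂ : IsAsympConst e₂ 0) (h₁ : ∀ p, τ • dY W p - dXi W p = a₁ p * W p + e₁ p)
    (h₂ : ∀ p, τ • dEta W p - dY W p = a₂ p * W p + e₂ p) : IsAsympConst W 0 := by
  have hent : ∀ i j, ContDiff ℝ ∞ (fun p => W p i j) := fun i j =>
    (entryCLM i j).contDiff.comp hs
  have hE : ∀ {a : Spacetime → Mat n}, IsAsympConst a 0 → ∀ i j,
      IsAsympConst (fun p => a p i j) 0 := fun ha i j => by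
    have := ha.clm (entryCLM i j)
    rw [map_zero] at this
    exact this
  have hrhs : ∀ {m : ℕ} {a e : Spacetime → Mat n}, IsAsympConst a 0 → IsAsympConst e 0 →
      (∀ i j, VanishesSobolev m (fun p => W p i j)) → ∀ i j,
      VanishesSobolev m (fun p => ∑ l, a p i l * W p l j + e p i j) := by
    intro m a e ha he hm i j
    have h0 : VanishesSobolev m (fun _ => 0) := (isAsympConst_const (0 : ℂ)).vanishesSobolev m
    refine VanishesSobolev.add ?_ ((hE he i j).vanishesSobolev m) ?_ (hE he i j).smooth
    · exact VanishesSobolev.sum _ (fun l _ => (hm l j).mul (hE ha i l) (hent l j))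
        (fun l _ => (hE ha i l).smooth.mul (hent l j)) h0
    · exact ContDiff.sum fun l _ => (hE ha i l).smooth.mul (hent l j)
  -- Bootstrap: the right-hand side inherits the order m known for W, and ellipticity gains one
  -- more.
  have key : ∀ m, ∀ i j, VanishesSobolev m (fun p => W p i j) := by
    intro m
    induction m with
    | zero =>
      intro i j
      refine vanishesL2_of_tendsto fun t => ?_
      have := ((entryCLM i j).continuous.tendsto 0).comp (hW t)
      rw [map_zero] at this
      exact this
    | succ m ih =>
      intro i j
      refine VanishesSobolev.of_system hτ (hent i j) (ih i j).vanishesL2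
        ((hrhs ha₁ he₁ ih i j).congr fun p => ?_) ((hrhs ha₂ he₂ ih i j).congr fun p => ?_)
      · have := congrFun (congrFun (h₁ p) i) j
        simp only [fderiv_entry hs]
        rw [Matrix.add_apply, Matrix.mul_apply] at this
        rw [← this]
        rfl
      · have := congrFun (congrFun (h₂ p) i) j
        simp only [fderiv_entry hs]
        rw [Matrix.add_apply, Matrix.mul_apply] at this
        rw [← this]
        rfl
  apply isAsympConst_of_entries
  intro i j
  exact isAsympConst_of_vanishesSobolev (hent i j) fun m => key m i j

end LinearSystem

/-! ### Contour integrals of a family: smoothness, derivatives, limits. -/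

section ContourCoefficients

theorem circleIntegral_clm {F G : Type} [NormedAddCommGroup F] [NormedSpace ℂ F] [CompleteSpace F]
    [NormedAddCommGroup G] [NormedSpace ℂ G] [CompleteSpace G] (L : F →L[ℂ] G) {f : ℂ → F} {c : ℂ}
    {R : ℝ} (hf : CircleIntegrable f c R) : ∮ z in C(c, R), L (f z) = L (∮ z in C(c, R), f z) := by
  unfold circleIntegral
  rw [← L.intervalIntegral_comp_comm hf.out]
  simp only [map_smul]

variable {E F : Type} [NormedAddCommGroup E] [NormedSpace ℝ E] [FiniteDimensional ℝ E]
  [NormedAddCommGroup F] [NormedSpace ℂ F] [CompleteSpace F]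
  {Ω : Set ℂ} {ψ : E → ℂ → F}

theorem contDiff_slice_of_contDiffOn (hψ : ContDiffOn ℝ ∞ (fun q : E × ℂ => ψ q.1 q.2) (univ ×ˢ Ω))
    {z : ℂ} (hz : z ∈ Ω) : ContDiff ℝ ∞ (fun p => ψ p z) := by
  rw [← contDiffOn_univ]
  exact hψ.comp (f := fun p : E => (p, z)) (by fun_prop) fun p _ => ⟨mem_univ _, hz⟩

theorem contDiffOn_fderiv_slice (hΩ : IsOpen Ω)
    (hψ : ContDiffOn ℝ ∞ (fun q : E × ℂ => ψ q.1 q.2) (univ ×ˢ Ω)) (v : E) :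
    ContDiffOn ℝ ∞ (fun q : E × ℂ => fderiv ℝ (fun p => ψ p q.2) q.1 v) (univ ×ˢ Ω) := by
  have hopen : IsOpen ((univ : Set E) ×ˢ Ω) := isOpen_univ.prod hΩ
  have : ContDiffOn ℝ ∞ (fun q : E × ℂ => fderiv ℝ (fun q : E × ℂ => ψ q.1 q.2) q (v, 0))
      (univ ×ˢ Ω) := (hψ.fderiv_of_isOpen hopen (by simp)).clm_apply contDiffOn_const
  refine this.congr ?_
  rintro ⟨q, z⟩ hq
  have h1 : DifferentiableAt ℝ (fun q : E × ℂ => ψ q.1 q.2) (q, z) :=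
    (hψ.differentiableOn (by simp)).differentiableAt (hopen.mem_nhds hq)
  have h2 : HasFDerivAt (fun p : E => (p, z)) (.inl ℝ E ℂ) q := hasFDerivAt_prodMk_left q z
  exact congrArg (fun A => A v) (h1.hasFDerivAt.comp q h2).fderiv

theorem continuousOn_slice (hψ : ContDiffOn ℝ ∞ (fun q : E × ℂ => ψ q.1 q.2) (univ ×ˢ Ω))
    (p : E) : ContinuousOn (ψ p) Ω :=
  hψ.continuousOn.comp (f := fun z : ℂ => (p, z)) (by fun_prop) fun _ hz => ⟨mem_univ _, hz⟩

variable {β : ℂ} {r : ℝ} {w : ℂ → ℂ}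

theorem contDiffOn_weighted_circle (hr : 0 < r) (hS : Metric.sphere β r ⊆ Ω)
    (hψ : ContDiffOn ℝ ∞ (fun q : E × ℂ => ψ q.1 q.2) (univ ×ˢ Ω))
    (hw : ContDiff ℝ ∞ (fun θ => w (circleMap β r θ))) :
    ContDiffOn ℝ ∞ (fun q : E × ℝ => w (circleMap β r q.2) • ψ q.1 (circleMap β r q.2))
      (univ ×ˢ univ) := by
  have h1 := contDiff_circleMap (n := ∞) β r
  refine ContDiffOn.smul (hw.comp contDiff_snd).contDiffOn ?_
  exact hψ.comp (f := fun q : E × ℝ => (q.1, circleMap β r q.2)) (by fun_prop)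
    fun q _ => ⟨mem_univ _, hS (circleMap_mem_sphere _ hr.le _)⟩

theorem circleIntegrable_of_continuous_circleMap {f : ℂ → F}
    (hf : Continuous (fun θ => f (circleMap β r θ))) : CircleIntegrable f β r :=
  hf.intervalIntegrable _ _

theorem circleIntegrable_weighted (hr : 0 < r) {f : ℂ → F}
    (hf : ContinuousOn f (Metric.sphere β r)) (hw : ContDiff ℝ ∞ (fun θ => w (circleMap β r θ))) :
    CircleIntegrable (fun z => w z • f z) β r := by
  apply circleIntegrable_of_continuous_circleMap
  refine hw.continuous.smul ?_
  exact hf.comp_continuous (continuous_circleMap β r) fun θ => circleMap_mem_sphere _ hr.le _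

theorem contDiff_contour (hr : 0 < r) (hS : Metric.sphere β r ⊆ Ω)
    (hψ : ContDiffOn ℝ ∞ (fun q : E × ℂ => ψ q.1 q.2) (univ ×ˢ Ω))
    (hw : ContDiff ℝ ∞ (fun θ => w (circleMap β r θ))) :
    ContDiff ℝ ∞ (fun p => ∮ z in C(β, r), w z • ψ p z) := by
  rw [← contDiffOn_univ]
  exact contDiffOn_circleIntegral isOpen_univ (contDiffOn_weighted_circle hr hS hψ hw)

theorem fderiv_contour (hr : 0 < r) (hS : Metric.sphere β r ⊆ Ω)
    (hψ : ContDiffOn ℝ ∞ (fun q : E × ℂ => ψ q.1 q.2) (univ ×ˢ Ω))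
    (hw : ContDiff ℝ ∞ (fun θ => w (circleMap β r θ))) (p v : E) :
    fderiv ℝ (fun p => ∮ z in C(β, r), w z • ψ p z) p v =
      ∮ z in C(β, r), w z • fderiv ℝ (fun p => ψ p z) p v := by
  rw [fderiv_circleIntegral isOpen_univ (contDiffOn_weighted_circle hr hS hψ hw) (mem_univ p) v]
  refine circleIntegral.integral_congr hr.le fun z hz => ?_
  have := (contDiff_slice_of_contDiffOn hψ (hS hz)).differentiable (by simp) p
  simp only [fderiv_fun_const_smul this]
  rfl

theorem tendsto_contour {ι : Type*} {l : Filter ι} (hr : 0 < r) {f : ι → ℂ → F} {h : ℂ → F}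
    (hf : ∀ q, ContinuousOn (f q) (Metric.sphere β r)) (hh : ContinuousOn h (Metric.sphere β r))
    (hlim : TendstoUniformlyOn f h l (Metric.sphere β r))
    (hw : ContDiff ℝ ∞ (fun θ => w (circleMap β r θ))) :
    Tendsto (fun q => ∮ z in C(β, r), w z • f q z) l (𝓝 (∮ z in C(β, r), w z • h z)) := by
  obtain ⟨C, hC⟩ := (isCompact_Icc (a := (0 : ℝ)) (b := 2 * Real.pi)).exists_bound_of_continuousOn
    hw.continuous.continuousOn
  have hCs : ∀ z ∈ Metric.sphere β r, ‖w z‖ ≤ C := by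
    intro z hz
    rw [← abs_of_pos hr, ← image_circleMap_Ioc] at hz
    obtain ⟨θ, hθ, rfl⟩ := hz
    exact hC θ (Ioc_subset_Icc_self hθ)
  have hC0 : 0 ≤ C := (norm_nonneg _).trans (hC 0 (by simp [Real.pi_pos.le]))
  rw [Metric.tendsto_nhds]
  intro ε hε
  have hden : 0 < 2 * Real.pi * r * (C + 1) := by positivity
  filter_upwards [Metric.tendstoUniformlyOn_iff.mp hlim (ε / (2 * (2 * Real.pi * r * (C + 1))))
    (by positivity)] with q hq
  rw [dist_eq_norm, ← circleIntegral.integral_sub (circleIntegrable_weighted hr (hf q) hw)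
    (circleIntegrable_weighted hr hh hw)]
  have := circleIntegral.norm_integral_le_of_norm_le_const hr.le (c := β)
    (C := C * (ε / (2 * (2 * Real.pi * r * (C + 1)))))
    (f := fun z => w z • f q z - w z • h z) (by
      intro z hz
      rw [← smul_sub, norm_smul]
      have h2 := hq z hz
      rw [dist_comm, dist_eq_norm] at h2
      exact mul_le_mul (hCs z hz) h2.le (norm_nonneg _) hC0)
  refine this.trans_lt ?_
  have e : 2 * Real.pi * r * (C * (ε / (2 * (2 * Real.pi * r * (C + 1))))) =
      ε * (C / (C + 1)) / 2 := by
    have := Real.pi_pos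
    field_simp
  rw [e]
  have : C / (C + 1) ≤ 1 := by rw [div_le_one (by positivity)]; linarith
  nlinarith

end ContourCoefficients

/-! ### Asymptotics of the contour coefficients of a frame. -/

section FrameContours

variable {n : ℕ} {Ω : Set ℂ} {ψ : Spacetime → ℂ → Mat n}

theorem dXi_eq_fderiv (f : Spacetime → Mat n) (p : Spacetime) :
    dXi f p = fderiv ℝ f p (1, 0, 1) := by
  have : ((1, 0, 1) : Spacetime) = (0, 0, 1) + (1, 0, 0) := by simp
  rw [this, map_add]
  rfl

theorem dEta_eq_fderiv (f : Spacetime → Mat n) (p : Spacetime) :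
    dEta f p = fderiv ℝ f p (-1, 0, 1) := by
  have : ((-1, 0, 1) : Spacetime) = (0, 0, 1) - (1, 0, 0) := by simp
  rw [this, map_sub]
  rfl

theorem dY_eq_fderiv (f : Spacetime → Mat n) (p : Spacetime) :
    dY f p = fderiv ℝ f p (0, 1, 0) := rfl

/-- The linear system with coefficients `z b + c` in the directions `u`, `v` becomes, for the
contour coefficients of `ψ`, an inhomogeneous linear system at the centre of the contour. -/
theorem fderiv_contour_eq {β : ℂ} {r : ℝ} {w : ℂ → ℂ} (hr : 0 < r)
    (hΩ : IsOpen Ω) (hS : Metric.sphere β r ⊆ Ω)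
    (hψ : ContDiffOn ℝ ∞ (fun q : Spacetime × ℂ => ψ q.1 q.2) (univ ×ˢ Ω))
    (hw : ContDiff ℝ ∞ (fun θ => w (circleMap β r θ))) {u v p : Spacetime} {b c : Mat n}
    (hsys : ∀ z ∈ Ω, z • fderiv ℝ (fun q => ψ q z) p u - fderiv ℝ (fun q => ψ q z) p v =
      (z • b + c) * ψ p z) :
    β • fderiv ℝ (fun p => ∮ z in C(β, r), w z • ψ p z) p u -
        fderiv ℝ (fun p => ∮ z in C(β, r), w z • ψ p z) p v =
      (β • b + c) * (∮ z in C(β, r), w z • ψ p z) +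
        (b * (∮ z in C(β, r), ((z - β) * w z) • ψ p z) -
          fderiv ℝ (fun p => ∮ z in C(β, r), ((z - β) * w z) • ψ p z) p u) := by
  have hw' : ContDiff ℝ ∞ (fun θ => (fun z => (z - β) * w z) (circleMap β r θ)) :=
    (((contDiff_circleMap β r).sub contDiff_const).mul hw)
  have hcu := continuousOn_slice (ψ := fun p z => fderiv ℝ (fun p => ψ p z) p u)
    (contDiffOn_fderiv_slice hΩ hψ u) p
  have hcv := continuousOn_slice (ψ := fun p z => fderiv ℝ (fun p => ψ p z) p v)
    (contDiffOn_fderiv_slice hΩ hψ v) p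
  have hc := continuousOn_slice hψ p
  have hI := circleIntegrable_weighted hr (hc.mono hS) hw
  have hI' := circleIntegrable_weighted (w := fun z => (z - β) * w z) hr (hc.mono hS) hw'
  have hIu' := circleIntegrable_weighted (w := fun z => (z - β) * w z) hr (hcu.mono hS) hw'
  have hIv := circleIntegrable_weighted hr (hcv.mono hS) hw
  have hmul : ∀ (a : Mat n) {f : ℂ → Mat n}, CircleIntegrable f β r →
      a * ∮ z in C(β, r), f z = ∮ z in C(β, r), a * f z := fun a f hf =>
    (circleIntegral_clm (ContinuousLinearMap.mul ℂ (Mat n) a) hf).symm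
  have hmulI : ∀ (a : Mat n) {f : ℂ → Mat n}, CircleIntegrable f β r →
      CircleIntegrable (fun z => a * f z) β r := fun a f hf => hf.const_mul a
  have hIβ : CircleIntegrable (fun z => β • w z • fderiv ℝ (fun p => ψ p z) p u) β r := by
    have := circleIntegrable_weighted (w := fun z => β * w z) hr (hcu.mono hS)
      (contDiff_const.mul hw)
    simpa only [mul_smul] using this
  have hsub : CircleIntegrable (fun z => b * ((z - β) * w z) • ψ p z -
      ((z - β) * w z) • fderiv ℝ (fun p => ψ p z) p u) β r := (hmulI _ hI').sub hIu'
  rw [fderiv_contour hr hS hψ hw, fderiv_contour hr hS hψ hw, fderiv_contour (w := fun z => (z - β) * w z) hr hS hψ hw',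
    hmul _ hI, hmul _ hI', ← circleIntegral.integral_smul,
    ← circleIntegral.integral_sub hIβ hIv,
    ← circleIntegral.integral_sub (hmulI _ hI') hIu',
    ← circleIntegral.integral_add (hmulI _ hI) hsub]
  refine circleIntegral.integral_congr hr.le fun z hz => ?_
  -- Pointwise identity: write z = β + (z - β) in the system and move the (z - β) terms to the
  -- right.
  have h := hsys z (hS hz)
  have h2 : fderiv ℝ (fun q => ψ q z) p v = z • fderiv ℝ (fun q => ψ q z) p u -
      (z • b + c) * ψ p z := by rw [← h]; abel
  rw [h2]
  simp only [add_mul, smul_mul_assoc, mul_smul_comm]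
  module

/-- The linear system of a frame, with coefficients decaying at spatial infinity. -/
structure HasDecayingSystem (Ω : Set ℂ) (ψ : Spacetime → ℂ → Mat n)
    (b₁ c₁ b₂ c₂ : Spacetime → Mat n) : Prop where
  decay : (IsAsympConst b₁ 0 ∧ IsAsympConst c₁ 0) ∧ IsAsympConst b₂ 0 ∧ IsAsympConst c₂ 0
  eq_one : ∀ p, ∀ τ ∈ Ω, τ • dY (fun q => ψ q τ) p - dXi (fun q => ψ q τ) p =
    (τ • b₁ p + c₁ p) * ψ p τ
  eq_two : ∀ p, ∀ τ ∈ Ω, τ • dEta (fun q => ψ q τ) p - dY (fun q => ψ q τ) p =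
    (τ • b₂ p + c₂ p) * ψ p τ

theorem IsAsympConst.mul_const {f : Spacetime → Mat n} (hf : IsAsympConst f 0) (L : Mat n) :
    IsAsympConst (fun p => f p * L) 0 := by
  simpa using hf.mul (isAsympConst_const L)

theorem IsAsympConst.const_smul_zero {f : Spacetime → Mat n} (hf : IsAsympConst f 0) (c : ℂ) :
    IsAsympConst (fun p => c • f p) 0 := by
  have := (isAsympConst_const (c • (1 : Mat n))).mul hf
  rw [mul_zero] at this
  exact this.congr fun p => by simp

/-- The integral with weight w solves the linear system at the nonreal centre β, with an
inhomogeneity formed from the integral with weight (z - β) w. When the latter is asymptotically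
constant the inhomogeneity decays, because it enters only differentiated or multiplied by a decaying
coefficient. Subtracting the limit gives a solution tending to zero, to which elliptic decay
applies. -/
theorem isAsympConst_contour {b₁ c₁ b₂ c₂ : Spacetime → Mat n} {h : ℂ → Mat n}
    {β : ℂ} {r : ℝ} {w : ℂ → ℂ} (hβ : β.im ≠ 0) (hr : 0 < r)
    (hΩ : IsOpen Ω) (hS : Metric.sphere β r ⊆ Ω)
    (hψ : ContDiffOn ℝ ∞ (fun q : Spacetime × ℂ => ψ q.1 q.2) (univ ×ˢ Ω))
    (hw : ContDiff ℝ ∞ (fun θ => w (circleMap β r θ)))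
    (hsys : HasDecayingSystem Ω ψ b₁ c₁ b₂ c₂) (hh : ContinuousOn h (Metric.sphere β r))
    (hlim : ∀ t : ℝ, TendstoUniformlyOn (fun (q : ℝ × ℝ) τ => ψ (q.1, q.2, t) τ) h
      (cocompact (ℝ × ℝ)) (Metric.sphere β r)) {L : Mat n}
    (hnext : IsAsympConst (fun p => ∮ z in C(β, r), ((z - β) * w z) • ψ p z) L) :
    IsAsympConst (fun p => ∮ z in C(β, r), w z • ψ p z) (∮ z in C(β, r), w z • h z) := by
  set K := fun p => ∮ z in C(β, r), w z • ψ p z with hK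
  set K₀ := ∮ z in C(β, r), w z • h z with hK₀
  set K' := fun p => ∮ z in C(β, r), ((z - β) * w z) • ψ p z with hK'
  have hKs : ContDiff ℝ ∞ K := contDiff_contour hr hS hψ hw
  have hfd : ∀ p v, fderiv ℝ (fun p => K p - K₀) p v = fderiv ℝ K p v := by
    intro p v
    rw [fderiv_sub_const]
  obtain ⟨⟨hb₁, hc₁⟩, hb₂, hc₂⟩ := hsys.decay
  have hcoef : ∀ {b c : Spacetime → Mat n}, IsAsympConst b 0 → IsAsympConst c 0 →
      IsAsympConst (fun p => β • b p + c p) 0 := fun hb hc => by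
    simpa using (hb.const_smul_zero β).add hc
  have hinh : ∀ {b c : Spacetime → Mat n}, IsAsympConst b 0 → IsAsympConst c 0 → ∀ u,
      IsAsympConst (fun p => (β • b p + c p) * K₀ + (b p * K' p - fderiv ℝ K' p u)) 0 := by
    intro b c hb hc u
    simpa using ((hcoef hb hc).mul_const K₀).add ((hb.mul hnext).sub (hnext.fderiv_apply u))
  refine IsAsympConst.of_sub (isAsympConst_of_linear_system hβ (hKs.sub contDiff_const) (fun t => ?_)
    (hcoef hb₁ hc₁) (hcoef hb₂ hc₂) (hinh hb₁ hc₁ (0, 1, 0)) (hinh hb₂ hc₂ (-1, 0, 1)) (fun p => ?_)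
    fun p => ?_)
  · have := tendsto_contour hr (fun q => (continuousOn_slice hψ _).mono hS) hh (hlim t) hw
    have := this.sub_const K₀
    rw [sub_self] at this
    exact this
  · have := fderiv_contour_eq hr hΩ hS hψ hw (fun z hz => by
      have := hsys.eq_one p z hz
      rwa [dXi_eq_fderiv, dY_eq_fderiv] at this)
    rw [dXi_eq_fderiv, dY_eq_fderiv, hfd, hfd, this, mul_sub]
    abel
  · have := fderiv_contour_eq hr hΩ hS hψ hw (fun z hz => by
      have := hsys.eq_two p z hz
      rwa [dEta_eq_fderiv, dY_eq_fderiv] at this)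
    rw [dEta_eq_fderiv, dY_eq_fderiv, hfd, hfd, this, mul_sub]
    abel

/-- If some contour coefficient `∮ (z - β) ^ M u ψ` is asymptotically constant, then so are the
coefficients `∮ (z - β) ^ j u ψ` for `j ≤ M`. -/
theorem isAsympConst_contour_of_le {b₁ c₁ b₂ c₂ : Spacetime → Mat n} {h : ℂ → Mat n}
    {β : ℂ} {r : ℝ} {u : ℂ → ℂ} (hβ : β.im ≠ 0) (hr : 0 < r)
    (hΩ : IsOpen Ω) (hS : Metric.sphere β r ⊆ Ω)
    (hψ : ContDiffOn ℝ ∞ (fun q : Spacetime × ℂ => ψ q.1 q.2) (univ ×ˢ Ω))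
    (hu : ContDiff ℝ ∞ (fun θ => u (circleMap β r θ)))
    (hsys : HasDecayingSystem Ω ψ b₁ c₁ b₂ c₂) (hh : ContinuousOn h (Metric.sphere β r))
    (hlim : ∀ t : ℝ, TendstoUniformlyOn (fun (q : ℝ × ℝ) τ => ψ (q.1, q.2, t) τ) h
      (cocompact (ℝ × ℝ)) (Metric.sphere β r)) {M : ℕ} {L : Mat n}
    (hM : IsAsympConst (fun p => ∮ z in C(β, r), ((z - β) ^ M * u z) • ψ p z) L) {j : ℕ}
    (hj : j < M) : IsAsympConst (fun p => ∮ z in C(β, r), ((z - β) ^ j * u z) • ψ p z)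
      (∮ z in C(β, r), ((z - β) ^ j * u z) • h z) := by
  have hw : ∀ j : ℕ, ContDiff ℝ ∞
      (fun θ => (fun z => (z - β) ^ j * u z) (circleMap β r θ)) := fun j =>
    ((contDiff_circleMap β r).sub contDiff_const).pow j |>.mul hu
  have hstep : ∀ {j L}, IsAsympConst (fun p => ∮ z in C(β, r), ((z - β) ^ (j + 1) * u z) • ψ p z) L →
      IsAsympConst (fun p => ∮ z in C(β, r), ((z - β) ^ j * u z) • ψ p z)
        (∮ z in C(β, r), ((z - β) ^ j * u z) • h z) := by
    intro j L hL
    refine isAsympConst_contour hβ hr hΩ hS hψ (hw j) hsys hh hlim (L := L) ?_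
    simpa only [pow_succ', mul_assoc] using hL
  obtain ⟨m, rfl⟩ := Nat.exists_eq_add_of_lt hj
  clear hj
  induction m generalizing j with
  | zero => exact hstep hM
  | succ m ih =>
    refine hstep (ih (j := j + 1) ?_)
    rwa [show j + 1 + m + 1 = j + (m + 1) + 1 by ring]

end FrameContours

/-! ### Smooth and asymptotically constant factorization of a family. -/

section FamilyFactorization

variable {n k : ℕ}

/-- The points `α` and `conj α`, indexed by `Bool`. -/
noncomputable def conjPair (α : ℂ) (s : Bool) : ℂ := cond s α (conj α)

/-- The left multiplications by a family of coefficients, as a linear system in `d`. -/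
noncomputable def coeffSystem (k n : ℕ) : (Bool → Fin k → Fin k → Mat n) →L[ℝ]
    ((Fin k → Mat n) →L[ℝ] (Bool → Fin k → Mat n)) :=
  ((LinearMap.toContinuousLinearMap :
      ((Fin k → Mat n) →ₗ[ℝ] (Bool → Fin k → Mat n)) ≃ₗ[ℝ] _).toLinearMap ∘ₗ
    LinearMap.mk₂ ℝ (fun κ d s j => ∑ i, κ s j i * d i)
      (fun κ κ' d => by ext1 s; ext1 j; simp [add_mul, Finset.sum_add_distrib])
      (fun c κ d => by ext1 s; ext1 j; simp [Finset.smul_sum])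
      (fun κ d d' => by ext1 s; ext1 j; simp [mul_add, Finset.sum_add_distrib])
      (fun c κ d => by ext1 s; ext1 j; simp [Finset.smul_sum])).toContinuousLinearMap

theorem coeffSystem_apply (κ : Bool → Fin k → Fin k → Mat n) (d : Fin k → Mat n) (s : Bool)
    (j : Fin k) : coeffSystem k n κ d s j = ∑ i, κ s j i * d i := rfl

theorem contDiff_pow_mul_inv_circleMap {β c : ℂ} {r : ℝ}
    (hc : ∀ θ, circleMap β r θ - c ≠ 0) (j i : ℕ) :
    ContDiff ℝ ∞ (fun θ => (fun z => (z - β) ^ j * ((z - c) ^ i)⁻¹) (circleMap β r θ)) := by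
  have h1 := contDiff_circleMap (n := ∞) β r
  refine ((h1.sub contDiff_const).pow j).mul ?_
  exact ((h1.sub contDiff_const).pow i).inv fun θ => pow_ne_zero _ (hc θ)

theorem circleIntegral_mul_polarSum {β c : ℂ} {r : ℝ} (hr : 0 < r)
    (hc : ∀ θ, circleMap β r θ - c ≠ 0) {f : ℂ → Mat n}
    (hf : ContinuousOn f (Metric.sphere β r)) (d : Fin k → Mat n) (j : ℕ) :
    ∮ z in C(β, r), (z - β) ^ j • (f z * polarSum c d z) =
      ∑ i : Fin k, (∮ z in C(β, r), ((z - β) ^ j * ((z - c) ^ (i.val + 1))⁻¹) • f z) * d i := by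
  have hI : ∀ i : Fin k, CircleIntegrable
      (fun z => ((z - β) ^ j * ((z - c) ^ (i.val + 1))⁻¹) • f z) β r := fun i =>
    circleIntegrable_weighted (w := fun z => (z - β) ^ j * ((z - c) ^ (i.val + 1))⁻¹) hr hf
      (contDiff_pow_mul_inv_circleMap hc _ _)
  have hR : ∀ i : Fin k, (∮ z in C(β, r), ((z - β) ^ j * ((z - c) ^ (i.val + 1))⁻¹) • f z) * d i =
      ∮ z in C(β, r), (((z - β) ^ j * ((z - c) ^ (i.val + 1))⁻¹) • f z) * d i := fun i =>
    (circleIntegral_clm ((ContinuousLinearMap.mul ℂ (Mat n)).flip (d i)) (hI i)).symm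
  rw [Finset.sum_congr rfl fun i _ => hR i, ← circleIntegral.integral_fun_sum]
  · congr 1
    funext z
    simp only [polarSum, Finset.mul_sum, Finset.smul_sum, mul_smul_comm, smul_mul_assoc, mul_smul]
  · intro i _
    exact (hI i).mul_const (d i)

/-- A family of functions with a pole at `α`, with the reality condition, whose contour
coefficients are asymptotically constant. -/
structure IsContourFamily (α : ℂ) (k : ℕ) (r : ℝ) (ψ : Spacetime → ℂ → Mat n) (h : ℂ → Mat n) :
    Prop where
  pos : 0 < r
  sep : ∀ s, ∀ z ∈ Metric.closedBall (conjPair α s) r, z ≠ conjPair α s → z ≠ conj α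
  diff : ∀ p s, ∀ z ∈ Metric.closedBall (conjPair α s) r, z ≠ conjPair α s →
    DifferentiableAt ℂ (ψ p) z
  diff_lim : ∀ s, ∀ z ∈ Metric.closedBall (conjPair α s) r, z ≠ conjPair α s →
    DifferentiableAt ℂ h z
  pole : ∀ p, RealPoleAt α k (ψ p)
  pole_lim : RealPoleAt α k h
  coeff : ∀ (s : Bool) (j i : ℕ), j < k → IsAsympConst
    (fun p => ∮ z in C(conjPair α s, r),
      ((z - conjPair α s) ^ j * ((z - conj α) ^ i)⁻¹) • ψ p z)
    (∮ z in C(conjPair α s, r), ((z - conjPair α s) ^ j * ((z - conj α) ^ i)⁻¹) • h z)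

section PointwiseSystem

variable {α : ℂ} {r : ℝ}

/-- At α only `f` has a pole and at ᾱ only the polar part does, so order k suffices at both points
and k integrals at each decide regularity. -/
theorem hasLimitAt_pow_smul_mul_polarSum (hα : α.im ≠ 0) {f : ℂ → Mat n}
    (h : RealPoleAt α k f) (d : Fin k → Mat n) (s : Bool) :
    HasLimitAt (conjPair α s)
      (fun z => (z - conjPair α s) ^ k • (f z * polarSum (conj α) d z)) := by
  cases s with
  | true =>
    have h1 := h.pole.mul (differentiableAt_polarSum d (ne_conj_of_im_ne_zero hα)).continuousAt.hasLimitAt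
    exact h1.congr' (Eventually.of_forall fun z => smul_mul_assoc _ _ _)
  | false =>
    have h2 : HasLimitAt (conj α) (fun z => (z - conj α) ^ k • polarSum (conj α) d z) := by
      have h3 : ContinuousAt
          (fun z => ∑ i : Fin k, (z - conj α) ^ (k - (i.val + 1)) • d i) (conj α) := by
        fun_prop
      refine h3.hasLimitAt.congr' ?_
      filter_upwards [self_mem_nhdsWithin] with z hz
      rw [polarSum, Finset.smul_sum]
      refine Finset.sum_congr rfl fun i _ => ?_
      rw [smul_smul, pow_sub₀ _ (sub_ne_zero.mpr hz) (by omega)]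
    exact (h.no_pole.mul h2).congr' (Eventually.of_forall fun z => mul_smul_comm _ _ _)

/-- The contour coefficients of `f` times the polar parts. -/
noncomputable def contourCoeff (α : ℂ) (k : ℕ) (r : ℝ) (f : ℂ → Mat n) :
    Bool → Fin k → Fin k → Mat n := fun s j i =>
  ∮ z in C(conjPair α s, r),
    ((z - conjPair α s) ^ j.val * ((z - conj α) ^ (i.val + 1))⁻¹) • f z

theorem coeffSystem_contourCoeff (hr : 0 < r)
    (hsep : ∀ s, ∀ z ∈ Metric.closedBall (conjPair α s) r, z ≠ conjPair α s → z ≠ conj α)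
    {f : ℂ → Mat n} (hd : ∀ s, ∀ z ∈ Metric.closedBall (conjPair α s) r, z ≠ conjPair α s →
      DifferentiableAt ℂ f z) (d : Fin k → Mat n) (s : Bool) (j : Fin k) :
    coeffSystem k n (contourCoeff α k r f) d s j =
      ∮ z in C(conjPair α s, r), (z - conjPair α s) ^ j.val • (f z * polarSum (conj α) d z) := by
  rw [coeffSystem_apply, circleIntegral_mul_polarSum hr]
  · rfl
  · intro θ
    exact sub_ne_zero.mpr (hsep s _ (circleMap_mem_closedBall _ hr.le θ)
      (circleMap_ne_center hr.ne'))
  · intro z hz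
    exact (hd s z (Metric.sphere_subset_closedBall hz) (by
      rintro rfl
      simp [hr.ne] at hz)).continuousAt.continuousWithinAt

/-- A vector in the kernel makes all these contour integrals vanish, so f P is regular at α and ᾱ,
and P = 0 by the Liouville argument. -/
theorem coeffSystem_injective (hα : α.im ≠ 0) (hr : 0 < r)
    (hsep : ∀ s, ∀ z ∈ Metric.closedBall (conjPair α s) r, z ≠ conjPair α s → z ≠ conj α)
    {f : ℂ → Mat n} (hd : ∀ s, ∀ z ∈ Metric.closedBall (conjPair α s) r, z ≠ conjPair α s →
      DifferentiableAt ℂ f z) (h : RealPoleAt α k f) :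
    Function.Injective (coeffSystem k n (contourCoeff α k r f)) := by
  rw [injective_iff_map_eq_zero]
  intro d hd0
  have hlim : ∀ s, HasLimitAt (conjPair α s) (fun z => f z * polarSum (conj α) d z) := by
    intro s
    refine hasLimitAt_of_circleIntegrals_eq_zero (k := k) hr
      (fun z hz hne => (hd s z hz hne).mul (differentiableAt_polarSum d (hsep s z hz hne)))
      (hasLimitAt_pow_smul_mul_polarSum hα h d s) fun j hj => ?_
    rw [← coeffSystem_contourCoeff hr hsep hd d s ⟨j, hj⟩, hd0]
    rfl
  exact h.eq_zero_of_hasLimitAt hα (hlim true) (hlim false)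

/-- Cauchy's theorem for the regular function f (1 + P), with the term without P moved to the right.
The factor with exponent 0 keeps the right-hand side in the form of the coefficients of a contour
family, with i = 0. -/
theorem coeffSystem_eq (hr : 0 < r)
    (hsep : ∀ s, ∀ z ∈ Metric.closedBall (conjPair α s) r, z ≠ conjPair α s → z ≠ conj α)
    {f : ℂ → Mat n} (hd : ∀ s, ∀ z ∈ Metric.closedBall (conjPair α s) r, z ≠ conjPair α s →
      DifferentiableAt ℂ f z) {d : Fin k → Mat n}
    (hlim : ∀ s, HasLimitAt (conjPair α s) (fun z => f z * (1 + polarSum (conj α) d z))) :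
    coeffSystem k n (contourCoeff α k r f) d = fun s j =>
      -∮ z in C(conjPair α s, r), ((z - conjPair α s) ^ j.val * ((z - conj α) ^ 0)⁻¹) • f z := by
  ext1 s
  ext1 j
  have hcS : ContinuousOn f (Metric.sphere (conjPair α s) r) := by
    intro z hz
    exact (hd s z (Metric.sphere_subset_closedBall hz) (by
      rintro rfl
      simp [hr.ne] at hz)).continuousAt.continuousWithinAt
  have hcP : ContinuousOn (polarSum (conj α) d) (Metric.sphere (conjPair α s) r) := by
    intro z hz
    exact (differentiableAt_polarSum d (hsep s z (Metric.sphere_subset_closedBall hz) (by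
      rintro rfl
      simp [hr.ne] at hz))).continuousAt.continuousWithinAt
  have hpow : ContDiff ℝ ∞ (fun θ =>
      (fun z => (z - conjPair α s) ^ j.val) (circleMap (conjPair α s) r θ)) :=
    ((contDiff_circleMap _ r).sub contDiff_const).pow _
  have hzero := circleIntegral_pow_smul_eq_zero hr (fun z hz hne => (hd s z hz hne).mul
      ((differentiableAt_polarSum d (hsep s z hz hne)).const_add 1)) (hlim s)
      (w := fun z => (z - conjPair α s) ^ j.val) (fun z _ => by fun_prop)
  rw [coeffSystem_contourCoeff hr hsep hd d s j, eq_neg_iff_add_eq_zero, ← hzero,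
    ← circleIntegral.integral_add]
  · congr 1
    funext z
    simp [mul_add, add_comm]
  · exact circleIntegrable_weighted (w := fun z => (z - conjPair α s) ^ j.val) hr
      (hcS.mul hcP) hpow
  · simpa using circleIntegrable_weighted (w := fun z => (z - conjPair α s) ^ j.val) hr hcS hpow

end PointwiseSystem

/-- The factors are chosen independently at each point; smoothness and the limit come afterwards,
because d solves an injective linear system whose data are asymptotically constant. The limiting
system is injective since h satisfies the same hypotheses as each ψ p. -/
theorem IsContourFamily.exists_factor {α : ℂ} (hα : α.im ≠ 0) {r : ℝ}
    {ψ : Spacetime → ℂ → Mat n} {h : ℂ → Mat n} (H : IsContourFamily α k r ψ h) :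
    ∃ (d : Spacetime → Fin k → Mat n) (d₀ : Fin k → Mat n), IsAsympConst d d₀ ∧ ∀ p,
      HasLimitAt α (fun z => ψ p z * (1 + polarSum (conj α) (d p) z)) ∧
      HasLimitAt (conj α) (fun z => ψ p z * (1 + polarSum (conj α) (d p) z)) ∧
      ∀ z, z ≠ α → z ≠ conj α → star (1 + polarSum (conj α) (d p) (conj z)) *
        (1 + polarSum (conj α) (d p) z) = 1 := by
  choose d h1 h2 h3 using fun p => (H.pole p).exists_factor hα
  have hT : IsAsympConst (fun p => coeffSystem k n (contourCoeff α k r (ψ p)))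
      (coeffSystem k n (contourCoeff α k r h)) := by
    refine IsAsympConst.clm (isAsympConst_pi fun s => isAsympConst_pi fun j =>
      isAsympConst_pi fun i => ?_) _
    exact H.coeff s j.val (i.val + 1) j.isLt
  have hb := isAsympConst_pi fun s => isAsympConst_pi fun j : Fin k =>
    (H.coeff s j.val 0 j.isLt).comp (Φ := fun A => -A) contDiff_neg
  obtain ⟨d₀, hd₀⟩ := isAsympConst_of_injective_system hT hb
    (fun p => coeffSystem_injective hα H.pos H.sep (H.diff p) (H.pole p))
    (coeffSystem_injective hα H.pos H.sep H.diff_lim H.pole_lim)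
    (d := d) (fun p => coeffSystem_eq H.pos H.sep (H.diff p) (fun s => by
      cases s
      · exact h2 p
      · exact h1 p))
  exact ⟨d, d₀, hd₀, fun p => ⟨h1 p, h2 p, h3 p⟩⟩

section Transpose

/-- Transposition as a continuous linear map. -/
noncomputable def transposeCLM (n : ℕ) : Mat n →L[ℂ] Mat n :=
  (Matrix.transposeLinearEquiv (Fin n) (Fin n) ℂ ℂ).toLinearMap.toContinuousLinearMap

theorem transposeCLM_apply (A : Mat n) : transposeCLM n A = Aᵀ := rfl

theorem HasLimitAt.transpose {β : ℂ} {f : ℂ → Mat n} (hf : HasLimitAt β f) :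
    HasLimitAt β (fun z => (f z)ᵀ) := by
  obtain ⟨L, hL⟩ := hf
  exact ⟨_, ((transposeCLM n).continuous.tendsto L).comp hL⟩

theorem DifferentiableAt.matrix_transpose {z : ℂ} {f : ℂ → Mat n} (hf : DifferentiableAt ℂ f z) :
    DifferentiableAt ℂ (fun z => (f z)ᵀ) z :=
  (transposeCLM n).differentiableAt.comp z hf

theorem star_transpose_mul_transpose (A B : Mat n) : star Aᵀ * Bᵀ = (B * star A)ᵀ := by
  rw [Matrix.transpose_mul]
  rfl

theorem RealPoleAt.transpose {α : ℂ} {f : ℂ → Mat n} (h : RealPoleAt α k f) :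
    RealPoleAt α k (fun z => (f z)ᵀ) where
  diff := h.diff.mono fun _ hz => hz.matrix_transpose
  diff_conj := h.diff_conj.mono fun _ hz => hz.matrix_transpose
  pole := h.pole.transpose.congr' (Eventually.of_forall fun _ => Matrix.transpose_smul _ _)
  no_pole := h.no_pole.transpose
  real := h.real.mono fun z hz => by
    rw [star_transpose_mul_transpose, mul_eq_one_comm.mp hz, Matrix.transpose_one]

theorem circleIntegral_transpose {β : ℂ} {r : ℝ} {w : ℂ → ℂ} {f : ℂ → Mat n}
    (hI : CircleIntegrable (fun z => w z • f z) β r) :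
    ∮ z in C(β, r), w z • (f z)ᵀ = (∮ z in C(β, r), w z • f z)ᵀ := by
  rw [← transposeCLM_apply, ← circleIntegral_clm (transposeCLM n) hI]
  rfl

/-- Transposition exchanges left and right factors, so the right factorization of the transposed
family gives the left factorization of the original one. -/
theorem IsContourFamily.transpose {α : ℂ} {r : ℝ} {ψ : Spacetime → ℂ → Mat n} {h : ℂ → Mat n}
    (H : IsContourFamily α k r ψ h) :
    IsContourFamily α k r (fun p z => (ψ p z)ᵀ) (fun z => (h z)ᵀ) where
  pos := H.pos
  sep := H.sep
  diff p s z hz hne := (H.diff p s z hz hne).matrix_transpose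
  diff_lim s z hz hne := (H.diff_lim s z hz hne).matrix_transpose
  pole p := (H.pole p).transpose
  pole_lim := H.pole_lim.transpose
  coeff s j i hj := by
    have hI : ∀ {f : ℂ → Mat n}, (∀ z ∈ Metric.closedBall (conjPair α s) r, z ≠ conjPair α s →
        DifferentiableAt ℂ f z) → CircleIntegrable
        (fun z => ((z - conjPair α s) ^ j * ((z - conj α) ^ i)⁻¹) • f z) (conjPair α s) r := by
      intro f hf
      refine circleIntegrable_weighted
        (w := fun z => (z - conjPair α s) ^ j * ((z - conj α) ^ i)⁻¹) H.pos ?_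
        (contDiff_pow_mul_inv_circleMap ?_ j i)
      · intro z hz
        exact (hf z (Metric.sphere_subset_closedBall hz) (by
          rintro rfl
          simp [H.pos.ne] at hz)).continuousAt.continuousWithinAt
      · intro θ
        exact sub_ne_zero.mpr (H.sep s _ (circleMap_mem_closedBall _ H.pos.le θ)
          (circleMap_ne_center H.pos.ne'))
    have := (H.coeff s j i hj).clm ((transposeCLM n).restrictScalars ℝ)
    have e := circleIntegral_transpose (hI (H.diff_lim s))
    rw [e]
    exact this.congr fun p => circleIntegral_transpose (hI (H.diff p s))

end Transpose

end FamilyFactorization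

/-! ### Normalized frames as contour families. -/

section FrameContourFamily

variable {n k : ℕ}

theorem GaugePair.IsMonopole.hasDecayingSystem {Ω : Set ℂ} {ψ : Spacetime → ℂ → Mat n}
    {M : GaugePair n} (hM : M.IsMonopole)
    (hsys : ∀ p, ∀ τ ∈ Ω, τ • dY (fun q => ψ q τ) p - dXi (fun q => ψ q τ) p
        = (τ • M.Ay p + τ • M.phi p - M.Axi p) * ψ p τ ∧
      τ • dEta (fun q => ψ q τ) p - dY (fun q => ψ q τ) p
        = (τ • M.Aeta p + M.phi p - M.Ay p) * ψ p τ) :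
    HasDecayingSystem Ω ψ (fun p => M.Ay p + M.phi p) (fun p => -M.Axi p) M.Aeta
      (fun p => M.phi p - M.Ay p) := by
  obtain ⟨h1, h2, h3, h4⟩ := hM.smooth
  obtain ⟨d1, d2, d3, d4⟩ := hM.decay
  have Ax := (isAsympConst_zero_iff_decaysSpatially h1).mpr d1
  have Ay := (isAsympConst_zero_iff_decaysSpatially h2).mpr d2
  have At := (isAsympConst_zero_iff_decaysSpatially h3).mpr d3
  have Ph := (isAsympConst_zero_iff_decaysSpatially h4).mpr d4
  have hadd : ∀ {f g : Spacetime → Mat n}, IsAsympConst f 0 → IsAsympConst g 0 →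
      IsAsympConst (fun p => f p + g p) 0 := fun hf hg => by simpa using hf.add hg
  have hsub : ∀ {f g : Spacetime → Mat n}, IsAsympConst f 0 → IsAsympConst g 0 →
      IsAsympConst (fun p => f p - g p) 0 := fun hf hg => by simpa using hf.sub hg
  refine ⟨⟨⟨hadd Ay Ph, ?_⟩, hsub At Ax, hsub Ph Ay⟩, fun p τ hτ => ?_, fun p τ hτ => ?_⟩
  · have := hsub (isAsympConst_const 0) (hadd At Ax)
    exact this.congr fun p => by simp [GaugePair.Axi]
  · rw [(hsys p τ hτ).1]
    congr 1
    rw [smul_add]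
    abel
  · rw [(hsys p τ hτ).2]
    congr 1
    abel

theorem tendstoLocallyUniformlyOn_smul_of_tendsto {ι F : Type*} {l : Filter ι}
    [NormedAddCommGroup F] [NormedSpace ℂ F] {s : Set ℂ} {w : ℂ → ℂ} (hw : ContinuousOn w s)
    {A : ι → F} {L : F} (hA : Tendsto A l (𝓝 L)) :
    TendstoLocallyUniformlyOn (fun q τ => w τ • A q) (fun τ => w τ • L) l s := by
  have h1 : TendstoLocallyUniformlyOn (fun (_ : ι) τ => w τ) w l s := fun u hu x _ =>
    ⟨s, self_mem_nhdsWithin, Eventually.of_forall fun _ y _ => refl_mem_uniformity hu⟩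
  have h2 : TendstoLocallyUniformlyOn (fun q (_ : ℂ) => A q) (fun _ => L) l s :=
    (hA.tendstoUniformlyOn_const s).tendstoLocallyUniformlyOn
  exact h1.smul₀ h2 hw continuousOn_const

theorem tendstoLocallyUniformlyOn_one_add_polarSum {ι : Type*} {l : Filter ι} (c : ℂ)
    {d : ι → Fin k → Mat n} {d₀ : Fin k → Mat n} (hd : Tendsto d l (𝓝 d₀)) :
    TendstoLocallyUniformlyOn (fun q τ => 1 + polarSum c (d q) τ) (fun τ => 1 + polarSum c d₀ τ)
      l {c}ᶜ := by
  have h : ∀ s : Finset (Fin k), TendstoLocallyUniformlyOn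
      (fun q τ => 1 + ∑ i ∈ s, ((τ - c) ^ (i.val + 1))⁻¹ • d q i)
      (fun τ => 1 + ∑ i ∈ s, ((τ - c) ^ (i.val + 1))⁻¹ • d₀ i) l {c}ᶜ := by
    classical
    intro s
    induction s using Finset.induction_on with
    | empty =>
      exact fun u hu x _ => ⟨_, self_mem_nhdsWithin,
        Eventually.of_forall fun _ y _ => by simpa using refl_mem_uniformity hu⟩
    | insert a s ha ih =>
      have hw : ContinuousOn (fun τ : ℂ => ((τ - c) ^ (a.val + 1))⁻¹) {c}ᶜ :=
        ContinuousOn.inv₀ (by fun_prop) fun τ hτ => pow_ne_zero _ (sub_ne_zero.mpr hτ)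
      have := ih.add (tendstoLocallyUniformlyOn_smul_of_tendsto hw
        ((continuous_apply a).tendsto d₀ |>.comp hd))
      refine (this.congr fun q τ _ => ?_).congr_right fun τ _ => ?_
      · simp only [Pi.add_apply, Finset.sum_insert ha, Function.comp_apply]
        abel
      · simp only [Pi.add_apply, Finset.sum_insert ha]
        abel
  exact h Finset.univ

variable {U : Set ℂ} {α : ℂ} {ψ : Spacetime → ℂ → Mat n}

theorem conj_mem_diff_pair (hconj : ∀ τ ∈ U, conj τ ∈ U) {τ : ℂ} (hτ : τ ∈ U \ {α, conj α}) :
    conj τ ∈ U \ {α, conj α} := by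
  refine ⟨hconj τ hτ.1, fun h => hτ.2 ?_⟩
  rcases h with h | h
  · exact Or.inr (by rw [← h, Complex.conj_conj]; rfl)
  · exact Or.inl ((starRingEnd ℂ).injective h)

theorem isOpen_diff_pair (hU : IsOpen U) : IsOpen (U \ {α, conj α}) :=
  hU.sdiff (Set.toFinite {α, conj α}).isClosed

theorem eventually_mem_diff_pair (hU : IsOpen U) (hα : α.im ≠ 0) (hαU : α ∈ U) :
    ∀ᶠ z in 𝓝[≠] α, z ∈ U \ {α, conj α} := by
  filter_upwards [nhdsWithin_le_nhds (hU.mem_nhds hαU), self_mem_nhdsWithin,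
    nhdsWithin_le_nhds (isOpen_ne.mem_nhds (ne_conj_of_im_ne_zero hα))] with z h1 h2 h3
  exact ⟨h1, fun h => h.elim h2 h3⟩

theorem eventually_mem_diff_pair_conj (hU : IsOpen U) (hα : α.im ≠ 0) (hαU : conj α ∈ U) :
    ∀ᶠ z in 𝓝[≠] (conj α), z ∈ U \ {α, conj α} := by
  filter_upwards [nhdsWithin_le_nhds (hU.mem_nhds hαU), self_mem_nhdsWithin,
    nhdsWithin_le_nhds (isOpen_ne.mem_nhds (ne_conj_of_im_ne_zero hα).symm)] with z h1 h2 h3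
  exact ⟨h1, fun h => h.elim h3 h2⟩

theorem exists_radius (hU : IsOpen U) (hα : α.im ≠ 0) (hαU : α ∈ U) (hαU' : conj α ∈ U) :
    ∃ r : ℝ, 0 < r ∧ ∀ s, ∀ z ∈ Metric.closedBall (conjPair α s) r, z ≠ conjPair α s →
      z ∈ U \ {α, conj α} := by
  obtain ⟨r₁, h1, hb1⟩ := Metric.nhds_basis_closedBall.mem_iff.mp
    ((mem_nhdsWithin_iff_eventually.mp (eventually_mem_diff_pair hU hα hαU) : _))
  obtain ⟨r₂, h2, hb2⟩ := Metric.nhds_basis_closedBall.mem_iff.mp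
    ((mem_nhdsWithin_iff_eventually.mp (eventually_mem_diff_pair_conj hU hα hαU') : _))
  refine ⟨min r₁ r₂, lt_min h1 h2, fun s z hz hne => ?_⟩
  cases s with
  | true => exact hb1 (Metric.closedBall_subset_closedBall (min_le_left _ _) hz) hne
  | false => exact hb2 (Metric.closedBall_subset_closedBall (min_le_right _ _) hz) hne

/-- A normalized frame near a pole is a contour family, with limit family the limit of the frame at
spatial infinity. -/
theorem IsNormalizedFrame.exists_isContourFamily (hU : IsOpen U) (hconj : ∀ τ ∈ U, conj τ ∈ U)
    (hαU : α ∈ U) (hα : α.im ≠ 0) (hψ : IsNormalizedFrame (U \ {α, conj α}) ψ)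
    (hpole : ∀ p, HasLimitAt α (fun τ => (τ - α) ^ k • ψ p τ))
    (hno : ∀ p, HasLimitAt (conj α) (ψ p)) :
    ∃ r h, IsContourFamily α k r ψ h ∧ ∀ t : ℝ,
      TendstoLocallyUniformlyOn (fun (q : ℝ × ℝ) (τ : ℂ) => ψ (q.1, q.2, t) τ) h
      (cocompact (ℝ × ℝ)) (U \ {α, conj α}) := by
  set V := U \ {α, conj α} with hV
  have hVo : IsOpen V := isOpen_diff_pair hU
  obtain ⟨h, hlim⟩ := hψ.limit
  replace hlim : ∀ t : ℝ,
      TendstoLocallyUniformlyOn (fun (q : ℝ × ℝ) (τ : ℂ) => ψ (q.1, q.2, t) τ) h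
      (cocompact (ℝ × ℝ)) V := hlim
  obtain ⟨M, hM, hsys⟩ := hψ.linear_system
  have hS := hM.hasDecayingSystem hsys
  obtain ⟨r, hr, hball⟩ := exists_radius hU hα hαU (hconj α hαU)
  have hdψ : ∀ p, ∀ z ∈ V, DifferentiableAt ℂ (ψ p) z := fun p z hz =>
    (hψ.holomorphic p).differentiableAt (hVo.mem_nhds hz)
  have hdh : ∀ z ∈ V, DifferentiableAt ℂ h z := fun z hz =>
    ((hlim 0).differentiableOn (Eventually.of_forall fun _ => hψ.holomorphic _)
      hVo).differentiableAt (hVo.mem_nhds hz)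
  have evα := eventually_mem_diff_pair hU hα hαU
  have evα' := eventually_mem_diff_pair_conj hU hα (hconj α hαU)
  have hreal : ∀ z ∈ V, star (h (conj z)) * h z = 1 := by
    intro z hz
    have h1 := (hlim 0).tendsto_at hz
    have h2 := (hlim 0).tendsto_at (conj_mem_diff_pair hconj hz)
    refine tendsto_nhds_unique (h2.star.mul h1) (tendsto_const_nhds.congr fun q => ?_)
    exact (hψ.reality _ z hz).symm
  have hpψ : ∀ p, RealPoleAt α k (ψ p) := fun p =>
    ⟨evα.mono fun z hz => hdψ p z hz, evα'.mono fun z hz => hdψ p z hz, hpole p, hno p,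
      evα.mono fun z hz => hψ.reality p z hz⟩
  have hsphere : ∀ s, Metric.sphere (conjPair α s) r ⊆ V := by
    intro s z hz
    refine hball s z (Metric.sphere_subset_closedBall hz) ?_
    rintro rfl
    simp [hr.ne] at hz
  -- The limit h inherits the order of the pole: w ψ extends over the centre, and convergence on the
  -- punctured ball extends with it by the maximum principle.
  have hregular : ∀ s (w : ℂ → ℂ), Continuous w → DifferentiableOn ℂ w univ →
      (∀ p, HasLimitAt (conjPair α s) (fun z => w z • ψ p z)) →
      HasLimitAt (conjPair α s) (fun z => w z • h z) := by
    intro s w hw hwd hl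
    set B := Metric.ball (conjPair α s) r with hB
    have hBV : B \ {conjPair α s} ⊆ V := fun z hz =>
      hball s z (Metric.ball_subset_closedBall hz.1) hz.2
    have h1 : TendstoLocallyUniformlyOn
        (fun (q : ℝ × ℝ) τ => w τ • ψ (q.1, q.2, 0) τ) (fun τ => w τ • h τ)
        (cocompact (ℝ × ℝ)) (B \ {conjPair α s}) := by
      have h2 : TendstoLocallyUniformlyOn (fun (_ : ℝ × ℝ) τ => w τ) w (cocompact (ℝ × ℝ))
          (B \ {conjPair α s}) := fun u hu x _ =>
        ⟨_, self_mem_nhdsWithin, Eventually.of_forall fun _ y _ => refl_mem_uniformity hu⟩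
      exact h2.smul₀ ((hlim 0).mono hBV) hw.continuousOn
        fun z hz => (hdh z (hBV hz)).continuousAt.continuousWithinAt
    have h3 : TendstoLocallyUniformlyOn
        (fun (q : ℝ × ℝ) => regularize (conjPair α s) (fun τ => w τ • ψ (q.1, q.2, 0) τ))
        (fun τ => w τ • h τ) (cocompact (ℝ × ℝ)) (B \ {conjPair α s}) :=
      h1.congr fun q τ hτ => (regularize_of_ne (fun τ => w τ • ψ (q.1, q.2, 0) τ) hτ.2).symm
    refine (tendstoLocallyUniformlyOn_regularize Metric.isOpen_ball (Metric.mem_ball_self hr)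
      (fun q => ?_) h3).1
    refine differentiableOn_regularize Metric.isOpen_ball (fun z hz => ?_) (hl _)
    exact ((hwd.differentiableAt univ_mem).smul (hdψ _ z (hBV hz))).differentiableWithinAt
  refine ⟨r, h, ⟨hr, fun s z hz hne => ?_, fun p s z hz hne => hdψ p z (hball s z hz hne),
    fun s z hz hne => hdh z (hball s z hz hne), hpψ, ?_, fun s j i hj => ?_⟩, hlim⟩
  · exact fun h => (hball s z hz hne).2 (Or.inr h)
  · refine ⟨evα.mono fun z hz => hdh z hz, evα'.mono fun z hz => hdh z hz, ?_, ?_,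
      evα.mono fun z hz => hreal z hz⟩
    · exact hregular true (fun z => (z - α) ^ k) (by fun_prop) (by fun_prop) hpole
    · simpa [conjPair] using hregular false (fun _ => 1) (by fun_prop) (by fun_prop)
        (by simpa [conjPair] using hno)
  · have hc : ∀ θ, circleMap (conjPair α s) r θ - conj α ≠ 0 := fun θ =>
      sub_ne_zero.mpr fun h => (hball s _ (circleMap_mem_closedBall _ hr.le θ)
        (circleMap_ne_center hr.ne')).2 (Or.inr h)
    have him : (conjPair α s).im ≠ 0 := by
      cases s <;> simpa [conjPair] using hα
    have hu : ContDiff ℝ ∞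
        (fun θ => (fun z => ((z - conj α) ^ i)⁻¹) (circleMap (conjPair α s) r θ)) := by
      simpa using contDiff_pow_mul_inv_circleMap hc 0 i
    -- With exponent k + i the weight compensates the pole of ψ as well as the i-th power of (z -
    -- ᾱ)⁻¹, whichever centre is used. The integrand is regular, the integral is zero, and the
    -- descending recursion can start here.
    refine isAsympConst_contour_of_le (M := k + i) (L := 0) him hr hVo (hsphere s) hψ.smooth hu hS
      (fun z hz => (hdh z (hsphere s hz)).continuousAt.continuousWithinAt)
      (fun t => (tendstoLocallyUniformlyOn_iff_forall_isCompact hVo).mp (hlim t) _ (hsphere s)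
        (isCompact_sphere _ _)) ?_ (by omega)
    refine (isAsympConst_const 0).congr fun p => ?_
    cases s with
    | true =>
      have := circleIntegral_pow_smul_eq_zero hr (f := fun z => (z - α) ^ k • ψ p z) (β := α)
        (w := fun z => (z - α) ^ i * ((z - conj α) ^ i)⁻¹)
        (fun z hz hne => by
          have := hdψ p z (hball true z hz hne)
          fun_prop) (hpole p) (fun z hz => by
          have h1 : (z - conj α) ^ i ≠ 0 := by
            refine pow_ne_zero _ (sub_ne_zero.mpr ?_)
            by_cases hne : z = α
            · rw [hne]; exact ne_conj_of_im_ne_zero hα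
            · exact fun h => (hball true z hz hne).2 (Or.inr h)
          fun_prop (disch := exact h1))
      rw [← this]
      refine circleIntegral.integral_congr hr.le fun z _ => ?_
      simp only [conjPair, smul_smul, cond_true]
      congr 1
      ring
    | false =>
      have := circleIntegral_pow_smul_eq_zero hr (f := ψ p) (β := conj α)
        (w := fun z => (z - conj α) ^ k)
        (fun z hz hne => hdψ p z (hball false z hz hne)) (hno p) (fun z hz => by fun_prop)
      rw [← this]
      refine circleIntegral.integral_congr hr.le fun z hz => ?_
      have h1 : (z - conj α) ^ i ≠ 0 := by
        refine pow_ne_zero _ (sub_ne_zero.mpr ?_)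
        rintro rfl
        simp [conjPair, hr.ne] at hz
      simp only [conjPair, cond_false]
      rw [pow_add, mul_assoc, mul_inv_cancel₀ h1, mul_one]

end FrameContourFamily

/-! ### Skewness, compatibility and the monopole equations. -/

section Compatibility

variable {n : ℕ}

theorem fderiv_mul_apply {f g : Spacetime → Mat n} {p : Spacetime} (hf : DifferentiableAt ℝ f p)
    (hg : DifferentiableAt ℝ g p) (v : Spacetime) :
    fderiv ℝ (fun p => f p * g p) p v = f p * fderiv ℝ g p v + fderiv ℝ f p v * g p := by
  rw [fderiv_fun_mul' hf hg]
  rfl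

theorem fderiv_star_apply {f : Spacetime → Mat n} {p : Spacetime} (hf : DifferentiableAt ℝ f p)
    (v : Spacetime) : fderiv ℝ (fun p => star (f p)) p v = star (fderiv ℝ f p v) :=
  congrArg (fun A => A v) hf.hasFDerivAt.star.fderiv

theorem exists_three_points {Ω : Set ℂ} (hΩ : IsOpen Ω) (hne : Ω.Nonempty) :
    ∃ z ε : ℂ, ε ≠ 0 ∧ z ∈ Ω ∧ z + ε ∈ Ω ∧ z + 2 * ε ∈ Ω := by
  obtain ⟨z, hz⟩ := hne
  obtain ⟨r, hr, hb⟩ := Metric.isOpen_iff.mp hΩ z hz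
  refine ⟨z, ((r / 4 : ℝ) : ℂ), ?_, hz, hb ?_, hb ?_⟩
  · exact_mod_cast (by positivity : r / 4 ≠ 0)
  · rw [Metric.mem_ball, dist_eq_norm, add_sub_cancel_left, Complex.norm_real, Real.norm_eq_abs,
      abs_of_pos (by positivity)]
    linarith
  · rw [Metric.mem_ball, dist_eq_norm, add_sub_cancel_left, norm_mul, Complex.norm_real,
      Real.norm_eq_abs, abs_of_pos (by positivity)]
    norm_num
    linarith

/-- Three equally spaced points suffice: the second difference isolates 2ε² A, then the first
difference isolates ε B. -/
theorem quadratic_coeff_eq_zero {Ω : Set ℂ} (hΩ : IsOpen Ω) (hne : Ω.Nonempty) {A B C : Mat n}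
    (h : ∀ z ∈ Ω, z ^ 2 • A + z • B + C = 0) : A = 0 ∧ B = 0 ∧ C = 0 := by
  obtain ⟨z, ε, hε, h0, h1, h2⟩ := exists_three_points hΩ hne
  have e0 := h _ h0
  have e1 := h _ h1
  have e2 := h _ h2
  have hA : A = 0 := by
    have : (2 * ε ^ 2) • A = 0 := by linear_combination (norm := module) e0 - (2 : ℂ) • e1 + e2
    exact (smul_eq_zero.mp this).resolve_left (mul_ne_zero two_ne_zero (pow_ne_zero _ hε))
  subst hA
  have hB : B = 0 := by
    have : ε • B = 0 := by linear_combination (norm := module) e1 - e0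
    exact (smul_eq_zero.mp this).resolve_left hε
  subst hB
  exact ⟨rfl, rfl, by simpa using e0⟩

theorem isUnit_of_reality {A B : Mat n} (h : star A * B = 1) : IsUnit B :=
  IsUnit.of_mul_eq_one _ (mul_eq_one_comm.mp h)

/-- Differentiating Ψ(τ̄)* Ψ(τ) = 1 and inserting the system at τ and at τ̄ gives Ψ(τ̄)* (τ (b* + b)
+ (c* + c)) Ψ(τ) = 0. The outer factors are invertible, and a polynomial vanishing on an open set
has zero coefficients. -/
theorem skew_of_system {Ω : Set ℂ} (hΩ : IsOpen Ω) (hne : Ω.Nonempty)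
    (hconj : ∀ τ ∈ Ω, conj τ ∈ Ω) {Ψ : Spacetime → ℂ → Mat n}
    (hs : ∀ τ ∈ Ω, ContDiff ℝ ∞ (fun p => Ψ p τ))
    (hreal : ∀ p, ∀ τ ∈ Ω, star (Ψ p (conj τ)) * Ψ p τ = 1) {u v p : Spacetime} {b c : Mat n}
    (hsys : ∀ τ ∈ Ω, τ • fderiv ℝ (fun q => Ψ q τ) p u - fderiv ℝ (fun q => Ψ q τ) p v =
      (τ • b + c) * Ψ p τ) : star b = -b ∧ star c = -c := by
  have key : ∀ τ ∈ Ω, τ ^ 2 • (0 : Mat n) + τ • (star b + b) + (star c + c) = 0 := by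
    intro τ hτ
    have hτ' := hconj τ hτ
    set F := fun q => Ψ q τ
    set G := fun q => Ψ q (conj τ)
    have hF : DifferentiableAt ℝ F p := (hs τ hτ).differentiable (by simp) p
    have hG : DifferentiableAt ℝ G p := (hs _ hτ').differentiable (by simp) p
    have hprod : ∀ w, star (G p) * fderiv ℝ F p w + star (fderiv ℝ G p w) * F p = 0 := by
      intro w
      rw [← fderiv_star_apply hG, ← fderiv_mul_apply hG.star hF]
      have : (fun p => star (G p) * F p) = fun _ => 1 := funext fun q => hreal q τ hτ
      rw [this]
      simp
    have h1 := hsys τ hτ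
    have h2 := congrArg star (hsys _ hτ')
    simp only [star_sub, star_smul, star_mul, star_add, RCLike.star_def, Complex.conj_conj] at h2
    have h3 : star (G p) * ((τ • b + c) * F p) + star (G p) * (τ • star b + star c) * F p = 0 := by
      rw [← h1, ← h2]
      have e1 := hprod u
      have e2 := hprod v
      simp only [mul_sub, sub_mul, mul_smul_comm, smul_mul_assoc]
      linear_combination (norm := module) τ • e1 - e2
    have h4 : star (G p) * (τ • (star b + b) + (star c + c)) * F p = 0 := by
      rw [← h3]
      simp only [mul_add, add_mul, smul_add, mul_assoc]
      abel
    have uF : IsUnit (F p) := isUnit_of_reality (hreal p τ hτ)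
    have uG : IsUnit (star (G p)) := by
      have := isUnit_of_reality (hreal p _ hτ')
      exact this.star
    rw [uF.mul_left_eq_zero, uG.mul_right_eq_zero] at h4
    simpa using h4
  obtain ⟨-, h1, h2⟩ := quadratic_coeff_eq_zero hΩ hne key
  exact ⟨eq_neg_of_add_eq_zero_left h1, eq_neg_of_add_eq_zero_left h2⟩

/-- The compatibility conditions of two linear systems that have a common fundamental solution. -/
theorem compatibility_of_systems {Ω : Set ℂ} (hΩ : IsOpen Ω) (hne : Ω.Nonempty)
    {Ψ : Spacetime → ℂ → Mat n} (hs : ∀ τ ∈ Ω, ContDiff ℝ ∞ (fun p => Ψ p τ))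
    (hunit : ∀ p, ∀ τ ∈ Ω, IsUnit (Ψ p τ)) {u v u' v' : Spacetime} {b c b' c' : Spacetime → Mat n}
    (hb : ContDiff ℝ ∞ b) (hc : ContDiff ℝ ∞ c) (hb' : ContDiff ℝ ∞ b') (hc' : ContDiff ℝ ∞ c')
    (h₁ : ∀ p, ∀ τ ∈ Ω, τ • fderiv ℝ (fun q => Ψ q τ) p u - fderiv ℝ (fun q => Ψ q τ) p v =
      (τ • b p + c p) * Ψ p τ)
    (h₂ : ∀ p, ∀ τ ∈ Ω, τ • fderiv ℝ (fun q => Ψ q τ) p u' - fderiv ℝ (fun q => Ψ q τ) p v' =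
      (τ • b' p + c' p) * Ψ p τ) (p : Spacetime) :
    fderiv ℝ b' p u - fderiv ℝ b p u' + (b' p * b p - b p * b' p) = 0 ∧
    fderiv ℝ c' p u - fderiv ℝ b' p v - fderiv ℝ c p u' + fderiv ℝ b p v' +
      (b' p * c p - c p * b' p) + (c' p * b p - b p * c' p) = 0 ∧
    -fderiv ℝ c' p v + fderiv ℝ c p v' + (c' p * c p - c p * c' p) = 0 := by
  refine quadratic_coeff_eq_zero hΩ hne fun τ hτ => ?_
  set F := fun q => Ψ q τ with hF
  have hFs : ContDiff ℝ ∞ F := hs τ hτ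
  have hFd : ∀ w, Differentiable ℝ (fun q => fderiv ℝ F q w) := fun w =>
    (hFs.fderiv_apply_const w).differentiable (by simp)
  have hd : ∀ {f : Spacetime → Mat n}, ContDiff ℝ ∞ f → Differentiable ℝ f := fun h =>
    h.differentiable (by simp)
  have hderiv : ∀ {b c : Spacetime → Mat n}, ContDiff ℝ ∞ b → ContDiff ℝ ∞ c → ∀ {u v},
      (∀ p, τ • fderiv ℝ F p u - fderiv ℝ F p v = (τ • b p + c p) * F p) → ∀ w,
      τ • fderiv ℝ (fun q => fderiv ℝ F q u) p w - fderiv ℝ (fun q => fderiv ℝ F q v) p w =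
        (τ • b p + c p) * fderiv ℝ F p w + (τ • fderiv ℝ b p w + fderiv ℝ c p w) * F p := by
    intro b c hb hc u v h w
    have e1 : fderiv ℝ (fun p => τ • fderiv ℝ F p u - fderiv ℝ F p v) p w =
        τ • fderiv ℝ (fun q => fderiv ℝ F q u) p w - fderiv ℝ (fun q => fderiv ℝ F q v) p w := by
      rw [fderiv_fun_sub ((hFd u p).fun_const_smul τ) (hFd v p), fderiv_fun_const_smul (hFd u p)]
      rfl
    have e2 : fderiv ℝ (fun p => τ • b p + c p) p w = τ • fderiv ℝ b p w + fderiv ℝ c p w := by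
      rw [fderiv_fun_add ((hd hb p).fun_const_smul τ) (hd hc p), fderiv_fun_const_smul (hd hb p)]
      rfl
    rw [← e1, ← e2, funext h]
    exact fderiv_mul_apply (((hd hb p).fun_const_smul τ).fun_add (hd hc p)) (hd hFs p) w
  -- Each system is differentiated by the operator of the other and the results subtracted. Symmetry
  -- of second derivatives removes the second-order terms, and the systems themselves (b1, b2)
  -- remove the first-order ones.
  have a1 := hderiv hb hc (fun p => h₁ p τ hτ) u'
  have a2 := hderiv hb hc (fun p => h₁ p τ hτ) v'
  have a3 := hderiv hb' hc' (fun p => h₂ p τ hτ) u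
  have a4 := hderiv hb' hc' (fun p => h₂ p τ hτ) v
  have s1 := fderiv_fderiv_apply_comm hFs p u u'
  have s2 := fderiv_fderiv_apply_comm hFs p u v'
  have s3 := fderiv_fderiv_apply_comm hFs p v u'
  have s4 := fderiv_fderiv_apply_comm hFs p v v'
  have b1 := congrArg (fun X => (τ • b' p + c' p) * X) (h₁ p τ hτ)
  have b2 := congrArg (fun X => (τ • b p + c p) * X) (h₂ p τ hτ)
  rw [← (hunit p τ hτ).mul_left_eq_zero]
  have hF0 : Ψ p τ = F p := rfl
  rw [hF0] at b1 b2 ⊢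
  simp only [add_mul, mul_add, sub_mul, mul_sub, smul_mul_assoc, mul_smul_comm, smul_add, smul_sub,
    smul_smul, neg_mul, mul_assoc] at a1 a2 a3 a4 b1 b2 ⊢
  linear_combination (norm := module) -τ • a3 + a4 + τ • a1 - a2 - b1 + b2 - τ ^ 2 • s1 + τ • s2 + τ • s3 - s4

theorem fderiv_inv_two_smul_add {f g : Spacetime → Mat n} (hf : ContDiff ℝ ∞ f)
    (hg : ContDiff ℝ ∞ g) (p v : Spacetime) :
    fderiv ℝ (fun p => (2⁻¹ : ℂ) • (f p + g p)) p v =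
      (2⁻¹ : ℂ) • (fderiv ℝ f p v + fderiv ℝ g p v) := by
  have hf' := hf.differentiable (by simp) p
  have hg' := hg.differentiable (by simp) p
  rw [fderiv_fun_const_smul (hf'.fun_add hg'), fderiv_fun_add hf' hg']
  rfl

theorem fderiv_inv_two_smul_sub {f g : Spacetime → Mat n} (hf : ContDiff ℝ ∞ f)
    (hg : ContDiff ℝ ∞ g) (p v : Spacetime) :
    fderiv ℝ (fun p => (2⁻¹ : ℂ) • (f p - g p)) p v =
      (2⁻¹ : ℂ) • (fderiv ℝ f p v - fderiv ℝ g p v) := by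
  have hf' := hf.differentiable (by simp) p
  have hg' := hg.differentiable (by simp) p
  rw [fderiv_fun_const_smul (hf'.fun_sub hg'), fderiv_fun_sub hf' hg']
  rfl

/-- A common fundamental solution, satisfying the reality condition, of two linear systems with
decaying coefficients is a frame of a monopole. -/
theorem HasDecayingSystem.exists_isMonopole {Ω : Set ℂ} (hΩ : IsOpen Ω) (hne : Ω.Nonempty)
    (hconj : ∀ τ ∈ Ω, conj τ ∈ Ω) {Ψ : Spacetime → ℂ → Mat n}
    (hs : ContDiffOn ℝ ∞ (fun q : Spacetime × ℂ => Ψ q.1 q.2) (univ ×ˢ Ω))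
    (hreal : ∀ p, ∀ τ ∈ Ω, star (Ψ p (conj τ)) * Ψ p τ = 1) {b₁ c₁ b₂ c₂ : Spacetime → Mat n}
    (hsys : HasDecayingSystem Ω Ψ b₁ c₁ b₂ c₂) :
    ∃ M : GaugePair n, M.IsMonopole ∧ ∀ p, ∀ τ ∈ Ω,
      τ • dY (fun q => Ψ q τ) p - dXi (fun q => Ψ q τ) p
        = (τ • M.Ay p + τ • M.phi p - M.Axi p) * Ψ p τ ∧
      τ • dEta (fun q => Ψ q τ) p - dY (fun q => Ψ q τ) p
        = (τ • M.Aeta p + M.phi p - M.Ay p) * Ψ p τ := by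
  obtain ⟨⟨hb₁, hc₁⟩, hb₂, hc₂⟩ := hsys.decay
  have hΨ : ∀ τ ∈ Ω, ContDiff ℝ ∞ (fun p => Ψ p τ) := fun τ hτ => contDiff_slice_of_contDiffOn hs hτ
  have e1 : ∀ p, ∀ τ ∈ Ω, τ • fderiv ℝ (fun q => Ψ q τ) p (0, 1, 0) -
      fderiv ℝ (fun q => Ψ q τ) p (1, 0, 1) = (τ • b₁ p + c₁ p) * Ψ p τ := fun p τ hτ => by
    have := hsys.eq_one p τ hτ
    rwa [dXi_eq_fderiv, dY_eq_fderiv] at this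
  have e2 : ∀ p, ∀ τ ∈ Ω, τ • fderiv ℝ (fun q => Ψ q τ) p (-1, 0, 1) -
      fderiv ℝ (fun q => Ψ q τ) p (0, 1, 0) = (τ • b₂ p + c₂ p) * Ψ p τ := fun p τ hτ => by
    have := hsys.eq_two p τ hτ
    rwa [dEta_eq_fderiv, dY_eq_fderiv] at this
  have sk1 := fun p => skew_of_system hΩ hne hconj hΨ hreal (e1 p)
  have sk2 := fun p => skew_of_system hΩ hne hconj hΨ hreal (e2 p)
  have comp := compatibility_of_systems hΩ hne hΨ (fun p τ hτ => isUnit_of_reality (hreal p τ hτ))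
    hb₁.smooth hc₁.smooth hb₂.smooth hc₂.smooth e1 e2
  have hadd : ∀ {f g : Spacetime → Mat n}, IsAsympConst f 0 → IsAsympConst g 0 →
      IsAsympConst (fun p => (2⁻¹ : ℂ) • (f p + g p)) 0 := fun hf hg => by
    have := (hf.add hg)
    rw [add_zero] at this
    exact this.const_smul_zero _
  have hsub : ∀ {f g : Spacetime → Mat n}, IsAsympConst f 0 → IsAsympConst g 0 →
      IsAsympConst (fun p => (2⁻¹ : ℂ) • (f p - g p)) 0 := fun hf hg => by
    have := (hf.sub hg)
    rw [sub_zero] at this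
    exact this.const_smul_zero _
  have hneg : IsAsympConst (fun p => -c₁ p) 0 := by
    simpa using hc₁.const_smul_zero (-1)
  have aAx := hsub hneg hb₂
  have aAy := hsub hb₁ hc₂
  have aAt := hsub hb₂ hc₁
  have aφ := hadd hb₁ hc₂
  have hnegd : ∀ p v, fderiv ℝ (fun p => -c₁ p) p v = -fderiv ℝ c₁ p v := fun p v => by
    rw [fderiv_fun_neg]
    rfl
  have dX' : ∀ (f : Spacetime → Mat n) p, dX f p = fderiv ℝ f p (1, 0, 0) := fun _ _ => rfl
  have dT' : ∀ (f : Spacetime → Mat n) p, dT f p = fderiv ℝ f p (0, 0, 1) := fun _ _ => rfl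
  have dxi : ∀ (f : Spacetime → Mat n) p, fderiv ℝ f p (1, 0, 1) =
    fderiv ℝ f p (0, 0, 1) + fderiv ℝ f p (1, 0, 0) := fun f p => (dXi_eq_fderiv f p).symm
  have deta : ∀ (f : Spacetime → Mat n) p, fderiv ℝ f p (-1, 0, 1) =
    fderiv ℝ f p (0, 0, 1) - fderiv ℝ f p (1, 0, 0) := fun f p => (dEta_eq_fderiv f p).symm
  -- The solution of b₁ = A_y + φ, c₁ = -A_ξ, b₂ = A_η, c₂ = φ - A_y.
  let M : GaugePair n :=
    { Ax := fun p => (2⁻¹ : ℂ) • (-c₁ p - b₂ p)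
      Ay := fun p => (2⁻¹ : ℂ) • (b₁ p - c₂ p)
      At := fun p => (2⁻¹ : ℂ) • (b₂ p - c₁ p)
      phi := fun p => (2⁻¹ : ℂ) • (b₁ p + c₂ p) }
  have dAx : ∀ p v, fderiv ℝ M.Ax p v = (2⁻¹ : ℂ) • (-fderiv ℝ c₁ p v - fderiv ℝ b₂ p v) :=
    fun p v => (fderiv_inv_two_smul_sub hneg.smooth hb₂.smooth p v).trans (by rw [hnegd])
  have dAy : ∀ p v, fderiv ℝ M.Ay p v = (2⁻¹ : ℂ) • (fderiv ℝ b₁ p v - fderiv ℝ c₂ p v) :=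
    fderiv_inv_two_smul_sub hb₁.smooth hc₂.smooth
  have dAt : ∀ p v, fderiv ℝ M.At p v = (2⁻¹ : ℂ) • (fderiv ℝ b₂ p v - fderiv ℝ c₁ p v) :=
    fderiv_inv_two_smul_sub hb₂.smooth hc₁.smooth
  have dφ : ∀ p v, fderiv ℝ M.phi p v = (2⁻¹ : ℂ) • (fderiv ℝ b₁ p v + fderiv ℝ c₂ p v) :=
    fderiv_inv_two_smul_add hb₁.smooth hc₂.smooth
  refine ⟨M, ⟨⟨aAx.smooth, aAy.smooth, aAt.smooth, aφ.smooth⟩, fun p => ?_,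
    ⟨(isAsympConst_zero_iff_decaysSpatially aAx.smooth).mp aAx,
      (isAsympConst_zero_iff_decaysSpatially aAy.smooth).mp aAy,
      (isAsympConst_zero_iff_decaysSpatially aAt.smooth).mp aAt,
      (isAsympConst_zero_iff_decaysSpatially aφ.smooth).mp aφ⟩, fun p => ?_, fun p => ?_,
      fun p => ?_⟩, fun p τ hτ => ⟨?_, ?_⟩⟩
  · obtain ⟨s1, s2⟩ := sk1 p
    obtain ⟨s3, s4⟩ := sk2 p
    refine ⟨?_, ?_, ?_, ?_⟩ <;>
      simp [M, star_smul, s1, s2, s3, s4, ← smul_neg] <;> module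
  -- E2, E1, E0 are the coefficients of τ², τ, 1. The x- and t-components of the monopole equation
  -- are combinations of E2 and E0, and the y-component is half of E1.
  · obtain ⟨E2, E1, E0⟩ := comp p
    rw [GaugePair.Fyt, dX', dY_eq_fderiv, dT', dφ, dAt, dAy]
    simp only [M, dxi, deta, smul_mul_assoc, mul_smul_comm, add_mul, mul_add, sub_mul, mul_sub,
      neg_mul, mul_neg] at E2 E1 E0 ⊢
    linear_combination (norm := module) (2⁻¹ : ℂ) • E2 - (2⁻¹ : ℂ) • E0
  · obtain ⟨E2, E1, E0⟩ := comp p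
    rw [GaugePair.Ftx, dX', dY_eq_fderiv, dT', dφ, dAt, dAx]
    simp only [M, dxi, deta, smul_mul_assoc, mul_smul_comm, add_mul, mul_add, sub_mul, mul_sub,
      neg_mul, mul_neg] at E2 E1 E0 ⊢
    linear_combination (norm := module) (2⁻¹ : ℂ) • E1
  · obtain ⟨E2, E1, E0⟩ := comp p
    rw [GaugePair.Fyx, dX', dY_eq_fderiv, dT', dφ, dAx, dAy]
    simp only [M, dxi, deta, smul_mul_assoc, mul_smul_comm, add_mul, mul_add, sub_mul, mul_sub,
      neg_mul, mul_neg] at E2 E1 E0 ⊢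
    linear_combination (norm := module) -(2⁻¹ : ℂ) • E2 - (2⁻¹ : ℂ) • E0
  · rw [hsys.eq_one p τ hτ]
    congr 1
    simp only [M, GaugePair.Axi]
    module
  · rw [hsys.eq_two p τ hτ]
    congr 1
    simp only [M, GaugePair.Aeta]
    module

end Compatibility

/-! ### Real rational factors and their inverses. -/

section PolarFactors

variable {n k : ℕ}

theorem fderiv_one_add_polarSum {d : Spacetime → Fin k → Mat n} (hd : ContDiff ℝ ∞ d) (β τ : ℂ)
    (p v : Spacetime) : fderiv ℝ (fun q => 1 + polarSum β (d q) τ) p v =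
      polarSum β (fderiv ℝ d p v) τ := by
  let L : (Fin k → Mat n) →L[ℝ] Mat n := ∑ i : Fin k, ((τ - β) ^ (i.val + 1))⁻¹ •
    (ContinuousLinearMap.proj i : (Fin k → Mat n) →L[ℝ] Mat n)
  have hL : ∀ x, polarSum β x τ = L x := fun x => by simp [L, polarSum, sum_apply]
  simp only [hL]
  rw [fderiv_const_add]
  exact congrArg (fun A => A v)
    (L.hasFDerivAt.comp p (hd.differentiable (by simp) p).hasFDerivAt).fderiv

theorem contDiffOn_one_add_polarSum {d : Spacetime → Fin k → Mat n} (hd : ContDiff ℝ ∞ d) (β : ℂ) :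
    ContDiffOn ℝ ∞ (fun q : Spacetime × ℂ => 1 + polarSum β (d q.1) q.2) (univ ×ˢ {β}ᶜ) := by
  refine contDiffOn_const.add (ContDiffOn.sum fun i _ => ?_)
  refine ContDiffOn.smul (f := fun q : Spacetime × ℂ => ((q.2 - β) ^ (i.val + 1))⁻¹)
    (g := fun q : Spacetime × ℂ => d q.1 i) ?_ ?_
  · exact ContDiffOn.inv (by fun_prop) fun q hq => pow_ne_zero _ (sub_ne_zero.mpr hq.2)
  · exact ((contDiff_pi.mp hd i).comp contDiff_fst).contDiffOn

theorem tendsto_div_sub_cocompact (β : ℂ) :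
    Tendsto (fun z : ℂ => z * (z - β)⁻¹) (cocompact ℂ) (𝓝 1) := by
  have h : Tendsto (fun z : ℂ => 1 + β * (z - β)⁻¹) (cocompact ℂ) (𝓝 1) := by
    simpa using ((tendsto_sub_const_inv_cocompact β).const_mul β).const_add 1
  refine h.congr' ?_
  have : ∀ᶠ z in cocompact ℂ, z ≠ β :=
    (finite_singleton β).isCompact.compl_mem_cocompact
  filter_upwards [this] with z hz
  have := sub_ne_zero.mpr hz
  field_simp
  ring

theorem tendsto_smul_polarSum_cocompact (β : ℂ) (d : Fin (k + 1) → Mat n) :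
    Tendsto (fun z => z • polarSum β d z) (cocompact ℂ) (𝓝 (d 0)) := by
  have h := (tendsto_div_sub_cocompact β).smul
    ((tendsto_polarSum_cocompact β (fun i => d i.succ)).const_add (d 0))
  rw [add_zero, one_smul] at h
  refine h.congr fun z => ?_
  rw [polarSum_succ, smul_smul]

theorem tendsto_one_add_polarSum_cocompact (β : ℂ) (d : Fin k → Mat n) :
    Tendsto (fun z => 1 + polarSum β d z) (cocompact ℂ) (𝓝 1) := by
  simpa using (tendsto_polarSum_cocompact β d).const_add 1

theorem tendsto_pow_smul_one_add_polarSum (β : ℂ) (d : Fin (k + 1) → Mat n) :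
    Tendsto (fun z => (z - β) ^ (k + 1) • (1 + polarSum β d z)) (𝓝[≠] β) (𝓝 (d (Fin.last k))) := by
  have h : ContinuousAt (fun z => (z - β) ^ (k + 1) • (1 : Mat n) +
      ∑ i : Fin (k + 1), (z - β) ^ (k + 1 - (i.val + 1)) • d i) β := by
    fun_prop
  have h' := h.tendsto.mono_left (nhdsWithin_le_nhds (s := {β}ᶜ))
  have e : (β - β) ^ (k + 1) • (1 : Mat n) +
      ∑ i : Fin (k + 1), (β - β) ^ (k + 1 - (i.val + 1)) • d i = d (Fin.last k) := by
    rw [sub_self, zero_pow (by omega), zero_smul, zero_add, Fin.sum_univ_castSucc]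
    simp only [Fin.val_last, Nat.sub_self, pow_zero, one_smul, add_eq_right]
    refine Finset.sum_eq_zero fun i _ => ?_
    rw [zero_pow, zero_smul]
    have := i.isLt
    simp only [Fin.val_castSucc]
    omega
  rw [e] at h'
  refine h'.congr' ?_
  filter_upwards [self_mem_nhdsWithin] with z hz
  rw [smul_add, polarSum, Finset.smul_sum]
  congr 1
  refine Finset.sum_congr rfl fun i _ => ?_
  rw [smul_smul, pow_sub₀ _ (sub_ne_zero.mpr hz) (by omega)]

/-- The reality condition for a factor with poles only at `conj α`. -/
def IsRealFactor (α : ℂ) (d : Fin k → Mat n) : Prop :=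
  ∀ z, z ≠ α → z ≠ conj α →
    star (1 + polarSum (conj α) d (conj z)) * (1 + polarSum (conj α) d z) = 1

variable {α : ℂ} {d : Fin k → Mat n}

theorem star_one_add_polarSum (d : Fin k → Mat n) (z : ℂ) :
    star (1 + polarSum (conj α) d (conj z)) = 1 + polarSum α (fun i => star (d i)) z := by
  rw [star_add, star_one, star_polarSum, Complex.conj_conj]

theorem star_one_add_polarSum_star (d : Fin k → Mat n) (z : ℂ) :
    star (1 + polarSum α (fun i => star (d i)) (conj z)) = 1 + polarSum (conj α) d z := by
  rw [star_add, star_one, star_polarSum]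
  simp

theorem IsRealFactor.mul_eq_one (h : IsRealFactor α d) {z : ℂ} (h1 : z ≠ α) (h2 : z ≠ conj α) :
    (1 + polarSum α (fun i => star (d i)) z) * (1 + polarSum (conj α) d z) = 1 := by
  rw [← star_one_add_polarSum]
  exact h z h1 h2

theorem IsRealFactor.mul_eq_one' (h : IsRealFactor α d) {z : ℂ} (h1 : z ≠ α) (h2 : z ≠ conj α) :
    (1 + polarSum (conj α) d z) * (1 + polarSum α (fun i => star (d i)) z) = 1 :=
  mul_eq_one_comm.mp (h.mul_eq_one h1 h2)

theorem IsRealFactor.reality (h : IsRealFactor α d) {z : ℂ} (h1 : z ≠ α) (h2 : z ≠ conj α) :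
    star (1 + polarSum α (fun i => star (d i)) (conj z)) *
      (1 + polarSum α (fun i => star (d i)) z) = 1 := by
  rw [star_one_add_polarSum_star]
  exact h.mul_eq_one' h1 h2

theorem IsRealFactor.transpose (h : IsRealFactor α d) :
    IsRealFactor α (fun i => (d i)ᵀ) := by
  intro z h1 h2
  have e : ∀ z, 1 + polarSum (conj α) (fun i => (d i)ᵀ) z = (1 + polarSum (conj α) d z)ᵀ := by
    intro z
    simp [polarSum, Matrix.transpose_sum]
  rw [e, e, star_transpose_mul_transpose, mul_eq_one_comm.mp (h z h1 h2), Matrix.transpose_one]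

/-- The rational factor whose inverse has poles only at `conj α` has pole data `(α, k + 1)`. -/
theorem hasPoleData_of_isRealFactor {d : Spacetime → Fin (k + 1) → Mat n} (hd : ContDiff ℝ ∞ d)
    (hreal : ∀ p, IsRealFactor α (d p)) (hne : ∃ p, d p (Fin.last k) ≠ 0) :
    HasPoleData α (k + 1) (fun p τ => 1 + polarSum α (fun i => star (d p i)) τ) where
  rational := by
    -- The order j of the pole corresponds to the index j - 1. By truncated subtraction c 0 repeats
    -- c 1, which is harmless because the sum starts at 1.
    let c : ℕ → Spacetime → Mat n := fun j p =>
      if h : j - 1 < k + 1 then star (d p ⟨j - 1, h⟩) else 0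
    have hc : ∀ p, (fun i => star (d p i)) = fun i : Fin (k + 1) => c (i.val + 1) p := by
      intro p
      funext i
      simp only [c, Nat.add_sub_cancel, i.isLt, dif_pos]
    refine ⟨c, fun j => ?_, ?_, fun p τ _ => ?_⟩
    · by_cases h : j - 1 < k + 1
      · simp only [c, h, dif_pos]
        exact (starL' ℝ : Mat n ≃L[ℝ] Mat n).contDiff.comp (contDiff_pi.mp hd ⟨j - 1, h⟩)
      · simp only [c, h, dif_neg, not_false_iff]
        exact contDiff_const
    · obtain ⟨p, hp⟩ := hne
      refine ⟨p, ?_⟩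
      have := congrFun (hc p) (Fin.last k)
      simp only [Fin.val_last] at this
      rw [← this]
      exact fun h => hp (star_eq_zero.mp h)
    · rw [hc p, polarSum_eq_sum_Icc α (fun j => c j p)]
  reality p τ h1 h2 := (hreal p).reality h1 h2

end PolarFactors

/-! ### Filling in the points α and ᾱ. -/

section RegularExtension

variable {n : ℕ} {U : Set ℂ} {α : ℂ}

theorem mem_closure_diff_pair (hU : IsOpen U) {τ : ℂ} (hτ : τ ∈ U) :
    τ ∈ closure (U \ {α, conj α}) := by
  have : Dense ({α, conj α} : Set ℂ)ᶜ := (Set.toFinite _).countable.dense_compl ℝ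
  have h := this.open_subset_closure_inter hU hτ
  rwa [← Set.sdiff_eq] at h

theorem eq_of_continuousOn_of_eq_diff_pair {E : Type*} [TopologicalSpace E] [T2Space E]
    (hU : IsOpen U) {f g : ℂ → E} (hf : ContinuousOn f U) (hg : ContinuousOn g U)
    (h : ∀ τ ∈ U \ {α, conj α}, f τ = g τ) {τ : ℂ} (hτ : τ ∈ U) : f τ = g τ := by
  have hcl : ∃ᶠ z in 𝓝 τ, z ∈ U \ {α, conj α} :=
    mem_closure_iff_frequently.mp (mem_closure_diff_pair hU hτ)
  by_contra hne
  have h1 := hf.continuousAt (hU.mem_nhds hτ)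
  have h2 := hg.continuousAt (hU.mem_nhds hτ)
  have h3 : ∀ᶠ z in 𝓝 τ, (f z, g z) ∈ (diagonal E)ᶜ :=
    (h1.prodMk h2).eventually (isClosed_diagonal.isOpen_compl.mem_nhds hne)
  obtain ⟨z, hz, hz'⟩ := (hcl.and_eventually h3).exists
  exact hz' (h z hz)

/-- Extension of a real family over its removable singularities `α` and `conj α`. -/
theorem exists_regular_extension (hU : IsOpen U) (hconj : ∀ τ ∈ U, conj τ ∈ U) (hαU : α ∈ U)
    (hα : α.im ≠ 0) {f : Spacetime → ℂ → Mat n}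
    (hs : ContDiffOn ℝ ∞ (fun q : Spacetime × ℂ => f q.1 q.2) (univ ×ˢ (U \ {α, conj α})))
    (hd : ∀ p, DifferentiableOn ℂ (f p) (U \ {α, conj α}))
    (h1 : ∀ p, HasLimitAt α (f p)) (h2 : ∀ p, HasLimitAt (conj α) (f p))
    (hreal : ∀ p, ∀ τ ∈ U \ {α, conj α}, star (f p (conj τ)) * f p τ = 1) :
    ∃ F : Spacetime → ℂ → Mat n, (∀ p τ, τ ≠ α → τ ≠ conj α → F p τ = f p τ) ∧
      ContDiffOn ℝ ∞ (fun q : Spacetime × ℂ => F q.1 q.2) (univ ×ˢ U) ∧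
      (∀ p, DifferentiableOn ℂ (F p) U) ∧ ∀ p, ∀ τ ∈ U, star (F p (conj τ)) * F p τ = 1 := by
  have hne := ne_conj_of_im_ne_zero hα
  have hW : IsOpen (U \ {conj α}) := hU.sdiff isClosed_singleton
  have hWV : (U \ {conj α}) \ {α} = U \ {α, conj α} := by
    rw [sdiff_sdiff, union_comm]
    rfl
  have hαW : α ∈ U \ {conj α} := ⟨hαU, hne⟩
  set F₁ := fun p => regularize α (f p) with hF₁
  have s1 : ContDiffOn ℝ ∞ (fun q : Spacetime × ℂ => F₁ q.1 q.2) (univ ×ˢ (U \ {conj α})) :=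
    contDiffOn_regularize hW hαW (by rwa [hWV]) (by rwa [hWV]) h1
  have d1 : ∀ p, DifferentiableOn ℂ (F₁ p) (U \ {conj α}) := fun p =>
    differentiableOn_regularize hW (by rw [hWV]; exact hd p) (h1 p)
  have l1 : ∀ p, HasLimitAt (conj α) (F₁ p) := fun p => (h2 p).congr' (by
    filter_upwards [nhdsWithin_le_nhds (isOpen_ne.mem_nhds hne.symm)] with z hz
    exact (regularize_of_ne _ hz).symm)
  set F := fun p => regularize (conj α) (F₁ p) with hF
  have s2 : ContDiffOn ℝ ∞ (fun q : Spacetime × ℂ => F q.1 q.2) (univ ×ˢ U) :=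
    contDiffOn_regularize hU (hconj α hαU) s1 d1 l1
  have d2 : ∀ p, DifferentiableOn ℂ (F p) U := fun p =>
    differentiableOn_regularize hU (d1 p) (l1 p)
  have e : ∀ p τ, τ ≠ α → τ ≠ conj α → F p τ = f p τ := fun p τ a b => by
    simp only [hF, hF₁]
    rw [regularize_of_ne _ b, regularize_of_ne _ a]
  refine ⟨F, e, s2, d2, fun p τ hτ => ?_⟩
  have hc1 : ContinuousOn (fun τ => F p (conj τ)) U :=
    (d2 p).continuousOn.comp Complex.continuous_conj.continuousOn hconj
  refine eq_of_continuousOn_of_eq_diff_pair (α := α) hU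
    (f := fun τ => star (F p (conj τ)) * F p τ) (g := fun _ => 1)
    (hc1.star.mul (d2 p).continuousOn) continuousOn_const (fun z hz => ?_) hτ
  have hz' := conj_mem_diff_pair hconj hz
  simp only [Set.mem_sdiff, mem_insert_iff, mem_singleton_iff, not_or] at hz'
  have hz2 := hz.2
  simp only [mem_insert_iff, mem_singleton_iff, not_or] at hz2
  rw [e p z hz2.1 hz2.2, e p (conj z) hz'.2.1 hz'.2.2]
  exact hreal p z hz

theorem isRegularAt_of_reality (hU : IsOpen U) {F : Spacetime → ℂ → Mat n}
    (hd : ∀ p, DifferentiableOn ℂ (F p) U)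
    (hreal : ∀ p, ∀ τ ∈ U, star (F p (conj τ)) * F p τ = 1) {τ : ℂ} (hτ : τ ∈ U) :
    IsRegularAt τ F := fun p =>
  ⟨(hd p).analyticAt (hU.mem_nhds hτ), isUnit_of_reality (hreal p τ hτ)⟩

end RegularExtension

/-! ### Linear systems of the two rational factors, by Liouville. -/

section FactorSystems

variable {n k : ℕ} {U : Set ℂ} {α : ℂ}

theorem ContinuousOn.hasLimitAt {E : Type*} [NormedAddCommGroup E] [NormedSpace ℂ E] {f : ℂ → E}
    (hU : IsOpen U) (hf : ContinuousOn f U) {β : ℂ} (hβ : β ∈ U) : HasLimitAt β f :=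
  (hf.continuousAt (hU.mem_nhds hβ)).hasLimitAt

theorem ne_of_mem_diff_pair {τ : ℂ} (hτ : τ ∈ U \ {α, conj α}) : τ ≠ α ∧ τ ≠ conj α := by
  have h := hτ.2
  simp only [mem_insert_iff, mem_singleton_iff, not_or] at h
  exact h

theorem differentiableAt_one_add_polarSum {β : ℂ} (d : Fin k → Mat n) {z : ℂ} (hz : z ≠ β) :
    DifferentiableAt ℂ (fun z => 1 + polarSum β d z) z :=
  (differentiableAt_polarSum d hz).const_add 1

theorem continuousOn_polarSum {β : ℂ} (d : Fin k → Mat n) : ContinuousOn (polarSum β d) {β}ᶜ :=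
  fun _ hz => (differentiableAt_polarSum d hz).continuousAt.continuousWithinAt

/-- Let X = ((τ∂_u - ∂_v) g) g⁻¹. It is rational with poles at most at α and ᾱ. Inserting ψ = F g
into the system of ψ rewrites X in terms of F, F⁻¹ and the derivatives of F, all regular at both
points. So X is constant, equal to its value at infinity, the u-derivative of the residue of g.
Continuity recovers the equation at ᾱ. -/
theorem soliton_system (hU : IsOpen U) (hconj : ∀ τ ∈ U, conj τ ∈ U) (hαU : α ∈ U)
    (hα : α.im ≠ 0) {d : Spacetime → Fin (k + 1) → Mat n} (hd : ContDiff ℝ ∞ d)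
    (hreal : ∀ p, IsRealFactor α (d p)) {F ψ : Spacetime → ℂ → Mat n}
    (hFs : ContDiffOn ℝ ∞ (fun q : Spacetime × ℂ => F q.1 q.2) (univ ×ˢ U))
    (hFr : ∀ p, ∀ τ ∈ U, star (F p (conj τ)) * F p τ = 1)
    (heq : ∀ p, ∀ τ ∈ U \ {α, conj α},
      ψ p τ = F p τ * (1 + polarSum α (fun i => star (d p i)) τ))
    {u v p : Spacetime} {b c : Mat n}
    (hsys : ∀ τ ∈ U \ {α, conj α}, τ • fderiv ℝ (fun q => ψ q τ) p u -
      fderiv ℝ (fun q => ψ q τ) p v = (τ • b + c) * ψ p τ) {τ : ℂ} (hτ : τ ≠ α) :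
    τ • fderiv ℝ (fun q => 1 + polarSum α (fun i => star (d q i)) τ) p u -
      fderiv ℝ (fun q => 1 + polarSum α (fun i => star (d q i)) τ) p v =
      fderiv ℝ (fun q => star (d q 0)) p u * (1 + polarSum α (fun i => star (d p i)) τ) := by
  set e : Spacetime → Fin (k + 1) → Mat n := fun q i => star (d q i) with he
  have hes : ContDiff ℝ ∞ e := contDiff_pi.mpr fun i =>
    (starL' ℝ : Mat n ≃L[ℝ] Mat n).contDiff.comp (contDiff_pi.mp hd i)
  have he0 : fderiv ℝ (fun q => star (d q 0)) p u = fderiv ℝ e p u 0 := by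
    have := ((ContinuousLinearMap.proj 0 : (Fin (k + 1) → Mat n) →L[ℝ] Mat n).hasFDerivAt.comp p
      (hes.differentiable (by simp) p).hasFDerivAt).fderiv
    exact congrArg (fun A => A u) this
  have hfd : ∀ τ w, fderiv ℝ (fun q => 1 + polarSum α (e q) τ) p w =
      polarSum α (fderiv ℝ e p w) τ := fun τ w => fderiv_one_add_polarSum hes α τ p w
  set D : ℂ → Mat n := fun τ => τ • polarSum α (fderiv ℝ e p u) τ - polarSum α (fderiv ℝ e p v) τ
    with hD
  set X : ℂ → Mat n := fun τ => D τ * (1 + polarSum (conj α) (d p) τ) with hX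
  have hFc : ContinuousOn (F p) U := continuousOn_slice hFs p
  have hFc' : ContinuousOn (fun τ => star (F p (conj τ))) U :=
    (hFc.comp Complex.continuous_conj.continuousOn hconj).star
  have hFd : ∀ w, ContinuousOn (fun τ => fderiv ℝ (fun q => F q τ) p w) U := fun w =>
    continuousOn_slice (ψ := fun p τ => fderiv ℝ (fun q => F q τ) p w)
      (contDiffOn_fderiv_slice hU hFs w) p
  set Y : ℂ → Mat n := fun τ => star (F p (conj τ)) * ((τ • b + c) * F p τ -
    (τ • fderiv ℝ (fun q => F q τ) p u - fderiv ℝ (fun q => F q τ) p v)) with hY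
  have hYc : ContinuousOn Y U := by
    refine hFc'.mul (ContinuousOn.sub (ContinuousOn.mul (by fun_prop) hFc) ?_)
    exact (continuousOn_id.smul (hFd u)).sub (hFd v)
  have hXY : ∀ τ ∈ U \ {α, conj α}, Y τ = X τ := by
    intro τ hτ
    obtain ⟨h1, h2⟩ := ne_of_mem_diff_pair hτ
    have hψ : (fun q => ψ q τ) = fun q => F q τ * (1 + polarSum α (e q) τ) :=
      funext fun q => heq q τ hτ
    have hdF : DifferentiableAt ℝ (fun q => F q τ) p :=
      (contDiff_slice_of_contDiffOn hFs hτ.1).differentiable (by simp) p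
    have hdg : DifferentiableAt ℝ (fun q => 1 + polarSum α (e q) τ) p :=
      (contDiff_slice_of_contDiffOn (ψ := fun q τ => 1 + polarSum α (e q) τ)
        (contDiffOn_one_add_polarSum hes α) h1).differentiable (by simp) p
    have h := hsys τ hτ
    rw [hψ, fderiv_mul_apply hdF hdg, fderiv_mul_apply hdF hdg, hfd, hfd, heq p τ hτ] at h
    have h' : F p τ * D τ = ((τ • b + c) * F p τ -
        (τ • fderiv ℝ (fun q => F q τ) p u - fderiv ℝ (fun q => F q τ) p v)) *
          (1 + polarSum α (e p) τ) := by
      simp only [hD, mul_sub, sub_mul, mul_smul_comm, smul_mul_assoc, mul_assoc] at h ⊢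
      linear_combination (norm := module) h
    have h3 : X τ = star (F p (conj τ)) * (F p τ * D τ) * (1 + polarSum (conj α) (d p) τ) := by
      rw [← mul_assoc, hFr p τ hτ.1, one_mul]
    rw [h3, h', hY, mul_assoc, mul_assoc, (hreal p).mul_eq_one h1 h2, mul_one]
  have hXlim : ∀ β ∈ U, (∀ᶠ z in 𝓝[≠] β, z ∈ U \ {α, conj α}) → HasLimitAt β X := fun β hβ hev =>
    (hYc.hasLimitAt hU hβ).congr' (hev.mono hXY)
  have hconst : ∀ z, z ≠ α → z ≠ conj α → X z = fderiv ℝ e p u 0 := by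
    intro z h1 h2
    refine eq_of_tendsto_cocompact_of_hasLimitAt (fun w a b => ?_)
      (hXlim α hαU (eventually_mem_diff_pair hU hα hαU))
      (hXlim _ (hconj α hαU) (eventually_mem_diff_pair_conj hU hα (hconj α hαU))) ?_ h1 h2
    · have := differentiableAt_polarSum (fderiv ℝ e p u) a
      have := differentiableAt_polarSum (fderiv ℝ e p v) a
      have := differentiableAt_one_add_polarSum (d p) b
      fun_prop
    · have := ((tendsto_smul_polarSum_cocompact α (fderiv ℝ e p u)).sub
        (tendsto_polarSum_cocompact α (fderiv ℝ e p v))).mul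
        (tendsto_one_add_polarSum_cocompact (conj α) (d p))
      simpa using this
  rw [hfd, hfd, he0]
  have hcp : ∀ x : Fin (k + 1) → Mat n, ContinuousOn (polarSum α x) {α}ᶜ := continuousOn_polarSum
  refine eq_of_continuousOn_of_eq_diff_pair (α := α) (U := {α}ᶜ) isOpen_compl_singleton
    (f := D) (g := fun τ => fderiv ℝ e p u 0 * (1 + polarSum α (e p) τ))
    ((continuousOn_id.smul (hcp _)).sub (hcp _))
    (continuousOn_const.mul (continuousOn_const.add (hcp _))) (fun z hz => ?_) hτ
  obtain ⟨h1, h2⟩ := ne_of_mem_diff_pair hz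
  rw [← hconst z h1 h2, hX, mul_assoc, (hreal p).mul_eq_one' h1 h2, mul_one]

/-- With F = (1 + P) ψ, the logarithmic derivative of F minus τ b is regular at α and ᾱ because F
is. Away from them it is rational in τ, because ψ cancels by reality. Liouville identifies it with
its value at infinity, which is read off from the residues of 1 + P and of its inverse. -/
theorem left_factor_system (hU : IsOpen U) (hconj : ∀ τ ∈ U, conj τ ∈ U) (hαU : α ∈ U)
    (hα : α.im ≠ 0) {e : Spacetime → Fin (k + 1) → Mat n} (hes : ContDiff ℝ ∞ e)
    {F ψ : Spacetime → ℂ → Mat n}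
    (hFs : ContDiffOn ℝ ∞ (fun q : Spacetime × ℂ => F q.1 q.2) (univ ×ˢ U))
    (hFr : ∀ p, ∀ τ ∈ U, star (F p (conj τ)) * F p τ = 1)
    (hψs : ContDiffOn ℝ ∞ (fun q : Spacetime × ℂ => ψ q.1 q.2) (univ ×ˢ (U \ {α, conj α})))
    (hψr : ∀ p, ∀ τ ∈ U \ {α, conj α}, star (ψ p (conj τ)) * ψ p τ = 1)
    (heq : ∀ p, ∀ τ ∈ U \ {α, conj α}, F p τ = (1 + polarSum (conj α) (e p) τ) * ψ p τ)
    {u v p : Spacetime} {b c : Mat n}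
    (hsys : ∀ τ ∈ U \ {α, conj α}, τ • fderiv ℝ (fun q => ψ q τ) p u -
      fderiv ℝ (fun q => ψ q τ) p v = (τ • b + c) * ψ p τ) {τ : ℂ} (hτ : τ ∈ U) :
    τ • fderiv ℝ (fun q => F q τ) p u - fderiv ℝ (fun q => F q τ) p v =
      (τ • b + (fderiv ℝ (fun q => e q 0) p u + e p 0 * b + b * star (e p 0) + c)) * F p τ := by
  have he0 : fderiv ℝ (fun q => e q 0) p u = fderiv ℝ e p u 0 := by
    have := ((ContinuousLinearMap.proj 0 : (Fin (k + 1) → Mat n) →L[ℝ] Mat n).hasFDerivAt.comp p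
      (hes.differentiable (by simp) p).hasFDerivAt).fderiv
    exact congrArg (fun A => A u) this
  have hfd : ∀ τ w, fderiv ℝ (fun q => 1 + polarSum (conj α) (e q) τ) p w =
      polarSum (conj α) (fderiv ℝ e p w) τ := fun τ w => fderiv_one_add_polarSum hes _ τ p w
  set es : Fin (k + 1) → Mat n := fun i => star (e p i) with hes'
  set D : ℂ → Mat n := fun τ =>
    τ • polarSum (conj α) (fderiv ℝ e p u) τ - polarSum (conj α) (fderiv ℝ e p v) τ with hD
  set X : ℂ → Mat n := fun τ => D τ * (1 + polarSum α es τ) +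
    (τ • polarSum (conj α) (e p) τ * b * (1 + polarSum α es τ) + b * (τ • polarSum α es τ)) +
      (1 + polarSum (conj α) (e p) τ) * c * (1 + polarSum α es τ) with hX
  have hFc : ContinuousOn (F p) U := continuousOn_slice hFs p
  have hFc' : ContinuousOn (fun τ => star (F p (conj τ))) U :=
    (hFc.comp Complex.continuous_conj.continuousOn hconj).star
  have hFd : ∀ w, ContinuousOn (fun τ => fderiv ℝ (fun q => F q τ) p w) U := fun w =>
    continuousOn_slice (ψ := fun p τ => fderiv ℝ (fun q => F q τ) p w)
      (contDiffOn_fderiv_slice hU hFs w) p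
  set DF : ℂ → Mat n := fun τ =>
    τ • fderiv ℝ (fun q => F q τ) p u - fderiv ℝ (fun q => F q τ) p v with hDF
  have hDFc : ContinuousOn DF U := (continuousOn_id.smul (hFd u)).sub (hFd v)
  have hYc : ContinuousOn (fun τ => DF τ * star (F p (conj τ)) - τ • b) U :=
    (hDFc.mul hFc').sub (by fun_prop)
  have hXY : ∀ τ ∈ U \ {α, conj α}, DF τ * star (F p (conj τ)) - τ • b = X τ := by
    intro τ hτ
    obtain ⟨h1, h2⟩ := ne_of_mem_diff_pair hτ
    have hτ' := conj_mem_diff_pair hconj hτ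
    have hF : (fun q => F q τ) = fun q => (1 + polarSum (conj α) (e q) τ) * ψ q τ :=
      funext fun q => heq q τ hτ
    have hdψ : DifferentiableAt ℝ (fun q => ψ q τ) p :=
      (contDiff_slice_of_contDiffOn hψs hτ).differentiable (by simp) p
    have hdg : DifferentiableAt ℝ (fun q => 1 + polarSum (conj α) (e q) τ) p :=
      (contDiff_slice_of_contDiffOn (ψ := fun q τ => 1 + polarSum (conj α) (e q) τ)
        (contDiffOn_one_add_polarSum hes _) h2).differentiable (by simp) p
    have h := hsys τ hτ
    have e1 : DF τ = (D τ + (1 + polarSum (conj α) (e p) τ) * (τ • b + c)) * ψ p τ := by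
      simp only [hDF, hF]
      rw [fderiv_mul_apply hdg hdψ, fderiv_mul_apply hdg hdψ, hfd, hfd, add_mul (D τ), mul_assoc _ _ (ψ p τ),
        ← h]
      simp only [hD, mul_sub, sub_mul, mul_smul_comm, smul_mul_assoc]
      module
    have e2 : star (F p (conj τ)) = star (ψ p (conj τ)) * (1 + polarSum α es τ) := by
      rw [heq p _ hτ', star_mul, star_one_add_polarSum]
    have e3 : ψ p τ * star (ψ p (conj τ)) = 1 := mul_eq_one_comm.mp (hψr p τ hτ)
    rw [e1, e2, mul_assoc, ← mul_assoc (ψ p τ), e3, one_mul]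
    simp only [hX, add_mul, mul_add, one_mul, mul_one, smul_mul_assoc, mul_smul_comm, mul_assoc]
    module
  have hXlim : ∀ β ∈ U, (∀ᶠ z in 𝓝[≠] β, z ∈ U \ {α, conj α}) → HasLimitAt β X := fun β hβ hev =>
    (hYc.hasLimitAt hU hβ).congr' (hev.mono hXY)
  set K := fderiv ℝ e p u 0 + e p 0 * b + b * star (e p 0) + c with hK
  have hconst : ∀ z, z ≠ α → z ≠ conj α → X z = K := by
    intro z h1 h2
    refine eq_of_tendsto_cocompact_of_hasLimitAt (fun w a b' => ?_)
      (hXlim α hαU (eventually_mem_diff_pair hU hα hαU))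
      (hXlim _ (hconj α hαU) (eventually_mem_diff_pair_conj hU hα (hconj α hαU))) ?_ h1 h2
    · have := differentiableAt_polarSum (fderiv ℝ e p u) b'
      have := differentiableAt_polarSum (fderiv ℝ e p v) b'
      have := differentiableAt_polarSum (e p) b'
      have := differentiableAt_polarSum es a
      fun_prop
    · have hg := tendsto_one_add_polarSum_cocompact α es
      have hH := tendsto_one_add_polarSum_cocompact (conj α) (e p)
      have := ((((tendsto_smul_polarSum_cocompact (conj α) (fderiv ℝ e p u)).sub
        (tendsto_polarSum_cocompact (conj α) (fderiv ℝ e p v))).mul hg).add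
        ((((tendsto_smul_polarSum_cocompact (conj α) (e p)).mul_const b).mul hg).add
          ((tendsto_smul_polarSum_cocompact α es).const_mul b))).add ((hH.mul_const c).mul hg)
      simpa [hX, hK, hes', hD, add_assoc] using this
  rw [he0]
  refine eq_of_continuousOn_of_eq_diff_pair (α := α) hU (f := DF)
    (g := fun τ => (τ • b + K) * F p τ) hDFc (ContinuousOn.mul (by fun_prop) hFc)
    (fun z hz => ?_) hτ
  obtain ⟨h1, h2⟩ := ne_of_mem_diff_pair hz
  have e4 := hXY z hz
  rw [hconst z h1 h2, sub_eq_iff_eq_add'] at e4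
  rw [← e4, mul_assoc, hFr p z hz.1, mul_one]

end FactorSystems

/-! ### Existence of the soliton subtraction. -/

section SolitonSubtraction

variable {n k : ℕ} {U Ω : Set ℂ} {α : ℂ} {ψ : Spacetime → ℂ → Mat n}

theorem HasDecayingSystem.fderiv_one {b₁ c₁ b₂ c₂ : Spacetime → Mat n}
    (h : HasDecayingSystem Ω ψ b₁ c₁ b₂ c₂) (p : Spacetime) {τ : ℂ} (hτ : τ ∈ Ω) :
    τ • fderiv ℝ (fun q => ψ q τ) p (0, 1, 0) - fderiv ℝ (fun q => ψ q τ) p (1, 0, 1) =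
      (τ • b₁ p + c₁ p) * ψ p τ := by
  have := h.eq_one p τ hτ
  rwa [dXi_eq_fderiv, dY_eq_fderiv] at this

theorem HasDecayingSystem.fderiv_two {b₁ c₁ b₂ c₂ : Spacetime → Mat n}
    (h : HasDecayingSystem Ω ψ b₁ c₁ b₂ c₂) (p : Spacetime) {τ : ℂ} (hτ : τ ∈ Ω) :
    τ • fderiv ℝ (fun q => ψ q τ) p (-1, 0, 1) - fderiv ℝ (fun q => ψ q τ) p (0, 1, 0) =
      (τ • b₂ p + c₂ p) * ψ p τ := by
  have := h.eq_two p τ hτ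
  rwa [dEta_eq_fderiv, dY_eq_fderiv] at this

theorem IsAsympConst.apply {d : Spacetime → Fin k → Mat n} {d₀ : Fin k → Mat n}
    (hd : IsAsympConst d d₀) (i : Fin k) : IsAsympConst (fun p => d p i) (d₀ i) :=
  hd.clm (ContinuousLinearMap.proj i : (Fin k → Mat n) →L[ℝ] Mat n)

theorem IsAsympConst.star {f : Spacetime → Mat n} {L : Mat n} (hf : IsAsympConst f L) :
    IsAsympConst (fun p => star (f p)) (star L) :=
  hf.clm ((starL' ℝ : Mat n ≃L[ℝ] Mat n) : Mat n →L[ℝ] Mat n)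

theorem isNormalizedFrame_of_hasDecayingSystem (hΩ : IsOpen Ω) (hne : Ω.Nonempty)
    (hconj : ∀ τ ∈ Ω, conj τ ∈ Ω)
    (hs : ContDiffOn ℝ ∞ (fun q : Spacetime × ℂ => ψ q.1 q.2) (univ ×ˢ Ω))
    (hd : ∀ p, DifferentiableOn ℂ (ψ p) Ω)
    (hreal : ∀ p, ∀ τ ∈ Ω, star (ψ p (conj τ)) * ψ p τ = 1) {b₁ c₁ b₂ c₂ : Spacetime → Mat n}
    (hsys : HasDecayingSystem Ω ψ b₁ c₁ b₂ c₂) {h : ℂ → Mat n}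
    (hlim : ∀ t : ℝ, TendstoLocallyUniformlyOn (fun (q : ℝ × ℝ) (τ : ℂ) => ψ (q.1, q.2, t) τ) h
      (cocompact (ℝ × ℝ)) Ω) : IsNormalizedFrame Ω ψ :=
  ⟨hs, hd, hsys.exists_isMonopole hΩ hne hconj hs hreal, hreal, h, hlim⟩

theorem compl_pair_eq : ({α, conj α} : Set ℂ)ᶜ = univ \ {α, conj α} := compl_eq_univ_sdiff _

/-- The soliton factor is a soliton frame and a normalized frame. -/
theorem isSolitonFrame_of_factor (hU : IsOpen U) (hconj : ∀ τ ∈ U, conj τ ∈ U) (hαU : α ∈ U)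
    (hα : α.im ≠ 0) {b₁ c₁ b₂ c₂ : Spacetime → Mat n}
    (hsys : HasDecayingSystem (U \ {α, conj α}) ψ b₁ c₁ b₂ c₂)
    {d : Spacetime → Fin (k + 1) → Mat n} {d₀ : Fin (k + 1) → Mat n} (hd : IsAsympConst d d₀)
    (hreal : ∀ p, IsRealFactor α (d p)) (hlast : ∃ p, d p (Fin.last k) ≠ 0)
    {F : Spacetime → ℂ → Mat n}
    (hFs : ContDiffOn ℝ ∞ (fun q : Spacetime × ℂ => F q.1 q.2) (univ ×ˢ U))
    (hFr : ∀ p, ∀ τ ∈ U, star (F p (conj τ)) * F p τ = 1)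
    (heq : ∀ p, ∀ τ ∈ U \ {α, conj α},
      ψ p τ = F p τ * (1 + polarSum α (fun i => star (d p i)) τ)) :
    IsSolitonFrame α (k + 1) (fun p τ => 1 + polarSum α (fun i => star (d p i)) τ) ∧
      IsNormalizedFrame ({α, conj α}ᶜ) (fun p τ => 1 + polarSum α (fun i => star (d p i)) τ) := by
  set g : Spacetime → ℂ → Mat n := fun p τ => 1 + polarSum α (fun i => star (d p i)) τ with hg
  have he : IsAsympConst (fun q i => star (d q i)) (fun i => star (d₀ i)) :=
    isAsympConst_pi fun i => (hd.apply i).star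
  have hP : ∀ v, IsAsympConst (fun p => fderiv ℝ (fun q => star (d q 0)) p v) 0 := fun v =>
    (hd.apply 0).star.fderiv_apply v
  have e1 : ∀ p τ, τ ≠ α → τ • dY (fun q => g q τ) p - dXi (fun q => g q τ) p =
      fderiv ℝ (fun q => star (d q 0)) p (0, 1, 0) * g p τ := by
    intro p τ hτ
    rw [dXi_eq_fderiv, dY_eq_fderiv]
    exact soliton_system hU hconj hαU hα hd.smooth hreal hFs hFr heq
      (fun τ hτ => hsys.fderiv_one p hτ) hτ
  have e2 : ∀ p τ, τ ≠ α → τ • dEta (fun q => g q τ) p - dY (fun q => g q τ) p =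
      fderiv ℝ (fun q => star (d q 0)) p (-1, 0, 1) * g p τ := by
    intro p τ hτ
    rw [dEta_eq_fderiv, dY_eq_fderiv]
    exact soliton_system hU hconj hαU hα hd.smooth hreal hFs hFr heq
      (fun τ hτ => hsys.fderiv_two p hτ) hτ
  refine ⟨⟨hasPoleData_of_isRealFactor hd.smooth hreal hlast, _, _,
    (isAsympConst_zero_iff_decaysSpatially (hP (0, 1, 0)).smooth).mp (hP _),
    (isAsympConst_zero_iff_decaysSpatially (hP (-1, 0, 1)).smooth).mp (hP _),
    fun p τ hτ => ⟨e1 p τ hτ, e2 p τ hτ⟩⟩, ?_⟩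
  have hsub : ({α, conj α} : Set ℂ)ᶜ ⊆ {α}ᶜ := compl_subset_compl.mpr (by simp)
  have hmem : ∀ τ ∈ ({α, conj α} : Set ℂ)ᶜ, τ ≠ α ∧ τ ≠ conj α := fun τ hτ => by
    rw [compl_pair_eq] at hτ
    exact ne_of_mem_diff_pair hτ
  -- The logarithmic derivatives of g are independent of τ, so the coefficients of τ in its linear
  -- system are zero.
  have hsys' : HasDecayingSystem ({α, conj α}ᶜ) g (fun _ => 0) _ (fun _ => 0) _ :=
    ⟨⟨⟨isAsympConst_const 0, hP (0, 1, 0)⟩, isAsympConst_const 0, hP (-1, 0, 1)⟩,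
      fun p τ hτ => by rw [smul_zero, zero_add]; exact e1 p τ (hmem τ hτ).1,
      fun p τ hτ => by rw [smul_zero, zero_add]; exact e2 p τ (hmem τ hτ).1⟩
  refine isNormalizedFrame_of_hasDecayingSystem (by
    rw [compl_pair_eq]; exact isOpen_diff_pair isOpen_univ) ⟨0, ?_⟩ (fun τ hτ => ?_)
    ((contDiffOn_one_add_polarSum he.smooth α).mono (prod_mono subset_rfl hsub))
    (fun p τ hτ => (differentiableAt_one_add_polarSum _ (hmem τ hτ).1).differentiableWithinAt)
    (fun p τ hτ => (hreal p).reality (hmem τ hτ).1 (hmem τ hτ).2) hsys'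
    (fun t => (tendstoLocallyUniformlyOn_one_add_polarSum α (he.tendsto t)).mono hsub)
  · simp only [mem_compl_iff, mem_insert_iff, mem_singleton_iff, not_or]
    refine ⟨?_, ?_⟩
    · rintro rfl; simp at hα
    · intro h
      have := congrArg Complex.im h
      simp at this
      exact hα this
  · rw [compl_pair_eq] at hτ ⊢
    exact conj_mem_diff_pair (fun _ _ => mem_univ _) hτ

/-- If the last coefficient vanished, the regular outer factors could not restore a pole of order k
+ 1, contradicting L ≠ 0. This carries the exact multiplicity over to both rational factors. -/
theorem ne_zero_of_hasPole (hα : α.im ≠ 0) (hU : IsOpen U) (hαU : α ∈ U) {f : ℂ → Mat n}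
    {d : Fin (k + 1) → Mat n} {L : Mat n} (hL : L ≠ 0)
    (hlim : Tendsto (fun τ => (τ - α) ^ (k + 1) • f τ) (𝓝[≠] α) (𝓝 L)) {A B : ℂ → Mat n}
    (hA : ContinuousAt A α) (hB : ContinuousAt B α)
    (heq : ∀ τ ∈ U \ {α, conj α}, f τ = A τ * (1 + polarSum α d τ) * B τ) :
    d (Fin.last k) ≠ 0 := by
  intro h0
  have h1 := ((hA.tendsto.mono_left nhdsWithin_le_nhds).mul
    (tendsto_pow_smul_one_add_polarSum α d)).mul (hB.tendsto.mono_left nhdsWithin_le_nhds)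
  rw [h0, mul_zero, zero_mul] at h1
  refine hL (tendsto_nhds_unique (hlim.congr' ?_) h1)
  filter_upwards [eventually_mem_diff_pair hU hα hαU] with τ hτ
  rw [heq τ hτ]
  simp only [smul_mul_assoc, mul_smul_comm]

/-- The right factor comes from the contour family of ψ and the left one from its transpose.
Multiplying ψ by them gives regular F and N, and reality inverts the factors, moving their pole from
ᾱ to α. N, with the rational factor on its left, satisfies a linear system in τ and is the
normalized frame; for F only regularity is needed. -/
theorem exists_isSolitonSubtraction (hU : IsOpen U) (hconj : ∀ τ ∈ U, conj τ ∈ U) (hαU : α ∈ U)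
    (hα : α.im ≠ 0) (hk : 1 ≤ k) (hψ : IsNormalizedFrame (U \ {α, conj α}) ψ)
    (hpole : HasPole α k ψ) (hno : HasNoPole (conj α) ψ) :
    ∃ g ψt gt ψ₁ : Spacetime → ℂ → Mat n, IsSolitonSubtraction U α k ψ g ψt gt ψ₁ ∧
      IsNormalizedFrame ({α, conj α}ᶜ) g ∧
      ContDiffOn ℝ ∞ (fun q : Spacetime × ℂ => ψt q.1 q.2) (univ ×ˢ U) := by
  obtain ⟨m, rfl⟩ : ∃ m, k = m + 1 := ⟨k - 1, by omega⟩
  have hαU' := hconj α hαU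
  obtain ⟨r, h, H, hlim⟩ := hψ.exists_isContourFamily hU hconj hαU hα hpole.1 hno
  obtain ⟨M, hM, hMsys⟩ := hψ.linear_system
  have hsys := hM.hasDecayingSystem hMsys
  obtain ⟨d, d₀, hd, hfac⟩ := H.exists_factor hα
  obtain ⟨e', e₀', he', hfac'⟩ := H.transpose.exists_factor hα
  set e : Spacetime → Fin (m + 1) → Mat n := fun p i => (e' p i)ᵀ with he_def
  have he : IsAsympConst e (fun i => (e₀' i)ᵀ) := isAsympConst_pi fun i =>
    (he'.apply i).clm ((transposeCLM n).restrictScalars ℝ)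
  have hdr : ∀ p, IsRealFactor α (d p) := fun p => (hfac p).2.2
  have her : ∀ p, IsRealFactor α (e p) := fun p => IsRealFactor.transpose (hfac' p).2.2
  have hVsub : U \ {α, conj α} ⊆ {conj α}ᶜ := fun τ hτ => (ne_of_mem_diff_pair hτ).2
  have hpd : ∀ (x : Spacetime → Fin (m + 1) → Mat n) p, DifferentiableOn ℂ
      (fun τ => 1 + polarSum (conj α) (x p) τ) (U \ {α, conj α}) := fun x p τ hτ =>
    (differentiableAt_one_add_polarSum _ (hVsub hτ)).differentiableWithinAt
  obtain ⟨F, hFeq, hFs, hFd, hFr⟩ := exists_regular_extension hU hconj hαU hα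
    (f := fun p τ => ψ p τ * (1 + polarSum (conj α) (d p) τ))
    (hψ.smooth.mul ((contDiffOn_one_add_polarSum hd.smooth _).mono (prod_mono subset_rfl hVsub)))
    (fun p => (hψ.holomorphic p).mul (hpd d p)) (fun p => (hfac p).1) (fun p => (hfac p).2.1)
    (fun p τ hτ => by
      obtain ⟨h1, h2⟩ := ne_of_mem_diff_pair hτ
      rw [star_mul, mul_assoc, ← mul_assoc (star (ψ p (conj τ))), hψ.reality p τ hτ, one_mul]
      exact hdr p τ h1 h2)
  have hlimT : ∀ β, (∀ p, HasLimitAt β (fun z => (ψ p z)ᵀ * (1 + polarSum (conj α) (e' p) z))) →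
      ∀ p, HasLimitAt β (fun z => (1 + polarSum (conj α) (e p) z) * ψ p z) := by
    intro β hβ p
    refine (hβ p).transpose.congr' (Eventually.of_forall fun z => ?_)
    simp [polarSum, he_def, Matrix.transpose_sum]
  obtain ⟨N, hNeq, hNs, hNd, hNr⟩ := exists_regular_extension hU hconj hαU hα
    (f := fun p τ => (1 + polarSum (conj α) (e p) τ) * ψ p τ)
    (((contDiffOn_one_add_polarSum he.smooth _).mono (prod_mono subset_rfl hVsub)).mul hψ.smooth)
    (fun p => (hpd e p).mul (hψ.holomorphic p)) (hlimT _ fun p => (hfac' p).1)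
    (hlimT _ fun p => (hfac' p).2.1)
    (fun p τ hτ => by
      obtain ⟨h1, h2⟩ := ne_of_mem_diff_pair hτ
      rw [star_mul, mul_assoc, ← mul_assoc (star (1 + _)), her p τ h1 h2, one_mul]
      exact hψ.reality p τ hτ)
  have hleft : ∀ p, ∀ τ ∈ U \ {α, conj α},
      ψ p τ = F p τ * (1 + polarSum α (fun i => star (d p i)) τ) := by
    intro p τ hτ
    obtain ⟨h1, h2⟩ := ne_of_mem_diff_pair hτ
    rw [hFeq p τ h1 h2, mul_assoc, (hdr p).mul_eq_one' h1 h2, mul_one]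
  have hNV : ∀ p, ∀ τ ∈ U \ {α, conj α},
      N p τ = (1 + polarSum (conj α) (e p) τ) * ψ p τ := fun p τ hτ =>
    hNeq p τ (ne_of_mem_diff_pair hτ).1 (ne_of_mem_diff_pair hτ).2
  have hright : ∀ p, ∀ τ ∈ U \ {α, conj α},
      ψ p τ = (1 + polarSum α (fun i => star (e p i)) τ) * N p τ := by
    intro p τ hτ
    obtain ⟨h1, h2⟩ := ne_of_mem_diff_pair hτ
    rw [hNV p τ hτ, ← mul_assoc, (her p).mul_eq_one h1 h2, one_mul]
  obtain ⟨p₀, L, hL, hLlim⟩ := hpole.2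
  have hdl : ∃ p, d p (Fin.last m) ≠ 0 := by
    refine ⟨p₀, fun h0 => ne_zero_of_hasPole hα hU hαU hL hLlim (A := F p₀) (B := fun _ => 1)
      ((hFd p₀).continuousOn.continuousAt (hU.mem_nhds hαU)) continuousAt_const
      (fun τ hτ => by rw [mul_one]; exact hleft p₀ τ hτ) ?_⟩
    simp [h0]
  have hel : ∃ p, e p (Fin.last m) ≠ 0 := by
    refine ⟨p₀, fun h0 => ne_zero_of_hasPole hα hU hαU hL hLlim (A := fun _ => 1) (B := N p₀)
      continuousAt_const ((hNd p₀).continuousOn.continuousAt (hU.mem_nhds hαU))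
      (fun τ hτ => by rw [one_mul]; exact hright p₀ τ hτ) ?_⟩
    simp [h0]
  obtain ⟨hsol, hgn⟩ := isSolitonFrame_of_factor hU hconj hαU hα hsys hd hdr hdl hFs hFr hleft
  refine ⟨_, F, _, N, ⟨hsol, hasPoleData_of_isRealFactor he.smooth her hel, ?_,
    ⟨isRegularAt_of_reality hU hNd hNr hαU, isRegularAt_of_reality hU hNd hNr hαU'⟩,
    ⟨isRegularAt_of_reality hU hFd hFr hαU, isRegularAt_of_reality hU hFd hFr hαU'⟩,
    hleft, hright⟩, hgn, hFs⟩
  obtain ⟨⟨hb₁, hc₁⟩, hb₂, hc₂⟩ := hsys.decay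
  -- Every term contains a decaying coefficient or a derivative of the asymptotically constant
  -- residue.
  have hcoef : ∀ {b c : Spacetime → Mat n}, IsAsympConst b 0 → IsAsympConst c 0 → ∀ u,
      IsAsympConst (fun p => fderiv ℝ (fun q => e q 0) p u + e p 0 * b p +
        b p * star (e p 0) + c p) 0 := fun hb hc u => by
    simpa using ((((he.apply 0).fderiv_apply u).add ((he.apply 0).mul hb)).add
      (hb.mul (he.apply 0).star)).add hc
  have hNsys : HasDecayingSystem U N _ _ _ _ :=
    ⟨⟨⟨hb₁, hcoef hb₁ hc₁ (0, 1, 0)⟩, hb₂, hcoef hb₂ hc₂ (-1, 0, 1)⟩, fun p τ hτ => by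
      rw [dXi_eq_fderiv, dY_eq_fderiv]
      exact left_factor_system hU hconj hαU hα he.smooth hNs hNr hψ.smooth hψ.reality hNV
        (fun τ hτ => hsys.fderiv_one p hτ) hτ, fun p τ hτ => by
      rw [dEta_eq_fderiv, dY_eq_fderiv]
      exact left_factor_system hU hconj hαU hα he.smooth hNs hNr hψ.smooth hψ.reality hNV
        (fun τ hτ => hsys.fderiv_two p hτ) hτ⟩
  -- The limit of N is known away from α and ᾱ as the product of the limits. The maximum principle
  -- extends the locally uniform convergence over each of the two points in turn.
  refine isNormalizedFrame_of_hasDecayingSystem hU ⟨α, hαU⟩ hconj hNs hNd hNr hNsys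
    (h := regularize (conj α) (regularize α
      (fun τ => (1 + polarSum (conj α) (fun i => (e₀' i)ᵀ) τ) * h τ))) fun t => ?_
  have hW : IsOpen (U \ {conj α}) := hU.sdiff isClosed_singleton
  have hWV : (U \ {conj α}) \ {α} = U \ {α, conj α} := by
    rw [sdiff_sdiff, union_comm]
    rfl
  have hhc : ContinuousOn h (U \ {α, conj α}) :=
    ((hlim t).differentiableOn (Eventually.of_forall fun _ => hψ.holomorphic _)
      (isOpen_diff_pair hU)).continuousOn
  have l1 : TendstoLocallyUniformlyOn (fun (q : ℝ × ℝ) τ => N (q.1, q.2, t) τ)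
      (fun τ => (1 + polarSum (conj α) (fun i => (e₀' i)ᵀ) τ) * h τ) (cocompact (ℝ × ℝ))
      (U \ {α, conj α}) := by
    have := ((tendstoLocallyUniformlyOn_one_add_polarSum (conj α) (he.tendsto t)).mono hVsub).mul₀
      (hlim t) (fun τ hτ => (differentiableAt_one_add_polarSum _
        (hVsub hτ)).continuousAt.continuousWithinAt) hhc
    exact this.congr fun q τ hτ => (hNV _ τ hτ).symm
  rw [← hWV] at l1
  exact (tendstoLocallyUniformlyOn_regularize hU hαU' (fun q => hNd _)
    (tendstoLocallyUniformlyOn_regularize hW ⟨hαU, ne_conj_of_im_ne_zero hα⟩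
      (fun q => (hNd _).mono sdiff_subset) l1).2).2

end SolitonSubtraction

/-! ### Uniqueness of the factors. -/

section Uniqueness

variable {n k : ℕ} {U : Set ℂ} {α : ℂ}

theorem HasPoleData.exists_polarSum {f : Spacetime → ℂ → Mat n} (hf : HasPoleData α k f)
    (p : Spacetime) : ∃ c : Fin k → Mat n, ∀ τ, τ ≠ α → f p τ = 1 + polarSum α c τ := by
  obtain ⟨c, -, -, hc⟩ := hf.rational
  exact ⟨fun i => c (i.val + 1) p, fun τ hτ => by
    rw [hc p τ hτ, polarSum_eq_sum_Icc α (fun j => c j p)]⟩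

theorem conj_ne_of_ne {β z : ℂ} (h : z ≠ conj β) : conj z ≠ β := fun h' =>
  h (by rw [← h', Complex.conj_conj])

theorem HasPoleData.differentiableAt {f : Spacetime → ℂ → Mat n} (hf : HasPoleData α k f)
    (p : Spacetime) {z : ℂ} (hz : z ≠ α) : DifferentiableAt ℂ (f p) z := by
  obtain ⟨c, hc⟩ := hf.exists_polarSum p
  refine (differentiableAt_one_add_polarSum c hz).congr_of_eventuallyEq ?_
  filter_upwards [isOpen_ne.mem_nhds hz] with w hw using hc w hw

theorem HasPoleData.tendsto {f : Spacetime → ℂ → Mat n} (hf : HasPoleData α k f)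
    (p : Spacetime) : Tendsto (f p) (cocompact ℂ) (𝓝 1) := by
  obtain ⟨c, hc⟩ := hf.exists_polarSum p
  refine (tendsto_one_add_polarSum_cocompact α c).congr' ?_
  have : ∀ᶠ z in cocompact ℂ, z ≠ α := (finite_singleton α).isCompact.compl_mem_cocompact
  filter_upwards [this] with z hz using (hc z hz).symm

/-- The inverse `star (f (conj z))` of a function with pole data. -/
theorem HasPoleData.exists_polarSum_star {f : Spacetime → ℂ → Mat n} (hf : HasPoleData α k f)
    (p : Spacetime) : ∃ c : Fin k → Mat n, ∀ τ, τ ≠ conj α →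
      star (f p (conj τ)) = 1 + polarSum (conj α) c τ := by
  obtain ⟨c, hc⟩ := hf.exists_polarSum p
  refine ⟨fun i => star (c i), fun τ hτ => ?_⟩
  rw [hc _ (conj_ne_of_ne hτ), star_add, star_one, star_polarSum]

theorem HasPoleData.differentiableAt_star {f : Spacetime → ℂ → Mat n} (hf : HasPoleData α k f)
    (p : Spacetime) {z : ℂ} (hz : z ≠ conj α) :
    DifferentiableAt ℂ (fun z => star (f p (conj z))) z := by
  obtain ⟨c, hc⟩ := hf.exists_polarSum_star p
  refine (differentiableAt_one_add_polarSum c hz).congr_of_eventuallyEq ?_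
  filter_upwards [isOpen_ne.mem_nhds hz] with w hw using hc w hw

theorem HasPoleData.tendsto_star {f : Spacetime → ℂ → Mat n} (hf : HasPoleData α k f)
    (p : Spacetime) : Tendsto (fun z => star (f p (conj z))) (cocompact ℂ) (𝓝 1) := by
  obtain ⟨c, hc⟩ := hf.exists_polarSum_star p
  refine (tendsto_one_add_polarSum_cocompact (conj α) c).congr' ?_
  have : ∀ᶠ z in cocompact ℂ, z ≠ conj α := (finite_singleton _).isCompact.compl_mem_cocompact
  filter_upwards [this] with z hz using (hc z hz).symm

theorem HasPoleData.eq_of_eq {f f' : Spacetime → ℂ → Mat n}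
    (hf : HasPoleData α k f) (hf' : HasPoleData α k f') {p : Spacetime}
    (h : ∀ z, z ≠ α → z ≠ conj α → f' p z = f p z) {τ : ℂ} (hτ : τ ≠ α) : f' p τ = f p τ :=
  eq_of_continuousOn_of_eq_diff_pair (α := α) (U := {α}ᶜ) isOpen_compl_singleton
    (fun _ hz => (hf'.differentiableAt p hz).continuousAt.continuousWithinAt)
    (fun _ hz => (hf.differentiableAt p hz).continuousAt.continuousWithinAt)
    (fun z hz => h z (ne_of_mem_diff_pair hz).1 (ne_of_mem_diff_pair hz).2) hτ

/-- The tested function is f' f⁻¹, by reality. It tends to 1 at infinity, so Liouville makes it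
identically 1. -/
theorem HasPoleData.eq_of_hasLimitAt_mul_star {f f' : Spacetime → ℂ → Mat n}
    (hf : HasPoleData α k f) (hf' : HasPoleData α k f') {p : Spacetime}
    (h1 : HasLimitAt α (fun z => f' p z * star (f p (conj z))))
    (h2 : HasLimitAt (conj α) (fun z => f' p z * star (f p (conj z)))) {τ : ℂ} (hτ : τ ≠ α) :
    f' p τ = f p τ := by
  refine hf.eq_of_eq hf' (fun z a b => ?_) hτ
  have h := eq_of_tendsto_cocompact_of_hasLimitAt (c := 1)
    (fun w a b => (hf'.differentiableAt p a).fun_mul (hf.differentiableAt_star p b)) h1 h2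
    (by simpa using (hf'.tendsto p).mul (hf.tendsto_star p)) a b
  calc f' p z = f' p z * (star (f p (conj z)) * f p z) := by rw [hf.reality p z a b, mul_one]
    _ = f p z := by rw [← mul_assoc, h, one_mul]

theorem HasPoleData.eq_of_hasLimitAt_star_mul {f f' : Spacetime → ℂ → Mat n}
    (hf : HasPoleData α k f) (hf' : HasPoleData α k f') {p : Spacetime}
    (h1 : HasLimitAt α (fun z => star (f p (conj z)) * f' p z))
    (h2 : HasLimitAt (conj α) (fun z => star (f p (conj z)) * f' p z)) {τ : ℂ} (hτ : τ ≠ α) :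
    f' p τ = f p τ := by
  refine hf.eq_of_eq hf' (fun z a b => ?_) hτ
  have h := eq_of_tendsto_cocompact_of_hasLimitAt (c := 1)
    (fun w a b => (hf.differentiableAt_star p b).fun_mul (hf'.differentiableAt p a)) h1 h2
    (by simpa using (hf.tendsto_star p).mul (hf'.tendsto p)) a b
  calc f' p z = (f p z * star (f p (conj z))) * f' p z := by
        rw [mul_eq_one_comm.mp (hf.reality p z a b), one_mul]
    _ = f p z := by rw [mul_assoc, h, mul_one]

theorem hasLimitAt_inverse {β : ℂ} {A : ℂ → Mat n} (hA : ContinuousAt A β) (hu : IsUnit (A β)) :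
    HasLimitAt β (fun z => Ring.inverse (A z)) := by
  obtain ⟨u, hu⟩ := hu
  have h := NormedRing.inverse_continuousAt u
  rw [hu] at h
  exact ContinuousAt.hasLimitAt (ContinuousAt.comp (g := Ring.inverse) h hA)

theorem IsRegularAt.continuousAt {β : ℂ} {f : Spacetime → ℂ → Mat n} (h : IsRegularAt β f)
    (p : Spacetime) : ContinuousAt (f p) β := (h p).1.continuousAt

theorem IsRegularAt.eventually_isUnit {β : ℂ} {f : Spacetime → ℂ → Mat n} (h : IsRegularAt β f)
    (p : Spacetime) : ∀ᶠ z in 𝓝[≠] β, IsUnit (f p z) :=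
  ((h.continuousAt p).eventually (Units.isOpen.mem_nhds (h p).2)).filter_mono nhdsWithin_le_nhds

theorem eq_of_eventually_eq {β : ℂ} {f g : ℂ → Mat n} (hf : ContinuousAt f β)
    (hg : ContinuousAt g β) (h : ∀ᶠ z in 𝓝[≠] β, f z = g z) : f β = g β :=
  tendsto_nhds_unique ((hf.tendsto.mono_left nhdsWithin_le_nhds).congr' h)
    (hg.tendsto.mono_left nhdsWithin_le_nhds)

/-- Equating the two factorizations gives g' g⁻¹ = ψt'⁻¹ ψt and gt⁻¹ gt' = ψ₁ ψ₁'⁻¹, whose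
right-hand sides are regular at α and ᾱ. Liouville identifies the rational factors. The regular
factors then agree off the two points, and by continuity at them. -/
theorem IsSolitonSubtraction.unique (hU : IsOpen U) (hconj : ∀ τ ∈ U, conj τ ∈ U) (hαU : α ∈ U)
    (hα : α.im ≠ 0) {ψ g ψt gt ψ₁ g' ψt' gt' ψ₁' : Spacetime → ℂ → Mat n}
    (H : IsSolitonSubtraction U α k ψ g ψt gt ψ₁)
    (H' : IsSolitonSubtraction U α k ψ g' ψt' gt' ψ₁') :
    (∀ p τ, τ ≠ α → g' p τ = g p τ) ∧ (∀ p τ, τ ≠ α → gt' p τ = gt p τ) ∧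
      ∀ p, ∀ τ ∈ U, ψt' p τ = ψt p τ ∧ ψ₁' p τ = ψ₁ p τ := by
  have ev1 := eventually_mem_diff_pair hU hα hαU
  have ev2 := eventually_mem_diff_pair_conj hU hα (hconj α hαU)
  have hg : ∀ p τ, τ ≠ α → g' p τ = g p τ := by
    intro p τ hτ
    have key : ∀ β, IsRegularAt β ψt → IsRegularAt β ψt' →
        (∀ᶠ z in 𝓝[≠] β, z ∈ U \ {α, conj α}) →
        HasLimitAt β (fun z => g' p z * star (g p (conj z))) := by
      intro β h1 h2 hev
      refine ((hasLimitAt_inverse (h2.continuousAt p) (h2 p).2).mul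
        (h1.continuousAt p).hasLimitAt).congr' ?_
      filter_upwards [hev, h2.eventually_isUnit p] with z hz hu
      obtain ⟨a, b⟩ := ne_of_mem_diff_pair hz
      have e := (H.eq_left p z hz).symm.trans (H'.eq_left p z hz)
      have e2 := mul_eq_one_comm.mp (H.soliton.pole_data.reality p z a b)
      calc Ring.inverse (ψt' p z) * ψt p z
          = Ring.inverse (ψt' p z) * (ψt p z * g p z) * star (g p (conj z)) := by
            rw [mul_assoc, mul_assoc, e2, mul_one]
        _ = g' p z * star (g p (conj z)) := by
            rw [e, ← mul_assoc, Ring.inverse_mul_cancel _ hu, one_mul]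
    exact H.soliton.pole_data.eq_of_hasLimitAt_mul_star H'.soliton.pole_data
      (key α H.regular_left.1 H'.regular_left.1 ev1)
      (key _ H.regular_left.2 H'.regular_left.2 ev2) hτ
  have hgt : ∀ p τ, τ ≠ α → gt' p τ = gt p τ := by
    intro p τ hτ
    have key : ∀ β, IsRegularAt β ψ₁ → IsRegularAt β ψ₁' →
        (∀ᶠ z in 𝓝[≠] β, z ∈ U \ {α, conj α}) →
        HasLimitAt β (fun z => star (gt p (conj z)) * gt' p z) := by
      intro β h1 h2 hev
      refine ((h1.continuousAt p).hasLimitAt.mul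
        (hasLimitAt_inverse (h2.continuousAt p) (h2 p).2)).congr' ?_
      filter_upwards [hev, h2.eventually_isUnit p] with z hz hu
      obtain ⟨a, b⟩ := ne_of_mem_diff_pair hz
      have e := (H.eq_right p z hz).symm.trans (H'.eq_right p z hz)
      have e2 := H.pole_data.reality p z a b
      calc ψ₁ p z * Ring.inverse (ψ₁' p z)
          = star (gt p (conj z)) * (gt p z * ψ₁ p z) * Ring.inverse (ψ₁' p z) := by
            rw [← mul_assoc (star _), e2, one_mul]
        _ = star (gt p (conj z)) * gt' p z := by
            rw [e, mul_assoc, mul_assoc, Ring.mul_inverse_cancel _ hu, mul_one]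
    exact H.pole_data.eq_of_hasLimitAt_star_mul H'.pole_data
      (key α H.regular_right.1 H'.regular_right.1 ev1)
      (key _ H.regular_right.2 H'.regular_right.2 ev2) hτ
  refine ⟨hg, hgt, fun p τ hτ => ?_⟩
  have hV : ∀ z ∈ U \ {α, conj α}, ψt' p z = ψt p z ∧ ψ₁' p z = ψ₁ p z := by
    intro z hz
    obtain ⟨a, b⟩ := ne_of_mem_diff_pair hz
    constructor
    · have e := (H'.eq_left p z hz).symm.trans (H.eq_left p z hz)
      rw [hg p z a] at e
      exact (isUnit_of_reality (H.soliton.pole_data.reality p z a b)).mul_right_cancel e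
    · have e := (H'.eq_right p z hz).symm.trans (H.eq_right p z hz)
      rw [hgt p z a] at e
      exact (isUnit_of_reality (H.pole_data.reality p z a b)).mul_left_cancel e
  by_cases h1 : τ = α
  · subst h1
    exact ⟨eq_of_eventually_eq (H'.regular_left.1.continuousAt p) (H.regular_left.1.continuousAt p)
      (ev1.mono fun z hz => (hV z hz).1),
      eq_of_eventually_eq (H'.regular_right.1.continuousAt p) (H.regular_right.1.continuousAt p)
      (ev1.mono fun z hz => (hV z hz).2)⟩
  by_cases h2 : τ = conj α
  · subst h2
    exact ⟨eq_of_eventually_eq (H'.regular_left.2.continuousAt p) (H.regular_left.2.continuousAt p)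
      (ev2.mono fun z hz => (hV z hz).1),
      eq_of_eventually_eq (H'.regular_right.2.continuousAt p) (H.regular_right.2.continuousAt p)
      (ev2.mono fun z hz => (hV z hz).2)⟩
  · exact hV τ ⟨hτ, fun h => h.elim h1 h2⟩

end Uniqueness

/-! ### Uniform difference quotients and boundary limits. -/

section BoundaryDerivatives

variable {E F : Type} [NormedAddCommGroup E] [NormedSpace ℝ E]

/-- Difference quotients converge to the directional derivative, uniformly in a compact
parameter. -/
theorem eventually_norm_difference_quotient_sub_le [NormedAddCommGroup F] [NormedSpace ℝ F]
    {G : E → ℝ → F}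
    (hG : ContDiff ℝ ∞ (fun q : E × ℝ => G q.1 q.2)) (p v : E) (a b : ℝ) {ε : ℝ} (hε : 0 < ε) :
    ∀ᶠ h : ℝ in 𝓝[≠] 0, ∀ θ ∈ Icc a b,
      ‖h⁻¹ • (G (p + h • v) θ - G p θ) - fderiv ℝ (fun q => G q θ) p v‖ ≤ ε := by
  have hGd : ∀ q θ, HasFDerivAt (fun q => G q θ) ((fderiv ℝ (fun q : E × ℝ => G q.1 q.2)
      (q, θ)).comp (.inl ℝ E ℝ)) q := by
    intro q θ
    have h1 : DifferentiableAt ℝ (fun q : E × ℝ => G q.1 q.2) (q, θ) :=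
      hG.differentiable (by simp) (q, θ)
    have h2 : HasFDerivAt (fun q : E => (q, θ)) (.inl ℝ E ℝ) q := hasFDerivAt_prodMk_left q θ
    exact h1.hasFDerivAt.comp q h2
  set g : ℝ × ℝ → F := fun x => fderiv ℝ (fun q => G q x.2) (p + x.1 • v) v with hg
  have hgc : Continuous g := by
    have h1 : Continuous (fun x : ℝ × ℝ => fderiv ℝ (fun q : E × ℝ => G q.1 q.2)
        (p + x.1 • v, x.2) (v, 0)) :=
      (((hG.continuous_fderiv (by simp)).comp (by fun_prop)).clm_apply continuous_const)
    refine h1.congr fun x => ?_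
    rw [hg]
    simp only
    rw [(hGd _ _).fderiv]
    simp
  have hu := (isCompact_Icc (a := (-1 : ℝ)) (b := 1)).prod (isCompact_Icc (a := a) (b := b)) |>.uniformContinuousOn_of_continuous hgc.continuousOn
  obtain ⟨δ, hδ, hδ'⟩ := Metric.uniformContinuousOn_iff.mp hu ε hε
  have hball : ∀ᶠ h : ℝ in 𝓝[≠] 0, h ∈ Metric.ball (0 : ℝ) (min δ 1) :=
    nhdsWithin_le_nhds (Metric.ball_mem_nhds 0 (by positivity))
  filter_upwards [hball, self_mem_nhdsWithin] with h hh hne θ hθ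
  have hne : h ≠ 0 := hne
  rw [Metric.mem_ball, dist_zero_right, Real.norm_eq_abs, lt_min_iff] at hh
  -- Mean value inequality after subtracting the linear part: the remaining derivative is at most ε
  -- by uniform continuity of g on a compact rectangle.
  have hder : ∀ s ∈ Icc (-|h|) |h|, HasDerivWithinAt (fun s : ℝ => G (p + s • v) θ - s • g (0, θ))
      (g (s, θ) - g (0, θ)) (Icc (-|h|) |h|) s := by
    intro s _
    apply HasDerivAt.hasDerivWithinAt
    have h1 : HasDerivAt (fun s : ℝ => p + s • v) v s := by
      simpa using ((hasDerivAt_id s).smul_const v).const_add p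
    have h2 := (hGd (p + s • v) θ).differentiableAt.hasFDerivAt.comp_hasDerivAt s h1
    have h3 : HasDerivAt (fun s : ℝ => s • g (0, θ)) (g (0, θ)) s := by
      simpa using (hasDerivAt_id s).smul_const (g (0, θ))
    exact h2.sub h3
  have hb : ∀ s ∈ Icc (-|h|) |h|, ‖g (s, θ) - g (0, θ)‖ ≤ ε := by
    intro s hs
    have hs' : |s| ≤ |h| := abs_le.mpr hs
    have := hδ' (s, θ) ⟨abs_le.mp (hs'.trans hh.2.le), hθ⟩ (0, θ) ⟨by simp, hθ⟩ (by
      rw [dist_prod_same_right, dist_zero_right, Real.norm_eq_abs]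
      exact hs'.trans_lt hh.1)
    rw [dist_eq_norm] at this
    exact this.le
  have := Convex.norm_image_sub_le_of_norm_hasDerivWithin_le hder hb (convex_Icc _ _)
    (x := 0) (y := h) (by simp) ⟨neg_abs_le h, le_abs_self h⟩
  simp only [zero_smul, add_zero, sub_zero] at this
  have e : h⁻¹ • (G (p + h • v) θ - G p θ) - fderiv ℝ (fun q => G q θ) p v =
      h⁻¹ • (G (p + h • v) θ - h • g (0, θ) - G p θ) := by
    simp only [hg, zero_smul, add_zero]
    rw [smul_sub, smul_sub, smul_sub, inv_smul_smul₀ hne]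
    abel
  rw [e, norm_smul, norm_inv]
  rw [inv_mul_le_iff₀ (norm_pos_iff.mpr hne), mul_comm]
  exact this

variable [NormedAddCommGroup F] [NormedSpace ℂ F]

/-- A pointwise limit of holomorphic functions that converge uniformly on the boundary of a bounded
domain extends continuously to the boundary. -/
theorem tendsto_nhdsWithin_of_uniform_on_frontier {ι : Type} {l : Filter ι} [l.NeBot]
    {Ω : Set ℂ} (hΩ : Bornology.IsBounded Ω) {f : ι → ℂ → F} {f₀ b : ℂ → F}
    (hf : ∀ i, DiffContOnCl ℂ (f i) Ω) (hlim : ∀ μ ∈ Ω, Tendsto (fun i => f i μ) l (𝓝 (f₀ μ)))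
    (hb : ∀ ε > 0, ∀ᶠ i in l, ∀ μ ∈ frontier Ω, ‖f i μ - b μ‖ ≤ ε) {z : ℂ}
    (hz : z ∈ frontier Ω) : Tendsto f₀ (𝓝[Ω] z) (𝓝 (b z)) := by
  rw [Metric.tendsto_nhds]
  intro ε hε
  obtain ⟨i, hi⟩ := (hb (ε / 8) (by positivity)).exists
  -- By the maximum principle f i is uniformly close to every later f j on Ω, hence to the pointwise
  -- limit.
  have h1 : ∀ μ ∈ Ω, ‖f i μ - f₀ μ‖ ≤ ε / 4 := by
    intro μ hμ
    refine le_of_tendsto ((tendsto_const_nhds.sub (hlim μ hμ)).norm) ?_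
    filter_upwards [hb (ε / 8) (by positivity)] with j hj
    refine Complex.norm_le_of_forall_mem_frontier_norm_le (f := fun μ => f i μ - f j μ) hΩ
      ((hf i).sub (hf j)) (fun w hw => ?_) (subset_closure hμ)
    have e : f i w - f j w = (f i w - b w) - (f j w - b w) := by abel
    rw [e]
    linarith [norm_sub_le (f i w - b w) (f j w - b w), hi w hw, hj w hw]
  have h2 : Tendsto (f i) (𝓝[Ω] z) (𝓝 (f i z)) :=
    ((hf i).continuousOn z (frontier_subset_closure hz)).mono subset_closure
  have h3 := (Metric.tendsto_nhds.mp h2) (ε / 4) (by positivity)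
  filter_upwards [h3, self_mem_nhdsWithin] with μ hμ hμΩ
  rw [dist_eq_norm] at hμ ⊢
  have e : f₀ μ - b z = (f i z - b z) + (f i μ - f i z) - (f i μ - f₀ μ) := by abel
  rw [e]
  linarith [norm_sub_le ((f i z - b z) + (f i μ - f i z)) (f i μ - f₀ μ),
    norm_add_le (f i z - b z) (f i μ - f i z), hi z hz, h1 μ hμΩ]

end BoundaryDerivatives

/-! ### Boundary values of derivatives on the unit circle. -/

section Annulus

variable {F : Type} [NormedAddCommGroup F] [NormedSpace ℂ F]

/-- The annulus `1 < |μ| < R`. -/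
def annulus (R : ℝ) : Set ℂ := {μ | 1 < ‖μ‖ ∧ ‖μ‖ < R}

theorem isOpen_annulus (R : ℝ) : IsOpen (annulus R) :=
  (isOpen_lt continuous_const continuous_norm).inter (isOpen_lt continuous_norm continuous_const)

theorem closure_annulus_subset (R : ℝ) : closure (annulus R) ⊆ {μ | 1 ≤ ‖μ‖ ∧ ‖μ‖ ≤ R} :=
  closure_minimal (fun _ h => ⟨h.1.le, h.2.le⟩)
    ((isClosed_le continuous_const continuous_norm).inter
      (isClosed_le continuous_norm continuous_const))

theorem frontier_annulus_subset {R : ℝ} {μ : ℂ} (h : μ ∈ frontier (annulus R)) :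
    ‖μ‖ = 1 ∨ ‖μ‖ = R := by
  rw [(isOpen_annulus R).frontier_eq] at h
  obtain ⟨h1, h2⟩ := closure_annulus_subset R h.1
  by_contra hne
  push Not at hne
  exact h.2 ⟨lt_of_le_of_ne h1 (Ne.symm hne.1), lt_of_le_of_ne h2 hne.2⟩

theorem isBounded_annulus (R : ℝ) : Bornology.IsBounded (annulus R) :=
  (Metric.isBounded_closedBall (x := (0 : ℂ)) (r := R)).subset fun μ h => by
    simpa using h.2.le

theorem mem_closure_exterior {z : ℂ} (hz : 1 ≤ ‖z‖) : z ∈ closure {μ : ℂ | 1 < ‖μ‖} := by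
  have : {μ : ℂ | 1 < ‖μ‖} = (Metric.closedBall (0 : ℂ) 1)ᶜ := by
    ext μ
    simp
  rw [this, closure_compl, interior_closedBall _ one_ne_zero]
  simpa using hz

theorem nhdsWithin_annulus {R : ℝ} (hR : 1 < R) {z : ℂ} (hz : ‖z‖ = 1) :
    𝓝[annulus R] z = 𝓝[{μ : ℂ | 1 < ‖μ‖}] z :=
  nhdsWithin_inter_of_mem' (nhdsWithin_le_nhds
    ((isOpen_lt continuous_norm continuous_const).mem_nhds (show ‖z‖ < R by rw [hz]; exact hR)))

theorem neBot_nhdsWithin_annulus {R : ℝ} (hR : 1 < R) {z : ℂ} (hz : ‖z‖ = 1) :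
    (𝓝[annulus R] z).NeBot := by
  rw [nhdsWithin_annulus hR hz]
  exact mem_closure_iff_nhdsWithin_neBot.mp (mem_closure_exterior hz.ge)

theorem exists_angle {z : ℂ} {R : ℝ} (hz : ‖z‖ = R) :
    ∃ θ ∈ Icc (-Real.pi) Real.pi, z = R * Circle.exp θ :=
  ⟨z.arg, ⟨(Complex.neg_pi_lt_arg z).le, Complex.arg_le_pi z⟩, by
    rw [Circle.coe_exp, ← hz, Complex.norm_mul_exp_arg_mul_I]⟩

/-- If a family of functions, holomorphic outside the closed unit disc near the unit circle and
smooth in the parameters, has boundary values on the unit circle that are smooth in the parameters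
and the angle, then also its derivatives have boundary values, namely the derivatives of the
boundary values. -/
theorem tendsto_fderiv_boundary {E : Type} [NormedAddCommGroup E] [NormedSpace ℝ E]
    {R : ℝ} (hR : 1 < R) {f : E → ℂ → F} {W : Set ℂ} (hW : IsOpen W)
    (hsub : ∀ μ : ℂ, 1 < ‖μ‖ → ‖μ‖ ≤ R → μ ∈ W)
    (hs : ContDiffOn ℝ ∞ (fun q : E × ℂ => f q.1 q.2) (univ ×ˢ W))
    (hd : ∀ p, DifferentiableOn ℂ (f p) W) {g : E → Circle → F}
    (hg : ContDiff ℝ ∞ (fun q : E × ℝ => g q.1 (Circle.exp q.2)))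
    (hlim : ∀ p (z : Circle), Tendsto (f p) (𝓝[{μ : ℂ | 1 < ‖μ‖}] (z : ℂ)) (𝓝 (g p z)))
    (p v : E) (z : Circle) :
    Tendsto (fun μ => fderiv ℝ (fun q => f q μ) p v) (𝓝[annulus R] (z : ℂ))
      (𝓝 (fderiv ℝ (fun q => g q z) p v)) := by
  set A : Set ℂ := {μ : ℂ | 1 < ‖μ‖} with hA
  have hcf : ∀ p, ∀ μ ∈ W, ContinuousAt (f p) μ := fun p μ hμ =>
    ((hd p).differentiableAt (hW.mem_nhds hμ)).continuousAt
  set e : E → ℂ → F := fun p => extendFrom A (f p) with he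
  have hlim' : ∀ p, ∀ μ ∈ closure (annulus R), ∃ y, Tendsto (f p) (𝓝[A] μ) (𝓝 y) := by
    intro p μ hμ
    obtain ⟨h1, h2⟩ := closure_annulus_subset R hμ
    rcases h1.eq_or_lt with h | h
    · obtain ⟨θ, -, hθ⟩ := exists_angle h.symm
      rw [Complex.ofReal_one, one_mul] at hθ
      rw [hθ]
      exact ⟨_, hlim p (Circle.exp θ)⟩
    · exact ⟨_, (hcf p μ (hsub μ h h2)).tendsto.mono_left nhdsWithin_le_nhds⟩
  have he1 : ∀ p (z : Circle), e p z = g p z := fun p z =>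
    extendFrom_eq (mem_closure_exterior (Circle.norm_coe z).ge) (hlim p z)
  have he2 : ∀ p (μ : ℂ), 1 < ‖μ‖ → ‖μ‖ ≤ R → e p μ = f p μ := fun p μ h1 h2 =>
    extendFrom_eq (mem_closure_exterior h1.le)
      ((hcf p μ (hsub μ h1 h2)).tendsto.mono_left nhdsWithin_le_nhds)
  have hdc : ∀ p, DiffContOnCl ℂ (e p) (annulus R) := by
    intro p
    refine ⟨?_, continuousOn_extendFrom
      (fun μ hμ => mem_closure_exterior (closure_annulus_subset R hμ).1) (hlim' p)⟩
    refine DifferentiableOn.congr (f := f p) (fun μ hμ => ?_) fun μ hμ => he2 p μ hμ.1 hμ.2.le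
    exact ((hd p).differentiableAt
      (hW.mem_nhds (hsub μ hμ.1 hμ.2.le))).differentiableWithinAt
  set b : ℂ → F := fun μ => fderiv ℝ (fun q => e q μ) p v with hb
  have hbz : b z = fderiv ℝ (fun q => g q z) p v := by
    simp only [hb, he1]
  rw [← hbz]
  have hzf : (z : ℂ) ∈ frontier (annulus R) := by
    rw [(isOpen_annulus R).frontier_eq]
    refine ⟨mem_closure_iff_nhdsWithin_neBot.mpr (neBot_nhdsWithin_annulus hR (Circle.norm_coe z)),
      fun h => h.1.ne' (Circle.norm_coe z)⟩
  have hRR : ContDiff ℝ ∞ (fun q : E × ℝ => f q.1 (R * Circle.exp q.2)) := by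
    rw [← contDiffOn_univ]
    refine hs.comp (f := fun q : E × ℝ => (q.1, (R * Circle.exp q.2 : ℂ))) ?_ fun q _ =>
      ⟨mem_univ _, hsub _ ?_ ?_⟩
    · apply ContDiff.contDiffOn
      simp only [Circle.coe_exp]
      have : ContDiff ℝ ∞ (fun x : ℝ => (x : ℂ)) := Complex.ofRealCLM.contDiff
      fun_prop
    · simpa [abs_of_pos (zero_lt_one.trans hR)] using hR
    · simp [abs_of_pos (zero_lt_one.trans hR)]
  -- The functions are the difference quotients in the direction v, holomorphic in μ on the annulus.
  -- On the inner circle they converge uniformly because the boundary values are smooth in the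
  -- angle, on the outer one because it lies in W.
  refine tendsto_nhdsWithin_of_uniform_on_frontier (isBounded_annulus R) (l := 𝓝[≠] (0 : ℝ))
    (f := fun h μ => h⁻¹ • (e (p + h • v) μ - e p μ)) (fun h => ?_) (fun μ hμ => ?_)
    (fun ε hε => ?_) hzf
  · have := ((hdc (p + h • v)).sub (hdc p)).const_smul ((h⁻¹ : ℝ) : ℂ)
    have e1 : (fun μ => h⁻¹ • (e (p + h • v) μ - e p μ)) =
        ((h⁻¹ : ℝ) : ℂ) • (e (p + h • v) - e p) := by
      funext μ
      exact (Complex.coe_smul h⁻¹ _).symm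
    rw [e1]
    exact this
  · have hμW := hsub μ hμ.1 hμ.2.le
    have h1 : DifferentiableAt ℝ (fun q => f q μ) p := by
      have h2 : ContDiff ℝ ∞ (fun q => f q μ) := by
        rw [← contDiffOn_univ]
        exact hs.comp (f := fun q : E => (q, μ)) (by fun_prop) fun q _ => ⟨mem_univ _, hμW⟩
      exact h2.differentiable (by simp) p
    have h3 := h1.hasFDerivAt.hasLineDerivAt v
    have h4 := h3.tendsto_slope_zero
    refine h4.congr fun h => ?_
    rw [he2 _ μ hμ.1 hμ.2.le, he2 _ μ hμ.1 hμ.2.le]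
  · filter_upwards [eventually_norm_difference_quotient_sub_le
        (G := fun p (θ : ℝ) => g p (Circle.exp θ)) hg p v (-Real.pi) Real.pi hε,
      eventually_norm_difference_quotient_sub_le
        (G := fun p (θ : ℝ) => f p (R * Circle.exp θ)) hRR p v (-Real.pi) Real.pi hε]
      with h h1 h2 μ hμ
    rcases frontier_annulus_subset hμ with hn | hn
    · obtain ⟨θ, hθ, rfl⟩ := exists_angle hn
      simp only [hb, Complex.ofReal_one, one_mul, he1]
      exact h1 θ hθ
    · obtain ⟨θ, hθ, rfl⟩ := exists_angle hn
      have e3 : ∀ q, e q (R * Circle.exp θ) = f q (R * Circle.exp θ) := fun q =>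
        he2 q _ (by rw [hn]; exact hR) hn.le
      simp only [hb, e3]
      exact h2 θ hθ

end Annulus

/-! ### The Cayley transform and the regular domain. -/

section Cayley

/-- The conformal map from the exterior of the unit disc to the upper half plane. -/
noncomputable def cayley (μ : ℂ) : ℂ := Complex.I * (μ - 1) / (μ + 1)

theorem add_one_mul_cayley {μ : ℂ} (h : μ + 1 ≠ 0) : (μ + 1) * cayley μ = Complex.I * (μ - 1) := by
  rw [cayley]
  field_simp

theorem add_one_ne_zero_of_one_lt_norm {μ : ℂ} (h : 1 < ‖μ‖) : μ + 1 ≠ 0 := by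
  intro h0
  rw [eq_neg_of_add_eq_zero_left h0] at h
  simp at h

theorem cayley_im_pos {μ : ℂ} (h : 1 < ‖μ‖) : 0 < (cayley μ).im := by
  have h0 := add_one_ne_zero_of_one_lt_norm h
  have e : (cayley μ).im = (Complex.normSq μ - 1) / Complex.normSq (μ + 1) := by
    rw [cayley, Complex.div_im, ← sub_div, Complex.normSq_apply μ]
    congr 1
    simp
    ring
  rw [e]
  refine div_pos ?_ (Complex.normSq_pos.mpr h0)
  rw [Complex.normSq_eq_norm_sq]
  nlinarith

theorem cayley_injOn : InjOn cayley {μ | μ + 1 ≠ 0} := by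
  intro μ hμ ν hν h
  rw [cayley, cayley, div_eq_div_iff hμ hν] at h
  have : (2 * Complex.I) * (μ - ν) = 0 := by linear_combination h
  simpa [sub_eq_zero] using this

theorem conj_cayley {μ : ℂ} (h0 : μ ≠ 0) : conj (cayley μ) = cayley (conj μ)⁻¹ := by
  have h1 : conj μ ≠ 0 := (map_ne_zero _).mpr h0
  simp only [cayley, map_div₀, map_mul, map_sub, map_add, map_one, Complex.conj_I]
  rw [show (conj μ)⁻¹ - 1 = (1 - conj μ) / conj μ by field_simp,
    show (conj μ)⁻¹ + 1 = (conj μ + 1) / conj μ by field_simp; ring, ← mul_div_assoc,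
    div_div_div_cancel_right₀ h1]
  ring

theorem continuousOn_cayley : ContinuousOn cayley {μ | μ + 1 ≠ 0} :=
  ContinuousOn.div (by fun_prop) (by fun_prop) fun _ h => h

theorem differentiableOn_cayley : DifferentiableOn ℂ cayley {μ | μ + 1 ≠ 0} :=
  DifferentiableOn.div (by fun_prop) (by fun_prop) fun _ h => h

theorem contDiffOn_cayley : ContDiffOn ℝ ∞ cayley {μ | μ + 1 ≠ 0} :=
  (ContDiffOn.div (𝕜 := ℂ) (by fun_prop) (by fun_prop) fun _ h => h).restrict_scalars ℝ

variable {m : ℕ} {α : Fin m → ℂ}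

theorem regularDomain_eq : regularDomain α =
    {τ : ℂ | τ.im ≠ 0} ∩ ⋂ j, ({α j}ᶜ ∩ {conj (α j)}ᶜ) := by
  ext τ
  simp [regularDomain]

theorem isOpen_im_ne_zero : IsOpen {τ : ℂ | τ.im ≠ 0} :=
  isOpen_ne_fun Complex.continuous_im continuous_const

theorem isOpen_regularDomain : IsOpen (regularDomain α) := by
  rw [regularDomain_eq]
  exact isOpen_im_ne_zero.inter
    (isOpen_iInter_of_finite fun j => isOpen_compl_singleton.inter isOpen_compl_singleton)

theorem conj_mem_regularDomain {τ : ℂ} (h : τ ∈ regularDomain α) : conj τ ∈ regularDomain α := by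
  refine ⟨by simpa using h.1, fun j => ⟨fun e => (h.2 j).2 ?_, fun e => (h.2 j).1 ?_⟩⟩
  · rw [← e, Complex.conj_conj]
  · exact (starRingEnd ℂ).injective e

/-- The preimage of the regular domain in the `μ`-plane. -/
def cayleyDomain (α : Fin m → ℂ) : Set ℂ := {μ | μ + 1 ≠ 0} ∩ cayley ⁻¹' regularDomain α

theorem isOpen_cayleyDomain : IsOpen (cayleyDomain α) :=
  continuousOn_cayley.isOpen_inter_preimage (isOpen_ne_fun (by fun_prop) continuous_const)
    isOpen_regularDomain

/-- By injectivity β has at most one preimage ν outside the closed disc, and any R < ‖ν‖ avoids it.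
Thus a thin annulus misses all poles. -/
theorem eventually_cayley_ne (β : ℂ) :
    ∀ᶠ R : ℝ in 𝓝[>] 1, ∀ μ : ℂ, 1 < ‖μ‖ → ‖μ‖ ≤ R → cayley μ ≠ β := by
  by_cases h : ∃ μ : ℂ, 1 < ‖μ‖ ∧ cayley μ = β
  · obtain ⟨ν, hν, rfl⟩ := h
    filter_upwards [Ioo_mem_nhdsGT hν] with R hR μ h1 h2 he
    rw [cayley_injOn (add_one_ne_zero_of_one_lt_norm h1) (add_one_ne_zero_of_one_lt_norm hν) he]
      at h2
    exact absurd hR.2 h2.not_gt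
  · push Not at h
    exact Eventually.of_forall fun R μ h1 _ => h μ h1

theorem exists_annulus_subset (α : Fin m → ℂ) :
    ∃ R : ℝ, 1 < R ∧ ∀ μ : ℂ, 1 < ‖μ‖ → ‖μ‖ ≤ R → μ ∈ cayleyDomain α := by
  have h : ∀ᶠ R : ℝ in 𝓝[>] 1, ∀ j, (∀ μ : ℂ, 1 < ‖μ‖ → ‖μ‖ ≤ R → cayley μ ≠ α j) ∧
      ∀ μ : ℂ, 1 < ‖μ‖ → ‖μ‖ ≤ R → cayley μ ≠ conj (α j) :=
    eventually_all.mpr fun j => (eventually_cayley_ne _).and (eventually_cayley_ne _)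
  obtain ⟨R, hR, h1⟩ := (h.and self_mem_nhdsWithin).exists
  exact ⟨R, h1, fun μ h2 h3 => ⟨add_one_ne_zero_of_one_lt_norm h2, (cayley_im_pos h2).ne',
    fun j => ⟨(hR j).1 μ h2 h3, (hR j).2 μ h2 h3⟩⟩⟩

theorem tendsto_inv_conj_exterior (z : Circle) :
    Tendsto (fun μ : ℂ => (conj μ)⁻¹) (𝓝[{μ : ℂ | 1 < ‖μ‖}] (z : ℂ))
      (𝓝[{μ : ℂ | ‖μ‖ < 1}] (z : ℂ)) := by
  refine tendsto_nhdsWithin_iff.mpr ⟨?_, ?_⟩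
  · have hz : conj (z : ℂ) ≠ 0 := (map_ne_zero _).mpr (Circle.coe_ne_zero z)
    have h1 : ContinuousAt (fun μ : ℂ => (conj μ)⁻¹) z :=
      Complex.continuous_conj.continuousAt.inv₀ hz
    have h2 : (conj (z : ℂ))⁻¹ = z := by
      rw [← Circle.coe_inv_eq_conj, Circle.coe_inv, inv_inv]
    have h3 := h1.tendsto.mono_left (nhdsWithin_le_nhds (s := {μ : ℂ | 1 < ‖μ‖}))
    rwa [h2] at h3
  · filter_upwards [self_mem_nhdsWithin] with μ hμ
    simpa using inv_lt_one_of_one_lt₀ hμ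

end Cayley

/-! ### The frame on the boundary circle. -/

namespace HasPolesAndJump

variable {n m : ℕ} {α : Fin m → ℂ} {k : Fin m → ℕ} {ψ : Spacetime → ℂ → Mat n}
  {Ep Em : Spacetime → Circle → Mat n}

theorem contDiffOn_toMu (H : HasPolesAndJump α k ψ Ep Em) :
    ContDiffOn ℝ ∞ (fun q : Spacetime × ℂ => toMu ψ q.1 q.2) (univ ×ˢ cayleyDomain α) := by
  refine H.normalized.smooth.comp (f := fun q : Spacetime × ℂ => (q.1, cayley q.2))
    (contDiffOn_fst.prodMk ?_) fun q hq => ⟨mem_univ _, hq.2.2⟩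
  exact contDiffOn_cayley.comp contDiffOn_snd fun q hq => hq.2.1

theorem differentiableOn_toMu (H : HasPolesAndJump α k ψ Ep Em) (p : Spacetime) :
    DifferentiableOn ℂ (toMu ψ p) (cayleyDomain α) :=
  (H.normalized.holomorphic p).comp (differentiableOn_cayley.mono inter_subset_left)
    fun _ hμ => hμ.2

/-- The linear system passes to the boundary values on the unit circle. -/
theorem boundary_system (H : HasPolesAndJump α k ψ Ep Em) {u v : Spacetime}
    {b c : Spacetime → Mat n}
    (hsys : ∀ p, ∀ τ ∈ regularDomain α, τ • fderiv ℝ (fun q => ψ q τ) p u -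
      fderiv ℝ (fun q => ψ q τ) p v = (τ • b p + c p) * ψ p τ) (p : Spacetime) (z : Circle) :
    (Complex.I * (z - 1)) • fderiv ℝ (fun q => Ep q z) p u -
      ((z : ℂ) + 1) • fderiv ℝ (fun q => Ep q z) p v =
        ((Complex.I * (z - 1)) • b p + ((z : ℂ) + 1) • c p) * Ep p z := by
  obtain ⟨R, hR, hsub⟩ := exists_annulus_subset α
  have hd : ∀ w, Tendsto (fun μ => fderiv ℝ (fun q => toMu ψ q μ) p w) (𝓝[annulus R] (z : ℂ))
      (𝓝 (fderiv ℝ (fun q => Ep q z) p w)) := fun w =>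
    tendsto_fderiv_boundary hR isOpen_cayleyDomain hsub H.contDiffOn_toMu
      H.differentiableOn_toMu H.smooth_plus H.limit_plus p w z
  have h0 : Tendsto (toMu ψ p) (𝓝[annulus R] (z : ℂ)) (𝓝 (Ep p z)) := by
    rw [nhdsWithin_annulus hR (Circle.norm_coe z)]
    exact H.limit_plus p z
  -- The system is multiplied by μ + 1 before passing to the limit, so that its coefficients stay
  -- finite at μ = -1, that is at τ = ∞.
  have h1 : Tendsto (fun μ : ℂ => Complex.I * (μ - 1)) (𝓝[annulus R] (z : ℂ))
      (𝓝 (Complex.I * (z - 1))) :=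
    (Continuous.tendsto (by fun_prop) _).mono_left nhdsWithin_le_nhds
  have h2 : Tendsto (fun μ : ℂ => μ + 1) (𝓝[annulus R] (z : ℂ)) (𝓝 ((z : ℂ) + 1)) :=
    (Continuous.tendsto (by fun_prop) _).mono_left nhdsWithin_le_nhds
  have := neBot_nhdsWithin_annulus hR (Circle.norm_coe z)
  refine tendsto_nhds_unique ((h1.smul (hd u)).sub (h2.smul (hd v)))
    (((((h1.smul_const (b p)).add (h2.smul_const (c p))).mul h0)).congr' ?_)
  filter_upwards [self_mem_nhdsWithin] with μ hμ
  have hμW := hsub μ hμ.1 hμ.2.le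
  have e := hsys p _ hμW.2
  have e2 := add_one_mul_cayley hμW.1
  rw [← e2, mul_smul, mul_smul, ← smul_add, ← smul_sub, smul_mul_assoc]
  exact congrArg (fun M => (μ + 1) • M) e.symm

/-- Conjugation of τ is the reflection μ ↦ 1/μ̄, which exchanges the two sides of the circle and
fixes its points. The reality condition in the limit therefore pairs E_- with E_+. -/
theorem star_minus_mul_plus (H : HasPolesAndJump α k ψ Ep Em) (p : Spacetime) (z : Circle) :
    star (Em p z) * Ep p z = 1 := by
  obtain ⟨R, hR, hsub⟩ := exists_annulus_subset α
  have := neBot_nhdsWithin_annulus hR (Circle.norm_coe z)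
  rw [nhdsWithin_annulus hR (Circle.norm_coe z)] at this
  have h1 := (H.limit_minus p z).comp (tendsto_inv_conj_exterior z)
  refine tendsto_nhds_unique (h1.star.mul (H.limit_plus p z))
    (tendsto_const_nhds.congr' ?_)
  rw [← nhdsWithin_annulus hR (Circle.norm_coe z)]
  filter_upwards [self_mem_nhdsWithin] with μ hμ
  have hμW := hsub μ hμ.1 hμ.2.le
  have hμ0 : μ ≠ 0 := norm_pos_iff.mp (zero_lt_one.trans hμ.1)
  have := H.normalized.reality p _ hμW.2
  rw [conj_cayley hμ0] at this
  exact this.symm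

theorem scatteringMatrix_eq (H : HasPolesAndJump α k ψ Ep Em) (p : Spacetime) (z : Circle) :
    scatteringMatrix Ep Em p z = star (Ep p z) * Ep p z := by
  have h : star (Ep p z) * Em p z = 1 := by
    simpa using congrArg star (H.star_minus_mul_plus p z)
  rw [scatteringMatrix, Matrix.inv_eq_left_inv h]

theorem isUnit_plus (H : HasPolesAndJump α k ψ Ep Em) (p : Spacetime) (z : Circle) :
    IsUnit (Ep p z) :=
  isUnit_of_reality (H.star_minus_mul_plus p z)

end HasPolesAndJump

/-! ### Null directions of the scattering matrix. -/

section ScatteringMatrix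

variable {n m : ℕ} {α : Fin m → ℂ} {k : Fin m → ℕ} {ψ : Spacetime → ℂ → Mat n}
  {Ep Em : Spacetime → Circle → Mat n}

theorem regularDomain_nonempty : (regularDomain α).Nonempty := by
  obtain ⟨R, hR, hsub⟩ := exists_annulus_subset α
  have h : ‖(R : ℂ)‖ = R := by
    rw [Complex.norm_real, Real.norm_of_nonneg (zero_le_one.trans hR.le)]
  exact ⟨_, (hsub R (by rwa [h]) h.le).2⟩

/-- Half-angle form: 1 + e^{iθ} and i(e^{iθ} - 1) share the factor 2e^{iθ/2}. Dividing it out leaves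
real coefficients cos(θ/2) and -sin(θ/2) in the boundary system. -/
theorem circle_exp_add_one (θ : ℝ) : ((Circle.exp θ : ℂ)) + 1 =
    (2 * Circle.exp (θ / 2)) * (Real.cos (θ / 2) : ℂ) := by
  have h : (Circle.exp θ : ℂ) = (Circle.exp (θ / 2) : ℂ) * Circle.exp (θ / 2) := by
    rw [← Circle.coe_mul, ← Circle.exp_add, add_halves]
  have h1 : (Circle.exp (θ / 2) : ℂ) = Real.cos (θ / 2) + Real.sin (θ / 2) * Complex.I := by
    rw [Circle.coe_exp, Complex.exp_mul_I]
    push_cast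
    rfl
  have h2 : (Real.sin (θ / 2) : ℂ) ^ 2 + (Real.cos (θ / 2) : ℂ) ^ 2 = 1 := by
    exact_mod_cast Real.sin_sq_add_cos_sq (θ / 2)
  rw [h, h1]
  linear_combination (Real.sin (θ / 2) : ℂ) ^ 2 * Complex.I_sq - h2

theorem I_mul_circle_exp_sub_one (θ : ℝ) : Complex.I * ((Circle.exp θ : ℂ) - 1) =
    -(2 * Circle.exp (θ / 2)) * (Real.sin (θ / 2) : ℂ) := by
  have h1 : (Circle.exp (θ / 2) : ℂ) = Real.cos (θ / 2) + Real.sin (θ / 2) * Complex.I := by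
    rw [Circle.coe_exp, Complex.exp_mul_I]
    push_cast
    rfl
  have h2 : (Real.sin (θ / 2) : ℂ) ^ 2 + (Real.cos (θ / 2) : ℂ) ^ 2 = 1 := by
    exact_mod_cast Real.sin_sq_add_cos_sq (θ / 2)
  have h3 := circle_exp_add_one θ
  rw [h1] at h3 ⊢
  linear_combination Complex.I * h3 + (2 * Real.sin (θ / 2) * Real.cos (θ / 2)) * Complex.I_sq +
    2 * Complex.I * h2

namespace HasPolesAndJump

theorem contDiff_plus (H : HasPolesAndJump α k ψ Ep Em) (z : Circle) :
    ContDiff ℝ ∞ (fun p => Ep p z) := by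
  obtain ⟨θ, rfl⟩ := Circle.exp_surjective z
  exact H.smooth_plus.comp (f := fun p : Spacetime => (p, θ)) (by fun_prop)

/-- The linear system on the unit circle is anti-Hermitian along a real direction, which hence
annihilates the scattering matrix. -/
theorem fderiv_gram (H : HasPolesAndJump α k ψ Ep Em) {u v : Spacetime}
    {b c : Spacetime → Mat n}
    (hsys : ∀ p, ∀ τ ∈ regularDomain α, τ • fderiv ℝ (fun q => ψ q τ) p u -
      fderiv ℝ (fun q => ψ q τ) p v = (τ • b p + c p) * ψ p τ) (p : Spacetime) (θ : ℝ) :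
    (Real.sin (θ / 2) : ℂ) •
        fderiv ℝ (fun q => star (Ep q (Circle.exp θ)) * Ep q (Circle.exp θ)) p u +
      (Real.cos (θ / 2) : ℂ) •
        fderiv ℝ (fun q => star (Ep q (Circle.exp θ)) * Ep q (Circle.exp θ)) p v = 0 := by
  obtain ⟨hb, hc⟩ := skew_of_system isOpen_regularDomain regularDomain_nonempty
    (fun τ hτ => conj_mem_regularDomain hτ)
    (fun τ hτ => contDiff_slice_of_contDiffOn H.normalized.smooth hτ) H.normalized.reality (hsys p)
  have h := H.boundary_system hsys p (Circle.exp θ)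
  rw [circle_exp_add_one, I_mul_circle_exp_sub_one] at h
  set w : ℂ := 2 * Circle.exp (θ / 2)
  have hw : w ≠ 0 := mul_ne_zero two_ne_zero (Circle.coe_ne_zero _)
  set s : ℝ := Real.sin (θ / 2)
  set a : ℝ := Real.cos (θ / 2)
  set E : Spacetime → Mat n := fun q => Ep q (Circle.exp θ) with hE
  have hEd : DifferentiableAt ℝ E p := (H.contDiff_plus _).differentiable (by simp) p
  have h' : (s : ℂ) • fderiv ℝ E p u + (a : ℂ) • fderiv ℝ E p v =
      ((s : ℂ) • b p - (a : ℂ) • c p) * E p := by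
    have h2 : w • ((s : ℂ) • fderiv ℝ E p u + (a : ℂ) • fderiv ℝ E p v -
        ((s : ℂ) • b p - (a : ℂ) • c p) * E p) = 0 := by
      have h3 : (-w * (s : ℂ)) • fderiv ℝ E p u - (w * (a : ℂ)) • fderiv ℝ E p v =
        ((-w * (s : ℂ)) • b p + (w * (a : ℂ)) • c p) * E p := h
      simp only [add_mul, sub_mul, smul_mul_assoc] at h3 ⊢
      linear_combination (norm := module) -h3
    exact sub_eq_zero.mp ((smul_eq_zero.mp h2).resolve_left hw)
  -- With real s, a and skew-Hermitian b, c, the matrix s b - a c is skew-Hermitian, so its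
  -- contributions to the derivative of E*E cancel.
  have h'' := congrArg star h'
  simp only [star_add, star_smul, star_mul, star_sub, hb, hc, Complex.star_def,
    Complex.conj_ofReal] at h''
  have key : ∀ x, fderiv ℝ (fun q => star (E q) * E q) p x =
      star (E p) * fderiv ℝ E p x + star (fderiv ℝ E p x) * E p := fun x => by
    rw [fderiv_mul_apply hEd.star hEd, fderiv_star_apply hEd]
  have e1 := congrArg (fun M => star (E p) * M) h'
  have e2 := congrArg (fun M => M * E p) h''
  show (s : ℂ) • fderiv ℝ (fun q => star (E q) * E q) p u +
    (a : ℂ) • fderiv ℝ (fun q => star (E q) * E q) p v = 0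
  rw [key, key]
  simp only [mul_add, add_mul, mul_sub, sub_mul, mul_smul_comm, smul_mul_assoc, mul_neg, neg_mul,
    smul_neg, mul_assoc] at e1 e2
  linear_combination (norm := module) e1 + e2

end HasPolesAndJump

end ScatteringMatrix

/-! ### The scattering datum and its profile. -/

section ScatteringDatum

variable {n m : ℕ} {α : Fin m → ℂ} {k : Fin m → ℕ} {ψ : Spacetime → ℂ → Mat n}
  {Ep Em : Spacetime → Circle → Mat n}

theorem circle_exp_re (θ : ℝ) : (Circle.exp θ : ℂ).re = Real.cos θ := by
  rw [Circle.coe_exp, Complex.exp_ofReal_mul_I_re]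

theorem circle_exp_im (θ : ℝ) : (Circle.exp θ : ℂ).im = Real.sin θ := by
  rw [Circle.coe_exp, Complex.exp_ofReal_mul_I_im]

theorem map_spacetime {V : Type} [NormedAddCommGroup V] [NormedSpace ℝ V] (L : Spacetime →L[ℝ] V)
    (a b c : ℝ) : L (a, b, c) = a • L (1, 0, 0) + b • L (0, 1, 0) + c • L (0, 0, 1) := by
  simp only [← map_smul, ← map_add]
  simp

/-- A linear map killed by two null directions is a multiple of the corresponding covector. -/
theorem map_eq_zero_of_null {V : Type} [NormedAddCommGroup V] [NormedSpace ℝ V]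
    {L : Spacetime →L[ℝ] V} {θ : ℝ}
    (h1 : Real.sin (θ / 2) • L (0, 1, 0) + Real.cos (θ / 2) • L (1, 0, 1) = 0)
    (h2 : Real.sin (θ / 2) • L (-1, 0, 1) + Real.cos (θ / 2) • L (0, 1, 0) = 0)
    {a b c : ℝ} (h : c = a * Real.cos θ + b * Real.sin θ) : L (a, b, c) = 0 := by
  have hc : Real.cos θ = Real.cos (θ / 2) ^ 2 - Real.sin (θ / 2) ^ 2 := by
    rw [← Real.cos_two_mul', mul_div_cancel₀ θ two_ne_zero]
  have hs : Real.sin θ = 2 * Real.sin (θ / 2) * Real.cos (θ / 2) := by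
    rw [← Real.sin_two_mul, mul_div_cancel₀ θ two_ne_zero]
  have hsc := Real.sin_sq_add_cos_sq (θ / 2)
  set S := Real.sin (θ / 2)
  set C := Real.cos (θ / 2)
  rw [map_spacetime L 1 0 1] at h1
  rw [map_spacetime L (-1) 0 1] at h2
  rw [map_spacetime L a b c]
  set X := L (1, 0, 0)
  set Y := L (0, 1, 0)
  set T := L (0, 0, 1)
  -- The two relations determine X = -cos θ T and Y = -sin θ T, so L(a, b, c) = (c - a cos θ - b sin
  -- θ) T.
  have hX : X = -(C ^ 2 - S ^ 2) • T := by
    have : (S ^ 2 + C ^ 2) • X = -(C ^ 2 - S ^ 2) • T := by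
      linear_combination (norm := module) C • h1 - S • h2
    rwa [hsc, one_smul] at this
  have hY : Y = -(2 * S * C) • T := by
    have : (S ^ 2 + C ^ 2) • Y = -(2 * S * C) • T := by
      linear_combination (norm := module) S • h1 + C • h2
    rwa [hsc, one_smul] at this
  rw [hX, hY, h, hc, hs]
  module

/-- A function whose derivative annihilates a direction is constant along it. -/
theorem eq_of_fderiv_apply_eq_zero {V W : Type} [NormedAddCommGroup V] [NormedSpace ℝ V]
    [NormedAddCommGroup W] [NormedSpace ℝ W] {f : W → V} (hf : Differentiable ℝ f) {d : W}
    (h : ∀ p, fderiv ℝ f p d = 0) (p : W) : f (p + d) = f p := by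
  have hd : ∀ s : ℝ, HasDerivAt (fun s : ℝ => f (p + s • d)) 0 s := by
    intro s
    have h1 : HasDerivAt (fun s : ℝ => p + s • d) d s := by
      simpa using ((hasDerivAt_id s).smul_const d).const_add p
    have h2 := (hf (p + s • d)).hasFDerivAt.comp_hasDerivAt s h1
    rwa [h] at h2
  simpa using is_const_of_deriv_eq_zero (fun s => (hd s).differentiableAt)
    (fun s => (hd s).deriv) 1 0

namespace HasPolesAndJump

/-- With r = x cos θ + y sin θ - t, the points (x, y, t) and (r cos θ, r sin θ, 0) differ by a
vector on which x cos θ + y sin θ - t vanishes. Such vectors lie in the plane spanned by the two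
annihilating directions, so the Gram matrix is the same at both points. -/
theorem gram_eq (H : HasPolesAndJump α k ψ Ep Em) (x y t θ : ℝ) :
    star (Ep (x, y, t) (Circle.exp θ)) * Ep (x, y, t) (Circle.exp θ) =
      star (Ep ((x * Real.cos θ + y * Real.sin θ - t) * Real.cos θ,
        (x * Real.cos θ + y * Real.sin θ - t) * Real.sin θ, 0) (Circle.exp θ)) *
      Ep ((x * Real.cos θ + y * Real.sin θ - t) * Real.cos θ,
        (x * Real.cos θ + y * Real.sin θ - t) * Real.sin θ, 0) (Circle.exp θ) := by
  obtain ⟨M, hM, hMsys⟩ := H.normalized.linear_system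
  have hsys := hM.hasDecayingSystem hMsys
  set r := x * Real.cos θ + y * Real.sin θ - t with hr
  set G : Spacetime → Mat n := fun q => star (Ep q (Circle.exp θ)) * Ep q (Circle.exp θ)
  have hE : Differentiable ℝ (fun q => Ep q (Circle.exp θ)) :=
    (H.contDiff_plus _).differentiable (by simp)
  have hG : Differentiable ℝ G := fun p => (hE p).star.mul (hE p)
  have e := eq_of_fderiv_apply_eq_zero hG
    (d := (x - r * Real.cos θ, y - r * Real.sin θ, t)) (fun p =>
      map_eq_zero_of_null (H.fderiv_gram (fun p _ hτ => hsys.fderiv_one p hτ) p θ)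
        (H.fderiv_gram (fun p _ hτ => hsys.fderiv_two p hτ) p θ) (by
          linear_combination hr + r * Real.sin_sq_add_cos_sq θ))
    (r * Real.cos θ, r * Real.sin θ, 0)
  rw [Prod.mk_add_mk, Prod.mk_add_mk, add_sub_cancel, add_sub_cancel, zero_add] at e
  exact e

theorem scatteringMatrix_eq_profile (H : HasPolesAndJump α k ψ Ep Em) (x y t : ℝ) (z : Circle) :
    scatteringMatrix Ep Em (x, y, t) z = scatteringMatrix Ep Em
      ((x * (z : ℂ).re + y * (z : ℂ).im - t) * (z : ℂ).re,
        (x * (z : ℂ).re + y * (z : ℂ).im - t) * (z : ℂ).im, 0) z := by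
  obtain ⟨θ, rfl⟩ := Circle.exp_surjective z
  rw [H.scatteringMatrix_eq, H.scatteringMatrix_eq, circle_exp_re, circle_exp_im]
  exact H.gram_eq x y t θ

theorem isScatteringDatum (H : HasPolesAndJump α k ψ Ep Em)
    (hdecay : ∀ z : Circle, DecaysOnLine (fun r : ℝ =>
      1 - scatteringMatrix Ep Em (r * (z : ℂ).re, r * (z : ℂ).im, 0) z)) :
    IsScatteringDatum (fun r z =>
      scatteringMatrix Ep Em (r * (z : ℂ).re, r * (z : ℂ).im, 0) z) := by
  refine ⟨?_, fun r z => ?_, fun r z => ?_, hdecay⟩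
  · simp only [H.scatteringMatrix_eq, circle_exp_re, circle_exp_im]
    have h : ContDiff ℝ ∞ (fun q : ℝ × ℝ =>
        Ep (q.1 * Real.cos q.2, q.1 * Real.sin q.2, 0) (Circle.exp q.2)) :=
      H.smooth_plus.comp (f := fun q : ℝ × ℝ =>
        (((q.1 * Real.cos q.2, q.1 * Real.sin q.2, 0) : Spacetime), q.2)) (by fun_prop)
    exact ((starL' ℝ : Mat n ≃L[ℝ] Mat n).contDiff.comp h).mul h
  · simp only [H.scatteringMatrix_eq]
    exact (H.isUnit_plus _ z).star.mul (H.isUnit_plus _ z)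
  · simp only [H.scatteringMatrix_eq]
    exact Matrix.posSemidef_conjTranspose_mul_self _


/-- Filling in only α_j and its conjugate puts ψ in the setting of a single pole. That the α_i are
distinct and never conjugate to each other keeps α_j away from the points still removed. -/
theorem exists_isOpen_sdiff_eq (H : HasPolesAndJump α k ψ Ep Em) (j : Fin m) :
    ∃ U : Set ℂ, IsOpen U ∧ (∀ τ ∈ U, conj τ ∈ U) ∧ α j ∈ U ∧
      U \ {α j, conj (α j)} = regularDomain α := by
  refine ⟨{τ : ℂ | τ.im ≠ 0} ∩ ⋂ i, {τ | i ≠ j → τ ≠ α i ∧ τ ≠ conj (α i)},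
    isOpen_im_ne_zero.inter (isOpen_iInter_of_finite fun i => ?_), fun τ hτ => ⟨?_, ?_⟩,
    ⟨H.nonreal j, mem_iInter.mpr fun i hi => ⟨fun e => hi (H.distinct e).symm, H.not_conj j i⟩⟩, ?_⟩
  · by_cases h : i = j
    · simp [h]
    · simpa [h] using (isOpen_ne (x := α i)).and (isOpen_ne (x := conj (α i)))
  · simpa using hτ.1
  · refine mem_iInter.mpr fun i hi => ?_
    have h := mem_iInter.mp hτ.2 i hi
    exact ⟨fun e => h.2 (by rw [← e, Complex.conj_conj]),
      fun e => h.1 ((starRingEnd ℂ).injective e)⟩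
  · ext τ
    constructor
    · rintro ⟨⟨h1, h2⟩, h3⟩
      refine ⟨h1, fun i => ?_⟩
      by_cases h : i = j
      · rw [h]
        simpa using h3
      · exact mem_iInter.mp h2 i h
    · rintro ⟨h1, h2⟩
      exact ⟨⟨h1, mem_iInter.mpr fun i _ => h2 i⟩, by simpa using h2 j⟩

/-- The soliton is the right factor g of the subtraction at α_j, so ψ φ_j⁻¹ is the regular left
factor. -/
theorem exists_soliton (H : HasPolesAndJump α k ψ Ep Em) (j : Fin m) :
    ∃ φ : Spacetime → ℂ → Mat n, (IsSolitonFrame (α j) (k j) φ ∧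
      IsNormalizedFrame ({α j, conj (α j)}ᶜ) φ) ∧
      ∃ F : Spacetime → ℂ → Mat n, IsRegularAt (α j) F ∧
        ∀ p, ∀ᶠ τ in 𝓝[≠] (α j), F p τ = ψ p τ * (φ p τ)⁻¹ := by
  obtain ⟨U, hU, hconj, hαU, hUd⟩ := H.exists_isOpen_sdiff_eq j
  obtain ⟨g, ψt, gt, ψ₁, hs, hg, -⟩ := exists_isSolitonSubtraction hU hconj hαU (H.nonreal j)
    (H.mult_pos j) (hUd ▸ H.normalized) (H.pole j) (H.no_pole j)
  refine ⟨g, ⟨hs.soliton, hg⟩, ψt, hs.regular_left.1, fun p => ?_⟩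
  filter_upwards [eventually_mem_diff_pair hU (H.nonreal j) hαU] with τ hτ
  obtain ⟨h1, h2⟩ := ne_of_mem_diff_pair hτ
  have hu := isUnit_of_reality (hs.soliton.pole_data.reality p τ h1 h2)
  rw [hs.eq_left p τ hτ, Matrix.mul_assoc, Matrix.mul_nonsing_inv _
    ((Matrix.isUnit_iff_isUnit_det _).mp hu), mul_one]

end HasPolesAndJump

end ScatteringDatum

theorem theorem10 (n : ℕ) :
    (∀ (U : Set ℂ) (α : ℂ) (k : ℕ) (ψ : Spacetime → ℂ → Mat n),
      IsOpen U → (∀ τ ∈ U, conj τ ∈ U) → α ∈ U → α.im ≠ 0 → 1 ≤ k →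
      IsNormalizedFrame (U \ {α, conj α}) ψ → HasPole α k ψ → HasNoPole (conj α) ψ →
      ∃ g ψt gt ψ₁ : Spacetime → ℂ → Mat n,
        IsSolitonSubtraction U α k ψ g ψt gt ψ₁ ∧
        IsNormalizedFrame ({α, conj α}ᶜ) g ∧
        ContDiffOn ℝ ∞ (fun q : Spacetime × ℂ => ψt q.1 q.2) (univ ×ˢ U) ∧
        ∀ g' ψt' gt' ψ₁' : Spacetime → ℂ → Mat n,
          IsSolitonSubtraction U α k ψ g' ψt' gt' ψ₁' →
          (∀ p τ, τ ≠ α → g' p τ = g p τ) ∧ (∀ p τ, τ ≠ α → gt' p τ = gt p τ) ∧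
          ∀ p, ∀ τ ∈ U, ψt' p τ = ψt p τ ∧ ψ₁' p τ = ψ₁ p τ) ∧
    (∀ (m : ℕ) (α : Fin m → ℂ) (k : Fin m → ℕ) (ψ : Spacetime → ℂ → Mat n)
      (Ep Em : Spacetime → Circle → Mat n),
      HasPolesAndJump α k ψ Ep Em →
      (∀ (z : Circle) (t : ℝ), DecaysOnLine (fun r : ℝ =>
        1 - scatteringMatrix Ep Em (r * (z : ℂ).re, r * (z : ℂ).im, t) z)) →
      ∃ (s : ℝ → Circle → Mat n) (φ : Fin m → Spacetime → ℂ → Mat n),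
        IsScatteringDatum s ∧
        (∀ j, IsSolitonFrame (α j) (k j) (φ j) ∧
          IsNormalizedFrame ({α j, conj (α j)}ᶜ) (φ j)) ∧
        HasScatteringData α k s φ ψ) := by
  constructor
  · intro U α k ψ hU hconj hαU hα hk hψ hpole hno
    obtain ⟨g, ψt, gt, ψ₁, H, hg, hs⟩ :=
      exists_isSolitonSubtraction hU hconj hαU hα hk hψ hpole hno
    exact ⟨g, ψt, gt, ψ₁, H, hg, hs, fun g' ψt' gt' ψ₁' H' => H.unique hU hconj hαU hα H'⟩
  · intro m α k ψ Ep Em H hdecay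
    choose φ hφ F hF using H.exists_soliton
    -- The datum s is the scattering matrix along the line r ↦ (r cos θ, r sin θ) at time 0.
    exact ⟨_, φ, H.isScatteringDatum fun z => hdecay z 0, hφ, Ep, Em, H,
      H.scatteringMatrix_eq_profile, fun j => ⟨F j, hF j⟩⟩
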